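/- Let \(\mathbb T^3=\mathbb R^3/(2\pi\mathbb Z)^3\) with coordinates \(x=(x^1,x^2,x^3)\), and let \(g_{\alpha\beta}(x;\epsilon)\), \(|\epsilon|<\epsilon_0\), be a family of Riemannian metrics on \(\mathbb T^3\) whose components are smooth functions of \((x,\epsilon)\), with \(g_{\alpha\beta}(x;0)=\delta_{\alpha\beta}\). Let \(e^j{}_\alpha(x;\epsilon)\) be any coframe of this family, that is, a real \(3\times3\) matrix-function, smooth in \((x,\epsilon)\) and \(2\pi\)-periodic in each \(x^\alpha\), with \(g_{\alpha\beta}=\delta_{jk}e^j{}_\alpha e^k{}_\beta\) and \(e^j{}_\alpha(x;0)=\delta^j{}_\alpha\). Let \(e_j{}^\alpha\) be the corresponding frame (the transpose of the inverse matrix), let \(\sigma^\alpha=s^je_j{}^\alpha\), where \(s^1,s^2,s^3\) are the standard Pauli matrices, let \(\sigma_\beta=g_{\beta\alpha}\sigma^\alpha\), and let \(\Gamma^\beta_{\alpha\gamma}\) be the Christoffel symbols of \(g\). The massless Dirac operator \(W(\epsilon)\) of the metric \(g(\cdot\,;\epsilon)\) with the standard spin structure is \[ W(\epsilon)=-i\,\sigma^\alpha\left(\frac{\partial}{\partial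 x^\alpha}+\frac14\,\sigma_\beta\left(\frac{\partial\sigma^\beta}{\partial x^\alpha}+\Gamma^\beta_{\alpha\gamma}\,\sigma^\gamma\right)\right) \] acting in \(L^2(\mathbb T^3;\mathbb C^2)\) with domain the Sobolev space \(H^1(\mathbb T^3;\mathbb C^2)\). Repeated indices are summed over \(1,2,3\). **Theorem 1.** For all sufficiently small \(|\epsilon|\) the operator \(W(\epsilon)\) has exactly one eigenvalue \(\lambda_0(\epsilon)\) of smallest modulus; it is real and of multiplicity two, and every other eigenvalue has strictly larger modulus. Moreover \[ \lambda_0(\epsilon)=c\,\epsilon^2+O(\epsilon^3)\qquad\text{as }\epsilon\to0, \] where \[ c=\frac{i}{16}\,\varepsilon_{\alpha\beta\gamma}\sum_{m\in\mathbb Z^3\setminus\{0\}}\left(\delta_{\mu\nu}-\frac{m_\mu m_\nu}{\|m\|^2}\right)m_\alpha\,\hat h_{\beta\mu}(m)\,\overline{\hat h_{\gamma\nu}(m)} . \] Here the series converge absolutely, \(\varepsilon_{\alpha\beta\gamma}\) is totally antisymmetric with \(\varepsilon_{123}=+1\), \(\|m\|\) is the Euclidean norm, \(h_{\alpha\beta}(x)=\partial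 g_{\alpha\beta}/\partial\epsilon\,|_{\epsilon=0}\), and \(\hat f(m)=(2\pi)^{-3}\int_{\mathbb T^3}e^{-im_\alpha x^\alpha}f(x)\,dx\). -/

import Mathlib

open MeasureTheory Filter Topology Asymptotics
open scoped ContDiff Matrix

noncomputable section

namespace TorusDirac

/-- Points of `ℝ³`; functions on the torus `𝕋³` are the `2π`-periodic functions on `ℝ³`. Only the
smooth structure and Lebesgue measure of this space are used. -/
abbrev R3 : Type := Fin 3 → ℝ

/-- `2π`-periodicity in each of the three coordinates. -/
def Periodic3 {E : Type*} (f : R3 → E) : Prop :=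
  ∀ (x : R3) (α : Fin 3), f (x + Pi.single α (2 * Real.pi)) = f x

/-- The partial derivative `∂f/∂x^α`. -/
def pd {E : Type*} [NormedAddCommGroup E] [NormedSpace ℝ E] (α : Fin 3) (f : R3 → E) (x : R3) : E :=
  fderiv ℝ f x (Pi.single α 1)

/-- The fundamental cell `(0, 2π]³`. -/
def cell : Set R3 := Set.pi Set.univ fun _ => Set.Ioc 0 (2 * Real.pi)

/-- Lebesgue measure `dx` on the torus, realised on the fundamental cell. -/
def torusMeasure : Measure R3 := (volume : Measure R3).restrict cell

/-- The Hilbert space `L²(𝕋³; ℂ²)`. -/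
abbrev SpinorL2 : Type := Lp (EuclideanSpace ℂ (Fin 2)) 2 torusMeasure

/-- `w` is the weak partial derivative of `u` along `x^α` on the torus: the test functions are the
smooth periodic functions. -/
def IsWeakDeriv (α : Fin 3) (u w : SpinorL2) : Prop :=
  ∀ φ : R3 → ℂ, ContDiff ℝ ∞ φ → Periodic3 φ →
    ∫ x, pd α φ x • u x ∂torusMeasure = -∫ x, φ x • w x ∂torusMeasure

/-! ### The massless Dirac operator -/

/-- The standard Pauli matrices `s^j`. -/
def pauli (j : Fin 3) : Matrix (Fin 2) (Fin 2) ℂ :=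
  ![!![0, 1; 1, 0], !![0, -Complex.I; Complex.I, 0], !![1, 0; 0, -1]] j

/-- The frame `e_j^α` of a coframe `e^j_α` (rows of `e x` are indexed by `j`): the transpose of the
inverse matrix. -/
def frame (e : R3 → Matrix (Fin 3) (Fin 3) ℝ) (j α : Fin 3) (x : R3) : ℝ :=
  ((e x)⁻¹)ᵀ j α

/-- The Pauli matrices `σ^α = s^j e_j^α` of the coframe `e`. -/
def sigmaUp (e : R3 → Matrix (Fin 3) (Fin 3) ℝ) (α : Fin 3) (x : R3) : Matrix (Fin 2) (Fin 2) ℂ :=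
  ∑ j, (frame e j α x : ℂ) • pauli j

/-- `σ_β = g_{βα} σ^α`. -/
def sigmaDown (g e : R3 → Matrix (Fin 3) (Fin 3) ℝ) (β : Fin 3) (x : R3) :
    Matrix (Fin 2) (Fin 2) ℂ :=
  ∑ α, (g x β α : ℂ) • sigmaUp e α x

/-- The entrywise partial derivative `∂σ^β/∂x^α`. -/
def pdSigmaUp (e : R3 → Matrix (Fin 3) (Fin 3) ℝ) (α β : Fin 3) (x : R3) :
    Matrix (Fin 2) (Fin 2) ℂ :=
  Matrix.of fun a b => pd α (fun y => sigmaUp e β y a b) x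

/-- The Christoffel symbol `Γ^β_{αγ}` of the metric `g`. -/
def christoffel (g : R3 → Matrix (Fin 3) (Fin 3) ℝ) (β α γ : Fin 3) (x : R3) : ℝ :=
  (1 / 2) * ∑ δ, (g x)⁻¹ β δ *
    (pd α (fun y => g y γ δ) x + pd γ (fun y => g y α δ) x - pd δ (fun y => g y α γ) x)

/-- The spin connection `(1/4) σ_β (∂σ^β/∂x^α + Γ^β_{αγ} σ^γ)`. -/
def spinConnection (g e : R3 → Matrix (Fin 3) (Fin 3) ℝ) (α : Fin 3) (x : R3) :
    Matrix (Fin 2) (Fin 2) ℂ :=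
  (1 / 4 : ℂ) • ∑ β, sigmaDown g e β x *
    (pdSigmaUp e α β x + ∑ γ, (christoffel g β α γ x : ℂ) • sigmaUp e γ x)

/-- The pointwise expression `-i σ^α (w_α + ω_α u)` at the point `x`, where `ω` is the spin
connection, `u` is the value of the spinor and `w α` that of its derivative along `x^α`. -/
def diracSymbol (g e : R3 → Matrix (Fin 3) (Fin 3) ℝ) (x : R3)
    (w : Fin 3 → EuclideanSpace ℂ (Fin 2)) (u : EuclideanSpace ℂ (Fin 2)) :
    EuclideanSpace ℂ (Fin 2) :=
  (-Complex.I) • ∑ α, Matrix.toEuclideanLin (sigmaUp e α x)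
    (w α + Matrix.toEuclideanLin (spinConnection g e α x) u)

lemma integrable_smul_spinor (φ : R3 → ℂ) (hφ : Continuous φ) (u : SpinorL2) :
    Integrable (fun x => φ x • u x) torusMeasure := by
  have hfin : IsFiniteMeasure torusMeasure := by
    refine ⟨?_⟩
    rw [torusMeasure, Measure.restrict_apply_univ, cell, Real.volume_pi_Ioc]
    exact ENNReal.prod_lt_top fun _ _ => ENNReal.ofReal_lt_top
  have hu : Integrable (fun x => u x) torusMeasure :=
    (Lp.memLp u).integrable (by norm_num)
  have hcomp : IsCompact (Set.pi Set.univ fun _ : Fin 3 => Set.Icc (0 : ℝ) (2 * Real.pi)) :=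
    isCompact_univ_pi fun _ => isCompact_Icc
  obtain ⟨C, hC⟩ := hcomp.exists_bound_of_continuousOn hφ.continuousOn
  refine hu.bdd_smul C hφ.aestronglyMeasurable ?_
  have hm : MeasurableSet cell := MeasurableSet.univ_pi fun _ => measurableSet_Ioc
  filter_upwards [ae_restrict_mem (μ := (volume : Measure R3)) hm] with x hx
  exact hC x fun i hi => Set.Ioc_subset_Icc_self (hx i hi)

lemma continuous_pd (α : Fin 3) (φ : R3 → ℂ) (hφ : ContDiff ℝ ∞ φ) : Continuous (pd α φ) :=
  (hφ.continuous_fderiv (by simp)).clm_apply continuous_const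

lemma IsWeakDeriv.zero (α : Fin 3) : IsWeakDeriv α 0 0 := by
  intro φ _ _
  have h : ∀ ψ : R3 → ℂ, ∫ x, ψ x • (0 : SpinorL2) x ∂torusMeasure = 0 := by
    intro ψ
    refine integral_eq_zero_of_ae ?_
    filter_upwards [Lp.coeFn_zero (EuclideanSpace ℂ (Fin 2)) 2 torusMeasure] with x hx
    rw [hx]
    exact smul_zero _
  rw [h, h, neg_zero]

lemma IsWeakDeriv.add {α : Fin 3} {u w u' w' : SpinorL2} (h : IsWeakDeriv α u w)
    (h' : IsWeakDeriv α u' w') : IsWeakDeriv α (u + u') (w + w') := by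
  intro φ hφ hp
  have key : ∀ ψ : R3 → ℂ, Continuous ψ → ∀ a b : SpinorL2,
      ∫ x, ψ x • (a + b : SpinorL2) x ∂torusMeasure
        = ∫ x, ψ x • a x ∂torusMeasure + ∫ x, ψ x • b x ∂torusMeasure := by
    intro ψ hψ a b
    rw [← integral_add (integrable_smul_spinor ψ hψ a) (integrable_smul_spinor ψ hψ b)]
    refine integral_congr_ae ?_
    filter_upwards [Lp.coeFn_add a b] with x hx
    rw [hx]
    exact smul_add _ _ _
  rw [key _ (continuous_pd α φ hφ), key _ hφ.continuous, h φ hφ hp, h' φ hφ hp, neg_add]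

lemma IsWeakDeriv.smul {α : Fin 3} {u w : SpinorL2} (c : ℂ) (h : IsWeakDeriv α u w) :
    IsWeakDeriv α (c • u) (c • w) := by
  intro φ hφ hp
  have key : ∀ (ψ : R3 → ℂ) (a : SpinorL2),
      ∫ x, ψ x • (c • a : SpinorL2) x ∂torusMeasure = c • ∫ x, ψ x • a x ∂torusMeasure := by
    intro ψ a
    rw [← integral_smul]
    refine integral_congr_ae ?_
    filter_upwards [Lp.coeFn_smul c a] with x hx
    simp [hx, smul_comm c]
  rw [key, key, h φ hφ hp, smul_neg]

/-- The graph of the massless Dirac operator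
`W = -i σ^α (∂/∂x^α + (1/4) σ_β (∂σ^β/∂x^α + Γ^β_{αγ} σ^γ))` of the metric `g`, written in the
coframe `e`, as an operator in `L²(𝕋³; ℂ²)` with domain `H¹(𝕋³; ℂ²)`: it consists of the pairs
`(u, W u)`, where `u` has weak partial derivatives in `L²`. -/
def diracGraph (g e : R3 → Matrix (Fin 3) (Fin 3) ℝ) : Submodule ℂ (SpinorL2 × SpinorL2) where
  carrier := {p | ∃ w : Fin 3 → SpinorL2, (∀ α, IsWeakDeriv α p.1 (w α)) ∧
    ∀ᵐ x ∂torusMeasure, p.2 x = diracSymbol g e x (fun α => w α x) (p.1 x)}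
  zero_mem' := by
    refine ⟨0, fun α => IsWeakDeriv.zero α, ?_⟩
    filter_upwards [Lp.coeFn_zero (EuclideanSpace ℂ (Fin 2)) 2 torusMeasure] with x hx
    have hx0 : (0 : SpinorL2) x = 0 := hx
    change (0 : SpinorL2) x = diracSymbol g e x (fun _ => (0 : SpinorL2) x) ((0 : SpinorL2) x)
    rw [hx0]
    simp [diracSymbol]
  add_mem' := by
    rintro ⟨u, f⟩ ⟨u', f'⟩ ⟨w, hw, hf⟩ ⟨w', hw', hf'⟩
    refine ⟨w + w', fun α => (hw α).add (hw' α), ?_⟩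
    have hall : ∀ᵐ x ∂torusMeasure, ∀ α, (w α + w' α : SpinorL2) x = w α x + w' α x :=
      ae_all_iff.2 fun α => Lp.coeFn_add (w α) (w' α)
    filter_upwards [hf, hf', hall, Lp.coeFn_add u u', Lp.coeFn_add f f'] with x h1 h2 h3 h4 h5
    simp only [Prod.mk_add_mk, Pi.add_apply] at *
    rw [h5, h4, h1, h2]
    simp only [h3, diracSymbol, ← smul_add, ← Finset.sum_add_distrib, map_add]
    congr 1
    exact Finset.sum_congr rfl fun α _ => by abel
  smul_mem' := by
    rintro c ⟨u, f⟩ ⟨w, hw, hf⟩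
    refine ⟨c • w, fun α => (hw α).smul c, ?_⟩
    have hall : ∀ᵐ x ∂torusMeasure, ∀ α, (c • w α : SpinorL2) x = c • w α x :=
      ae_all_iff.2 fun α => Lp.coeFn_smul c (w α)
    filter_upwards [hf, hall, Lp.coeFn_smul c u, Lp.coeFn_smul c f] with x h1 h3 h4 h5
    simp only [Prod.smul_mk, Pi.smul_apply] at *
    rw [h5, h4, h1]
    simp only [h3, diracSymbol, map_smul, ← smul_add, ← Finset.smul_sum]
    rw [smul_comm]

/-- The eigenspace `{u ∈ H¹ : W u = μ u}` of the massless Dirac operator. -/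
def eigenspace (g e : R3 → Matrix (Fin 3) (Fin 3) ℝ) (μ : ℂ) : Submodule ℂ SpinorL2 :=
  (diracGraph g e).comap (LinearMap.prod LinearMap.id (μ • LinearMap.id))

/-- `μ` is an eigenvalue of the massless Dirac operator. -/
def IsEigenvalue (g e : R3 → Matrix (Fin 3) (Fin 3) ℝ) (μ : ℂ) : Prop :=
  eigenspace g e μ ≠ ⊥

/-! ### Families of metrics and coframes -/

/-- A smooth one-parameter family of Riemannian metrics on `𝕋³`, defined for `|ε| < ε₀` and equal
to the Euclidean metric at `ε = 0`. -/
structure IsMetricFamily (ε₀ : ℝ) (g : ℝ → R3 → Matrix (Fin 3) (Fin 3) ℝ) : Prop where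
  smooth : ∀ α β, ContDiffOn ℝ ∞ (fun p : ℝ × R3 => g p.1 p.2 α β)
    (Set.Ioo (-ε₀) ε₀ ×ˢ Set.univ)
  periodic : ∀ ε ∈ Set.Ioo (-ε₀) ε₀, Periodic3 (g ε)
  posDef : ∀ ε ∈ Set.Ioo (-ε₀) ε₀, ∀ x, (g ε x).PosDef
  euclidean : ∀ x, g 0 x = 1

/-- A smooth family of coframes on `𝕋³` for the family of metrics `g`, equal to the identity at
`ε = 0`: `g_{αβ} = δ_{jk} e^j_α e^k_β`. -/
structure IsCoframeFamily (ε₀ : ℝ) (g e : ℝ → R3 → Matrix (Fin 3) (Fin 3) ℝ) : Prop where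
  smooth : ∀ j α, ContDiffOn ℝ ∞ (fun p : ℝ × R3 => e p.1 p.2 j α)
    (Set.Ioo (-ε₀) ε₀ ×ˢ Set.univ)
  periodic : ∀ ε ∈ Set.Ioo (-ε₀) ε₀, Periodic3 (e ε)
  metric : ∀ ε ∈ Set.Ioo (-ε₀) ε₀, ∀ x, g ε x = (e ε x)ᵀ * e ε x
  identity : ∀ x, e 0 x = 1

/-! ### The coefficient -/

/-- `h_{αβ}(x) = ∂g_{αβ}/∂ε` at `ε = 0`. -/
def hTensor (g : ℝ → R3 → Matrix (Fin 3) (Fin 3) ℝ) (α β : Fin 3) (x : R3) : ℝ :=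
  deriv (fun ε => g ε x α β) 0

/-- The Fourier coefficient `(2π)⁻³ ∫ e^{-i m·x} f(x) dx`. -/
def fourierCoeff3 (f : R3 → ℂ) (m : Fin 3 → ℤ) : ℂ :=
  (1 / (2 * (Real.pi : ℂ)) ^ 3) *
    ∫ x, Complex.exp (-Complex.I * ∑ α, (m α : ℂ) * (x α : ℂ)) * f x ∂torusMeasure

/-- The Fourier coefficients of `h`. -/
def hHat (g : ℝ → R3 → Matrix (Fin 3) (Fin 3) ℝ) (α β : Fin 3) (m : Fin 3 → ℤ) : ℂ :=
  fourierCoeff3 (fun x => (hTensor g α β x : ℂ)) m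

/-- The totally antisymmetric symbol (the indices `1, 2, 3` are written `0, 1, 2`). -/
def antisymbol (α β γ : Fin 3) : ℂ :=
  if (α, β, γ) = (0, 1, 2) ∨ (α, β, γ) = (1, 2, 0) ∨ (α, β, γ) = (2, 0, 1) then 1
  else if (α, β, γ) = (0, 2, 1) ∨ (α, β, γ) = (2, 1, 0) ∨ (α, β, γ) = (1, 0, 2) then -1
  else 0

/-- The summand
`(δ_{μν} - m_μ m_ν / ‖m‖²) m_α ĥ_{βμ}(m) conj(ĥ_{γν}(m))`, summed over `μ`, `ν`. -/
def coeffTerm (g : ℝ → R3 → Matrix (Fin 3) (Fin 3) ℝ) (α β γ : Fin 3)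
    (m : {m : Fin 3 → ℤ // m ≠ 0}) : ℂ :=
  ∑ μ, ∑ ν, ((if μ = ν then 1 else 0) - (m.1 μ : ℂ) * (m.1 ν : ℂ) / ∑ κ, (m.1 κ : ℂ) ^ 2) *
    (m.1 α : ℂ) * hHat g β μ m.1 * (starRingEnd ℂ) (hHat g γ ν m.1)

/-- The constant `c`. -/
def coeffC (g : ℝ → R3 → Matrix (Fin 3) (Fin 3) ℝ) : ℂ :=
  (Complex.I / 16) * ∑ α, ∑ β, ∑ γ, antisymbol α β γ * ∑' m, coeffTerm g α β γ m

end TorusDirac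

end

/-!
# The lowest eigenvalue of the massless Dirac operator on a perturbed torus

*Reduction to bounded operators.* In terms of the coframe `e`, the Dirac operator multiplied by
the density `det e` is
`-i Σ c_{jα} s^j ∂_α - (i/2) Σ (∂_α c_{jα}) s^j + F`,
where `c_{jα}` are the cofactors of `e` and `F = (1/4) Σ_k ε_{αβγ} e^k_α ∂_β e^k_γ` is the density
of the axial torsion (`det_smul_diracSymbol`). The coefficients are polynomial in `e` and its
first derivatives, the operator is formally self-adjoint with respect to Lebesgue measure, and it
commutes with charge conjugation. Let `D = -i s^α ∂_α` be the flat operator and `P` the projection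
onto its kernel, the constant spinors. The operator `J = P + D⁻¹ (1 - P)` maps `L²` bijectively
onto `H¹` (`sobolevIso`), so that with `u = J f` the eigenvalue equation becomes `L f = μ G f`
with bounded `L` and `G` (`mem_eigenspace_iff`). Everything about `H¹` and about `J` is read off
from Fourier coefficients, where a weak derivative is multiplication by `i m_α`
(`isWeakDeriv_iff`).

*Perturbation theory.* For small `ε` the pencil `L - μ G` is a perturbation of size `δ = O(ε)` of
`(1 - P) - μ J` (`exists_smallPencil`). For `μ` in a fixed disc, `(1 - P)(L - μ G) f = 0` has
exactly one solution `f` with a prescribed constant part, so there remains an equation in the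
two-dimensional space of constant spinors. For real `μ` its matrix is Hermitian and commutes with
charge conjugation, a quaternionic structure, hence it is a real scalar, close to `-μ`. The
intermediate value theorem gives a zero `λ` (`SmallPencil.exists_eigenvalue`), and the kernel
there is the whole two-dimensional space (`SmallPencil.finrank_eq_two`). No other, possibly
complex, `μ` of the disc is an eigenvalue, because eigenvectors for different eigenvalues are
orthogonal in the pairing `⟨J f, G f'⟩`, whereas solutions with the same constant part are not
(`SmallPencil.eigenvalue_unique`). Moreover
`λ = ⟨L c, c⟩ - ⟨J (1 - P) L c, L c⟩ + O(δ³)`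
for each constant unit spinor `c`, provided that `⟨L c, c⟩ = O(δ²)`
(`SmallPencil.norm_eigenvalue_sub_le`).

*The coefficient.* For the Dirac operator `⟨L c, c⟩` is the mean of `F`. The part of `F` linear in
`e - 1` is a sum of derivatives and has mean zero, so the mean of `F` is `ε²` times the mean of
the quadratic expression `F` in the first variation `a` of the coframe, up to `O(ε³)`
(`isBigO_inner_diracOp`). By Parseval's identity both this mean and the average of `⟨D⁻¹ ψ, ψ⟩`
over the two constant spinors, with `ψ` the first-order part of `L c`, are sums over the
frequencies `m`. The two sums combine termwise, by a polynomial identity in the Fourier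
coefficients of `a` (`coefficient_identity`), to an expression that depends on `h = a + aᵀ` only,
which is the coefficient (`coeffC_eq`).
-/

open MeasureTheory Filter Topology Asymptotics
open scoped ContDiff Matrix

noncomputable section

namespace TorusDirac

/-! ### Perturbation of a doubly degenerate zero eigenvalue -/

section Pencil

variable {H : Type*} [NormedAddCommGroup H] [InnerProductSpace ℂ H]

/-- The orthogonal projection onto the span of an orthonormal pair. -/
def pairProj (c₁ c₂ : H) : H →L[ℂ] H :=
  (innerSL ℂ c₁).smulRight c₁ + (innerSL ℂ c₂).smulRight c₂

lemma pairProj_apply (c₁ c₂ f : H) :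
    pairProj c₁ c₂ f = inner ℂ c₁ f • c₁ + inner ℂ c₂ f • c₂ := by
  simp [pairProj]

/-- A pencil `L - μ G` that is a `δ`-perturbation of `(1 - P) - μ J`, where `P` is the orthogonal
projection onto the span of the orthonormal pair `c₁, c₂`, with the symmetries of a Dirac operator:
`L` and `G` are Hermitian when paired through `J`, and both commute with the antilinear
map `C`, which acts on the span of `c₁, c₂` as a quaternionic structure. The operator `J` stands for
the isomorphism of the underlying space onto the domain of the Dirac operator, so that the
eigenvectors are `J f` with `L f = μ G f`. -/
structure SmallPencil (c₁ c₂ : H) (J L G : H →L[ℂ] H) (C : H →L⋆[ℂ] H) (K δ : ℝ) : Prop where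
  norm₁ : ‖c₁‖ = 1
  norm₂ : ‖c₂‖ = 1
  orth : inner ℂ c₁ c₂ = 0
  J₁ : J c₁ = c₁
  J₂ : J c₂ = c₂
  PJ : ∀ f, pairProj c₁ c₂ (J f) = pairProj c₁ c₂ f
  one_le : 1 ≤ K
  normJ : ‖J‖ ≤ K
  normL : ‖L - (1 - pairProj c₁ c₂)‖ ≤ δ
  normG : ‖G - J‖ ≤ δ
  symmL : ∀ f f', inner ℂ (J f) (L f') = inner ℂ (L f) (J f')
  symmG : ∀ f f', inner ℂ (J f) (G f') = inner ℂ (G f) (J f')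
  C₁ : C c₁ = c₂
  C₂ : C c₂ = -c₁
  CP : ∀ f, C (pairProj c₁ c₂ f) = pairProj c₁ c₂ (C f)
  CL : ∀ f, C (L f) = L (C f)
  CG : ∀ f, C (G f) = G (C f)
  small : 100 * K ^ 2 * δ ≤ 1

namespace SmallPencil

variable {c₁ c₂ : H} {J L G : H →L[ℂ] H} {C : H →L⋆[ℂ] H} {K δ : ℝ}

lemma delta_nonneg (h : SmallPencil c₁ c₂ J L G C K δ) : 0 ≤ δ := (norm_nonneg _).trans h.normG

lemma delta_le (h : SmallPencil c₁ c₂ J L G C K δ) : 100 * δ ≤ 1 := by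
  have := h.small
  have h1 := h.one_le
  have h0 := h.delta_nonneg
  nlinarith [mul_nonneg h0 (sub_nonneg.2 h1),
    mul_nonneg (mul_nonneg h0 (sub_nonneg.2 h1)) (by linarith : 0 ≤ K)]

lemma delta_le' (h : SmallPencil c₁ c₂ J L G C K δ) : 100 * K * δ ≤ 1 := by
  have := h.small
  have h1 := h.one_le
  have h0 := h.delta_nonneg
  nlinarith [mul_nonneg (mul_nonneg h0 (sub_nonneg.2 h1)) (by linarith : 0 ≤ K)]

lemma orth' (h : SmallPencil c₁ c₂ J L G C K δ) : inner ℂ c₂ c₁ = 0 := by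
  rw [← inner_conj_symm, h.orth, map_zero]

lemma P₁ (h : SmallPencil c₁ c₂ J L G C K δ) : pairProj c₁ c₂ c₁ = c₁ := by
  simp [pairProj_apply, h.orth', inner_self_eq_norm_sq_to_K, h.norm₁]

lemma P₂ (h : SmallPencil c₁ c₂ J L G C K δ) : pairProj c₁ c₂ c₂ = c₂ := by
  simp [pairProj_apply, h.orth, inner_self_eq_norm_sq_to_K, h.norm₂]

lemma PP (h : SmallPencil c₁ c₂ J L G C K δ) (f : H) :
    pairProj c₁ c₂ (pairProj c₁ c₂ f) = pairProj c₁ c₂ f := by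
  rw [pairProj_apply c₁ c₂ f, map_add, map_smul, map_smul, h.P₁, h.P₂]

lemma JP (h : SmallPencil c₁ c₂ J L G C K δ) (f : H) :
    J (pairProj c₁ c₂ f) = pairProj c₁ c₂ f := by
  rw [pairProj_apply c₁ c₂ f, map_add, map_smul, map_smul, h.J₁, h.J₂]

lemma inner_P (f f' : H) :
    inner ℂ (pairProj c₁ c₂ f) f' = inner ℂ f (pairProj c₁ c₂ f') := by
  simp only [pairProj_apply, inner_add_left, inner_add_right, inner_smul_left, inner_smul_right,
    inner_conj_symm]
  ring

lemma inner_of_P {c : H} (hc : pairProj c₁ c₂ c = c) (f : H) :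
    inner ℂ c f = inner ℂ c (pairProj c₁ c₂ f) := by
  rw [← inner_P, hc]

lemma norm_Q_le (h : SmallPencil c₁ c₂ J L G C K δ) (f : H) :
    ‖f - pairProj c₁ c₂ f‖ ≤ ‖f‖ := by
  have key : inner ℂ (f - pairProj c₁ c₂ f) (pairProj c₁ c₂ f) = 0 := by
    rw [inner_sub_left, inner_P, h.PP, sub_self]
  have := norm_add_sq_eq_norm_sq_add_norm_sq_of_inner_eq_zero _ _ key
  rw [sub_add_cancel] at this
  nlinarith [norm_nonneg (f - pairProj c₁ c₂ f), norm_nonneg f, norm_nonneg (pairProj c₁ c₂ f)]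

variable (c₁ c₂ L G) in
/-- The operator `P + (1 - P)(L - μ G)`, whose inverse parametrises the solutions of
`(1 - P)(L - μ G) f = 0` by `P f`. -/
def reduced (μ : ℂ) : H →L[ℂ] H :=
  pairProj c₁ c₂ + (1 - pairProj c₁ c₂) ∘L (L - μ • G)

lemma reduced_apply (μ : ℂ) (f : H) : reduced c₁ c₂ L G μ f =
    pairProj c₁ c₂ f + ((L f - μ • G f) - pairProj c₁ c₂ (L f - μ • G f)) := by
  simp [reduced, smul_sub]
  abel

/-- In the disc `‖μ‖ ≤ 1 / (4 K)` the term `μ J` has norm at most `1/4`, so that `reduced` stays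
within `1/2` of the identity. -/
lemma norm_reduced_sub (h : SmallPencil c₁ c₂ J L G C K δ) {μ : ℂ} (hμ : ‖μ‖ ≤ 1 / (4 * K)) :
    ‖1 - reduced c₁ c₂ L G μ‖ ≤ 1 / 2 := by
  have hK := h.one_le
  have hμ' : ‖μ‖ * K ≤ 1 / 4 := by
    rw [le_div_iff₀ (by linarith)] at hμ; linarith
  have hμ1 : ‖μ‖ ≤ 1 / 4 := by nlinarith [norm_nonneg μ]
  have h0 := h.delta_nonneg
  have hδ := h.delta_le
  refine ContinuousLinearMap.opNorm_le_bound _ (by norm_num) fun f => ?_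
  have e : (1 - reduced c₁ c₂ L G μ) f = -(((L - (1 - pairProj c₁ c₂)) f - μ • G f)
      - pairProj c₁ c₂ ((L - (1 - pairProj c₁ c₂)) f - μ • G f)) := by
    rw [sub_apply, reduced_apply]
    simp only [sub_apply, one_apply_eq_self, map_sub, h.PP, map_smul]
    abel
  rw [e, norm_neg]
  refine (h.norm_Q_le _).trans ((norm_sub_le _ _).trans ?_)
  have h1 : ‖(L - (1 - pairProj c₁ c₂)) f‖ ≤ δ * ‖f‖ :=
    ContinuousLinearMap.le_of_opNorm_le _ h.normL f
  have h2 : ‖G f‖ ≤ (K + δ) * ‖f‖ := by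
    have : G f = J f + (G - J) f := by simp
    rw [this, add_mul]
    exact (norm_add_le _ _).trans (add_le_add (ContinuousLinearMap.le_of_opNorm_le _ h.normJ f)
      (ContinuousLinearMap.le_of_opNorm_le _ h.normG f))
  rw [norm_smul]
  have h3 := mul_le_mul_of_nonneg_left h2 (norm_nonneg μ)
  have hf := norm_nonneg f
  have : ‖μ‖ * δ ≤ 1 / 4 * δ := mul_le_mul_of_nonneg_right hμ1 h0
  have : ‖μ‖ * ((K + δ) * ‖f‖) ≤ (1 / 4 + 1 / 4 * δ) * ‖f‖ := by
    rw [← mul_assoc]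
    exact mul_le_mul_of_nonneg_right (by nlinarith) hf
  nlinarith

/-- Vectors close to `c ∈ ran P` pair through `J` and `G` to approximately `‖c‖²`. -/
lemma norm_inner_sub_le (h : SmallPencil c₁ c₂ J L G C K δ) {c f f' : H}
    (hc : pairProj c₁ c₂ c = c) (hPf : pairProj c₁ c₂ f = c)
    (hf : ‖f - c‖ ≤ 4 * δ * ‖c‖) (hf' : ‖f' - c‖ ≤ 4 * δ * ‖c‖) :
    ‖inner ℂ (J f') (G f) - (‖c‖ ^ 2 : ℝ)‖ ≤ 9 * K ^ 2 * δ * ‖c‖ ^ 2 := by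
  have h0 := h.delta_nonneg
  have hδ := h.delta_le
  have hK := h.one_le
  have hn := norm_nonneg c
  have bd : ∀ g : H, ‖g - c‖ ≤ 4 * δ * ‖c‖ → ‖g‖ ≤ 3 / 2 * ‖c‖ := by
    intro g hg
    have : ‖g‖ ≤ ‖g - c‖ + ‖c‖ := by simpa using norm_add_le (g - c) c
    nlinarith
  have hJ : J c = c := by rw [← hc, h.JP]
  have e : inner ℂ (J f') (G f) - (‖c‖ ^ 2 : ℝ)
      = inner ℂ (J f') ((G - J) f) + inner ℂ (J (f' - c)) (J f) := by
    have : inner ℂ c (J f) = ((‖c‖ ^ 2 : ℝ) : ℂ) := by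
      rw [inner_of_P hc, h.PJ, hPf, inner_self_eq_norm_sq_to_K]; norm_cast
    rw [map_sub, inner_sub_left, hJ, this, sub_apply, inner_sub_right]
    ring
  rw [e]
  have hJle : ∀ g, ‖J g‖ ≤ K * ‖g‖ := fun g => ContinuousLinearMap.le_of_opNorm_le _ h.normJ g
  have hGle : ∀ g, ‖(G - J) g‖ ≤ δ * ‖g‖ := fun g =>
    ContinuousLinearMap.le_of_opNorm_le _ h.normG g
  have t1 : ‖inner ℂ (J f') ((G - J) f)‖ ≤ (K * (3 / 2 * ‖c‖)) * (δ * (3 / 2 * ‖c‖)) := by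
    refine (norm_inner_le_norm _ _).trans (mul_le_mul ?_ ?_ (norm_nonneg _) (by positivity))
    · exact (hJle _).trans (by gcongr; exact bd _ hf')
    · exact (hGle _).trans (by gcongr; exact bd _ hf)
  have t2 : ‖inner ℂ (J (f' - c)) (J f)‖ ≤ (K * (4 * δ * ‖c‖)) * (K * (3 / 2 * ‖c‖)) := by
    refine (norm_inner_le_norm _ _).trans (mul_le_mul ?_ ?_ (norm_nonneg _) (by positivity))
    · exact (hJle _).trans (by gcongr)
    · exact (hJle _).trans (by gcongr; exact bd _ hf)
  refine (norm_add_le _ _).trans ((add_le_add t1 t2).trans ?_)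
  have : K * δ * ‖c‖ ^ 2 ≤ K ^ 2 * δ * ‖c‖ ^ 2 := by
    gcongr; nlinarith
  have : 0 ≤ K ^ 2 * δ * ‖c‖ ^ 2 := by positivity
  nlinarith

variable [CompleteSpace H]

lemma isUnit_reduced (h : SmallPencil c₁ c₂ J L G C K δ) {μ : ℂ} (hμ : ‖μ‖ ≤ 1 / (4 * K)) :
    IsUnit (reduced c₁ c₂ L G μ) := by
  have := isUnit_one_sub_of_norm_lt_one
    (lt_of_le_of_lt (h.norm_reduced_sub hμ) (by norm_num : (1 : ℝ) / 2 < 1))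
  rwa [sub_sub_cancel] at this

variable (c₁ c₂ L G) in
/-- The solution `f` of `(1 - P)(L - μ G) f = 0` with prescribed projection `P f`. -/
def lift (μ : ℂ) : H →L[ℂ] H := Ring.inverse (reduced c₁ c₂ L G μ)

lemma reduced_lift (h : SmallPencil c₁ c₂ J L G C K δ) {μ : ℂ} (hμ : ‖μ‖ ≤ 1 / (4 * K)) (c : H) :
    reduced c₁ c₂ L G μ (lift c₁ c₂ L G μ c) = c := by
  have := Ring.mul_inverse_cancel _ (h.isUnit_reduced hμ)
  exact DFunLike.congr_fun this c

lemma lift_reduced (h : SmallPencil c₁ c₂ J L G C K δ) {μ : ℂ} (hμ : ‖μ‖ ≤ 1 / (4 * K)) (c : H) :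
    lift c₁ c₂ L G μ (reduced c₁ c₂ L G μ c) = c := by
  have := Ring.inverse_mul_cancel _ (h.isUnit_reduced hμ)
  exact DFunLike.congr_fun this c

lemma P_lift (h : SmallPencil c₁ c₂ J L G C K δ) {μ : ℂ} (hμ : ‖μ‖ ≤ 1 / (4 * K)) {c : H}
    (hc : pairProj c₁ c₂ c = c) : pairProj c₁ c₂ (lift c₁ c₂ L G μ c) = c := by
  have := congrArg (pairProj c₁ c₂) (h.reduced_lift hμ c)
  rw [reduced_apply, map_add, map_sub, h.PP, h.PP, sub_self, add_zero, hc] at this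
  exact this

/-- The reduced equation leaves a residual in the span of `c₁, c₂` only. -/
lemma P_residual (h : SmallPencil c₁ c₂ J L G C K δ) {μ : ℂ} (hμ : ‖μ‖ ≤ 1 / (4 * K)) {c : H}
    (hc : pairProj c₁ c₂ c = c) :
    pairProj c₁ c₂ (L (lift c₁ c₂ L G μ c) - μ • G (lift c₁ c₂ L G μ c)) =
      L (lift c₁ c₂ L G μ c) - μ • G (lift c₁ c₂ L G μ c) := by
  have := h.reduced_lift hμ c
  rw [reduced_apply, h.P_lift hμ hc, add_eq_left, sub_eq_zero] at this
  exact this.symm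

lemma eq_lift (h : SmallPencil c₁ c₂ J L G C K δ) {μ : ℂ} (hμ : ‖μ‖ ≤ 1 / (4 * K)) {f : H}
    (hf : L f = μ • G f) : f = lift c₁ c₂ L G μ (pairProj c₁ c₂ f) := by
  conv_lhs => rw [← h.lift_reduced hμ f, reduced_apply, hf]
  simp

/-- The lift moves vectors of the span by `O(δ)` only, uniformly in `μ`, since for `L = 1 - P` and
`G = J` it is the identity there. -/
lemma norm_lift_sub_le (h : SmallPencil c₁ c₂ J L G C K δ) {μ : ℂ} (hμ : ‖μ‖ ≤ 1 / (4 * K)) {c : H}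
    (hc : pairProj c₁ c₂ c = c) : ‖lift c₁ c₂ L G μ c - c‖ ≤ 4 * δ * ‖c‖ := by
  have h0 := h.delta_nonneg
  have hK := h.one_le
  have hμ1 : ‖μ‖ ≤ 1 := hμ.trans (by rw [div_le_one (by linarith)]; linarith)
  set x := lift c₁ c₂ L G μ c - c with hx
  have h1 : reduced c₁ c₂ L G μ x = -(((L - (1 - pairProj c₁ c₂)) c - μ • (G - J) c)
      - pairProj c₁ c₂ ((L - (1 - pairProj c₁ c₂)) c - μ • (G - J) c)) := by
    have hJ : J c = c := by rw [← hc, h.JP]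
    rw [hx, map_sub, h.reduced_lift hμ, reduced_apply, hc]
    simp only [sub_apply, one_apply_eq_self, map_sub, hc, map_smul, hJ,
      smul_sub]
    abel
  have h2 : ‖reduced c₁ c₂ L G μ x‖ ≤ 2 * δ * ‖c‖ := by
    rw [h1, norm_neg]
    refine (h.norm_Q_le _).trans ((norm_sub_le _ _).trans ?_)
    have h1 := ContinuousLinearMap.le_of_opNorm_le _ h.normL c
    have h2 := ContinuousLinearMap.le_of_opNorm_le _ h.normG c
    rw [norm_smul]
    have : ‖μ‖ * ‖(G - J) c‖ ≤ 1 * (δ * ‖c‖) :=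
      mul_le_mul hμ1 h2 (norm_nonneg _) zero_le_one
    linarith
  have h3 : ‖x - reduced c₁ c₂ L G μ x‖ ≤ 1 / 2 * ‖x‖ :=
    ContinuousLinearMap.le_of_opNorm_le _ (h.norm_reduced_sub hμ) x
  have h4 : ‖x‖ ≤ ‖x - reduced c₁ c₂ L G μ x‖ + ‖reduced c₁ c₂ L G μ x‖ := by
    simpa using norm_add_le (x - reduced c₁ c₂ L G μ x) (reduced c₁ c₂ L G μ x)
  linarith

lemma C_lift (h : SmallPencil c₁ c₂ J L G C K δ) {μ : ℝ} (hμ : ‖(μ : ℂ)‖ ≤ 1 / (4 * K)) (c : H) :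
    C (lift c₁ c₂ L G μ c) = lift c₁ c₂ L G μ (C c) := by
  have h1 : reduced c₁ c₂ L G μ (C (lift c₁ c₂ L G μ c)) = C c := by
    conv_rhs => rw [← h.reduced_lift hμ c]
    rw [reduced_apply, reduced_apply]
    simp only [map_add, map_sub, h.CP, h.CL, h.CG, map_smulₛₗ, RingHom.id_apply,
      Complex.conj_ofReal]
  rw [← h1, h.lift_reduced hμ]

/-- For real `μ` the residual matrix on the span of `c₁, c₂` is Hermitian. -/
lemma inner_residual (h : SmallPencil c₁ c₂ J L G C K δ) {μ : ℝ} (hμ : ‖(μ : ℂ)‖ ≤ 1 / (4 * K))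
    {c c' : H} (hc : pairProj c₁ c₂ c = c) (hc' : pairProj c₁ c₂ c' = c') :
    inner ℂ c (L (lift c₁ c₂ L G μ c') - (μ : ℂ) • G (lift c₁ c₂ L G μ c')) =
      inner ℂ (L (lift c₁ c₂ L G μ c) - (μ : ℂ) • G (lift c₁ c₂ L G μ c)) c' := by
  have e1 : inner ℂ c (L (lift c₁ c₂ L G μ c') - (μ : ℂ) • G (lift c₁ c₂ L G μ c')) =
      inner ℂ (J (lift c₁ c₂ L G μ c))
        (L (lift c₁ c₂ L G μ c') - (μ : ℂ) • G (lift c₁ c₂ L G μ c')) := by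
    rw [← h.P_residual hμ hc', ← inner_P, ← inner_P, h.PJ, h.P_lift hμ hc, hc]
  have e2 : inner ℂ (L (lift c₁ c₂ L G μ c) - (μ : ℂ) • G (lift c₁ c₂ L G μ c)) c' =
      inner ℂ (L (lift c₁ c₂ L G μ c) - (μ : ℂ) • G (lift c₁ c₂ L G μ c))
        (J (lift c₁ c₂ L G μ c')) := by
    rw [← h.P_residual hμ hc, inner_P, inner_P, h.PJ, h.P_lift hμ hc', hc']
  rw [e1, e2, inner_sub_left, inner_sub_right, h.symmL, inner_smul_right, inner_smul_left, h.symmG,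
    Complex.conj_ofReal]

/-- For real `μ` the residual matrix is a scalar, because it is Hermitian and commutes with the
quaternionic structure. -/
lemma residual_eq (h : SmallPencil c₁ c₂ J L G C K δ) {μ : ℝ} (hμ : ‖(μ : ℂ)‖ ≤ 1 / (4 * K)) :
    L (lift c₁ c₂ L G μ c₁) - (μ : ℂ) • G (lift c₁ c₂ L G μ c₁) =
      inner ℂ c₁ (L (lift c₁ c₂ L G μ c₁) - (μ : ℂ) • G (lift c₁ c₂ L G μ c₁)) • c₁ := by
  have hh := h.inner_residual hμ h.P₂ h.P₁
  have hC : L (lift c₁ c₂ L G μ c₂) - (μ : ℂ) • G (lift c₁ c₂ L G μ c₂) =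
      C (L (lift c₁ c₂ L G μ c₁) - (μ : ℂ) • G (lift c₁ c₂ L G μ c₁)) := by
    have hl := h.C_lift hμ c₁
    rw [h.C₁] at hl
    rw [← hl]
    simp only [map_sub, h.CL, h.CG, map_smulₛₗ, Complex.conj_ofReal]
  have hr := (h.P_residual hμ h.P₁).symm
  rw [pairProj_apply] at hr
  set M := L (lift c₁ c₂ L G μ c₁) - (μ : ℂ) • G (lift c₁ c₂ L G μ c₁)
  have hM2 : C M = (starRingEnd ℂ) (inner ℂ c₁ M) • c₂ - (starRingEnd ℂ) (inner ℂ c₂ M) • c₁ := by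
    conv_lhs => rw [hr]
    simp [h.C₁, h.C₂, sub_eq_add_neg]
  rw [hC, hM2, inner_sub_left, inner_smul_left, inner_smul_left, h.orth',
    inner_self_eq_norm_sq_to_K, h.norm₁] at hh
  have hq : inner ℂ c₂ M = 0 := by
    simp at hh
    linear_combination hh / 2
  rw [hq, zero_smul, add_zero] at hr
  exact hr

/-- If the residual vanishes on `c₁` then it vanishes on the whole span, by the symmetry `C`. -/
lemma residual_eq₂ (h : SmallPencil c₁ c₂ J L G C K δ) {μ : ℝ} (hμ : ‖(μ : ℂ)‖ ≤ 1 / (4 * K))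
    (h1 : L (lift c₁ c₂ L G μ c₁) - (μ : ℂ) • G (lift c₁ c₂ L G μ c₁) = 0) {c : H}
    (hc : pairProj c₁ c₂ c = c) :
    L (lift c₁ c₂ L G μ c) = (μ : ℂ) • G (lift c₁ c₂ L G μ c) := by
  have hC : L (lift c₁ c₂ L G μ c₂) - (μ : ℂ) • G (lift c₁ c₂ L G μ c₂) = 0 := by
    have hl := h.C_lift hμ c₁
    rw [h.C₁] at hl
    rw [← map_zero C, ← h1, ← hl]
    simp only [map_sub, h.CL, h.CG, map_smulₛₗ, Complex.conj_ofReal]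
  rw [← sub_eq_zero, ← hc, pairProj_apply]
  rw [sub_eq_zero] at hC h1
  simp only [map_add, map_smul, hC, h1, smul_add]
  rw [smul_comm, smul_comm (μ : ℂ) (inner ℂ c₂ c)]
  abel

/-- The scalar by which the residual acts is `-μ` up to `O(δ)`. -/
lemma norm_residual (h : SmallPencil c₁ c₂ J L G C K δ) {μ : ℂ} (hμ : ‖μ‖ ≤ 1 / (4 * K)) :
    ‖inner ℂ c₁ (L (lift c₁ c₂ L G μ c₁) - μ • G (lift c₁ c₂ L G μ c₁)) + μ‖ ≤ 4 * δ := by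
  have h0 := h.delta_nonneg
  have hδ := h.delta_le
  have hK := h.one_le
  have hμ1 : ‖μ‖ ≤ 1 := hμ.trans (by rw [div_le_one (by linarith)]; linarith)
  have hb := h.norm_lift_sub_le hμ h.P₁
  have hP := h.P_lift hμ h.P₁
  set f := lift c₁ c₂ L G μ c₁
  rw [h.norm₁] at hb
  have hf : ‖f‖ ≤ 2 := by
    have : ‖f‖ ≤ ‖f - c₁‖ + ‖c₁‖ := by simpa using norm_add_le (f - c₁) c₁
    rw [h.norm₁] at this
    linarith
  have e : inner ℂ c₁ (L f - μ • G f) + μ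
      = inner ℂ c₁ ((L - (1 - pairProj c₁ c₂)) f) - μ * inner ℂ c₁ ((G - J) f) := by
    have a1 : inner ℂ c₁ (J f) = 1 := by
      rw [inner_of_P h.P₁, h.PJ, hP, inner_self_eq_norm_sq_to_K, h.norm₁]; simp
    have a2 : inner ℂ c₁ (pairProj c₁ c₂ f) = inner ℂ c₁ f := (inner_of_P h.P₁ f).symm
    simp only [sub_apply, one_apply_eq_self, inner_sub_right,
      inner_smul_right, a1, a2]
    ring
  rw [e]
  have t1 : ‖inner ℂ c₁ ((L - (1 - pairProj c₁ c₂)) f)‖ ≤ δ * 2 := by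
    refine (norm_inner_le_norm _ _).trans ?_
    rw [h.norm₁, one_mul]
    exact (ContinuousLinearMap.le_of_opNorm_le _ h.normL f).trans (by gcongr)
  have t2 : ‖inner ℂ c₁ ((G - J) f)‖ ≤ δ * 2 := by
    refine (norm_inner_le_norm _ _).trans ?_
    rw [h.norm₁, one_mul]
    exact (ContinuousLinearMap.le_of_opNorm_le _ h.normG f).trans (by gcongr)
  refine (norm_sub_le _ _).trans ?_
  rw [norm_mul]
  nlinarith [norm_nonneg μ, norm_nonneg (inner ℂ c₁ ((G - J) f))]

/-- There is a real `μ` at which the residual vanishes: the intermediate value theorem applied to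
the scalar by which the residual acts, which is close to `-μ`. -/
lemma exists_eigenvalue (h : SmallPencil c₁ c₂ J L G C K δ) :
    ∃ μ : ℝ, ‖(μ : ℂ)‖ ≤ 1 / (4 * K) ∧ ∀ c : H, pairProj c₁ c₂ c = c →
      L (lift c₁ c₂ L G μ c) = (μ : ℂ) • G (lift c₁ c₂ L G μ c) := by
  have hK := h.one_le
  set r : ℝ := 1 / (4 * K) with hr
  have hr0 : 0 < r := by positivity
  have hmem : ∀ μ ∈ Set.Icc (-r) r, ‖(μ : ℂ)‖ ≤ r := by
    intro μ hμ
    rw [Complex.norm_real]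
    exact abs_le.2 hμ
  let s : ℝ → ℂ := fun μ =>
    inner ℂ c₁ (L (lift c₁ c₂ L G μ c₁) - (μ : ℂ) • G (lift c₁ c₂ L G μ c₁))
  have hcont : ContinuousOn (fun μ => (s μ).re) (Set.Icc (-r) r) := by
    intro μ hμ
    have hred : Continuous fun μ : ℝ => reduced c₁ c₂ L G (μ : ℂ) := by
      unfold reduced
      refine continuous_const.add (continuous_const.clm_comp (continuous_const.sub ?_))
      exact Complex.continuous_ofReal.smul continuous_const
    have hlift : ContinuousAt (fun μ : ℝ => lift c₁ c₂ L G (μ : ℂ)) μ := by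
      obtain ⟨u, hu⟩ := h.isUnit_reduced (hmem μ hμ)
      have := NormedRing.inverse_continuousAt u
      rw [hu] at this
      exact ContinuousAt.comp (f := fun μ : ℝ => reduced c₁ c₂ L G (μ : ℂ)) this hred.continuousAt
    have hf : ContinuousAt (fun μ : ℝ => lift c₁ c₂ L G (μ : ℂ) c₁) μ :=
      hlift.clm_apply continuousAt_const
    refine ContinuousAt.continuousWithinAt ?_
    refine Complex.continuous_re.continuousAt.comp ?_
    refine ContinuousAt.inner continuousAt_const ?_
    refine (L.continuous.continuousAt.comp hf).sub ?_
    exact Complex.continuous_ofReal.continuousAt.smul (G.continuous.continuousAt.comp hf)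
  have hsgn : ∀ μ ∈ Set.Icc (-r) r, |(s μ).re + μ| ≤ 4 * δ := by
    intro μ hμ
    have := (Complex.abs_re_le_norm _).trans (h.norm_residual (hmem μ hμ))
    rwa [Complex.add_re, Complex.ofReal_re] at this
  have h4 : 4 * δ ≤ r := by
    rw [hr, le_div_iff₀ (by linarith)]
    nlinarith [h.delta_le']
  have hl := abs_le.1 (hsgn (-r) ⟨le_rfl, by linarith⟩)
  have hu := abs_le.1 (hsgn r ⟨by linarith, le_rfl⟩)
  obtain ⟨μ, hμ, hs⟩ := intermediate_value_Icc' (by linarith : -r ≤ r) hcont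
    (show (0 : ℝ) ∈ Set.Icc _ _ from ⟨by linarith, by linarith⟩)
  have hsim : (s μ).im = 0 := by
    have h2 : (starRingEnd ℂ) (s μ) = s μ := by
      rw [inner_conj_symm]
      exact (h.inner_residual (hmem μ hμ) h.P₁ h.P₁).symm
    exact Complex.conj_eq_iff_im.1 h2
  have hs0 : s μ = 0 := Complex.ext hs hsim
  refine ⟨μ, hmem μ hμ, fun c hc => h.residual_eq₂ (hmem μ hμ) ?_ hc⟩
  rw [h.residual_eq (hmem μ hμ)]
  change s μ • c₁ = 0
  rw [hs0, zero_smul]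

/-- There is only one eigenvalue in the disc. Given an eigenvector `f` for `μ`, let `f₀` be the
eigenvector for the real eigenvalue `lam` with the same projection. By symmetry
`(μ - lam) ⟨J f₀, G f⟩ = 0`, and the pairing is nonzero because both are close to their common
projection. -/
lemma eigenvalue_unique (h : SmallPencil c₁ c₂ J L G C K δ) {lam : ℝ}
    (hlam : ‖(lam : ℂ)‖ ≤ 1 / (4 * K)) (hker : ∀ c : H, pairProj c₁ c₂ c = c →
      L (lift c₁ c₂ L G lam c) = (lam : ℂ) • G (lift c₁ c₂ L G lam c))
    {μ : ℂ} (hμ : ‖μ‖ ≤ 1 / (4 * K)) {f : H} (hf0 : f ≠ 0) (hf : L f = μ • G f) : μ = lam := by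
  set c := pairProj c₁ c₂ f with hcdef
  have hc : pairProj c₁ c₂ c = c := h.PP f
  have hfc : f = lift c₁ c₂ L G μ c := h.eq_lift hμ hf
  have hc0 : c ≠ 0 := fun h0 => hf0 (by rw [hfc, h0, map_zero])
  have hb := h.norm_inner_sub_le hc hcdef.symm (hfc ▸ h.norm_lift_sub_le hμ hc)
    (h.norm_lift_sub_le hlam hc)
  have hne : inner ℂ (J (lift c₁ c₂ L G lam c)) (G f) ≠ 0 := by
    intro h0
    rw [h0, zero_sub, norm_neg, Complex.norm_real, Real.norm_eq_abs,
      abs_of_nonneg (by positivity)] at hb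
    have := h.small
    have hp : 0 < ‖c‖ ^ 2 := by positivity
    nlinarith
  have e := h.symmL (lift c₁ c₂ L G lam c) f
  rw [hf, hker c hc, inner_smul_right, inner_smul_left, Complex.conj_ofReal, ← h.symmG] at e
  exact mul_right_cancel₀ hne e

/-- Second-order perturbation theory with an error of third order, when the first-order term
`⟨L c, c⟩` is itself of second order. The eigenvector `f` is tested against `c - (1 - P) L c`, its
approximation to first order. -/
lemma norm_eigenvalue_sub_le (h : SmallPencil c₁ c₂ J L G C K δ) {lam : ℝ}
    (hlam : ‖(lam : ℂ)‖ ≤ 1 / (4 * K)) (hker : ∀ c : H, pairProj c₁ c₂ c = c →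
      L (lift c₁ c₂ L G lam c) = (lam : ℂ) • G (lift c₁ c₂ L G lam c))
    {c : H} (hc : pairProj c₁ c₂ c = c) (hc1 : ‖c‖ = 1) {K' : ℝ}
    (hK' : ‖inner ℂ (L c) c‖ ≤ K' * δ ^ 2) :
    ‖(lam : ℂ) - (inner ℂ (L c) c - inner ℂ (J (L c - pairProj c₁ c₂ (L c))) (L c))‖ ≤
      (9 * K ^ 2 * (2 * K' + 10 * K) + 4 * K) * δ ^ 3 := by
  have h0 := h.delta_nonneg
  have hδ := h.delta_le
  have hK := h.one_le
  have hK'0 : 0 ≤ K' * δ ^ 2 := (norm_nonneg _).trans hK'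
  have hJc : J c = c := by rw [← hc, h.JP]
  have hJle : ∀ g, ‖J g‖ ≤ K * ‖g‖ := fun g => ContinuousLinearMap.le_of_opNorm_le _ h.normJ g
  have hLc : ‖L c‖ ≤ δ := by
    have := ContinuousLinearMap.le_of_opNorm_le _ h.normL c
    simpa [hc, hc1] using this
  set f := lift c₁ c₂ L G lam c with hfdef
  have hPf : pairProj c₁ c₂ f = c := h.P_lift hlam hc
  have hfb : ‖f - c‖ ≤ 4 * δ * ‖c‖ := h.norm_lift_sub_le hlam hc
  set q := L c - pairProj c₁ c₂ (L c) with hq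
  have hqn : ‖q‖ ≤ δ := (h.norm_Q_le _).trans hLc
  have hPq : pairProj c₁ c₂ q = 0 := by rw [hq, map_sub, h.PP, sub_self]
  have hb := h.norm_inner_sub_le (f' := c - q) hc hPf hfb (by
    rw [sub_sub_cancel_left, norm_neg, hc1]; linarith)
  rw [hc1] at hb
  set I := inner ℂ (J (c - q)) (G f) with hI
  set κ := inner ℂ (L c) c - inner ℂ (J q) (L c) with hκ
  have e : (lam : ℂ) * I - κ = -inner ℂ ((L - (1 - pairProj c₁ c₂)) q) (J (f - c)) := by
    have e1 : (lam : ℂ) * I = inner ℂ (L (c - q)) (J f) := by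
      rw [← h.symmL, hfdef, hker c hc, inner_smul_right]
    have e2 : L (c - q) = pairProj c₁ c₂ (L c) - (L - (1 - pairProj c₁ c₂)) q := by
      have e0 : pairProj c₁ c₂ (L c) = L c - q := by rw [hq]; abel
      rw [map_sub, sub_apply, sub_apply, one_apply_eq_self, hPq, sub_zero, e0]
      abel
    have e3 : inner ℂ (pairProj c₁ c₂ (L c)) (J f) = inner ℂ (L c) c := by
      rw [inner_P, h.PJ, hPf]
    have e4 : inner ℂ ((L - (1 - pairProj c₁ c₂)) q) c = inner ℂ (J q) (L c) := by
      have : (L - (1 - pairProj c₁ c₂)) q = L q - q := by simp [hPq]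
      rw [this, inner_sub_left, h.symmL, hJc]
      have : inner ℂ q c = 0 := by
        rw [← hc, ← inner_P, hPq, inner_zero_left]
      rw [this, sub_zero]
    rw [e1, e2, inner_sub_left, e3, map_sub J, inner_sub_right, hJc, e4, hκ]
    ring
  have t1 : ‖(lam : ℂ) * I - κ‖ ≤ 4 * K * δ ^ 3 := by
    rw [e, norm_neg]
    refine (norm_inner_le_norm _ _).trans ?_
    have a1 : ‖(L - (1 - pairProj c₁ c₂)) q‖ ≤ δ * δ :=
      (ContinuousLinearMap.le_of_opNorm_le _ h.normL q).trans (by gcongr)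
    have a2 : ‖J (f - c)‖ ≤ K * (4 * δ * 1) := (hJle _).trans (by rw [hc1] at hfb; gcongr)
    calc _ ≤ (δ * δ) * (K * (4 * δ * 1)) := mul_le_mul a1 a2 (norm_nonneg _) (by positivity)
      _ = _ := by ring
  have t2 : ‖κ‖ ≤ (K' + K) * δ ^ 2 := by
    have : ‖inner ℂ (J q) (L c)‖ ≤ (K * δ) * δ := by
      refine (norm_inner_le_norm _ _).trans (mul_le_mul ?_ hLc (norm_nonneg _) (by positivity))
      exact (hJle q).trans (by gcongr)
    calc _ ≤ _ := norm_sub_le _ _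
      _ ≤ K' * δ ^ 2 + (K * δ) * δ := add_le_add hK' this
      _ = _ := by ring
  have hsm := h.small
  -- `I` is close to `1`, so that the bound on `lam * I` makes `lam` of second order.
  have hI2 : (1 : ℝ) / 2 ≤ ‖I‖ := by
    have h1 : ‖((1 ^ 2 : ℝ) : ℂ)‖ - ‖I‖ ≤ ‖((1 ^ 2 : ℝ) : ℂ) - I‖ := norm_sub_norm_le _ _
    rw [norm_sub_rev] at hb
    have : ‖((1 ^ 2 : ℝ) : ℂ)‖ = 1 := by simp
    rw [this] at h1
    nlinarith
  have t3 : ‖(lam : ℂ)‖ ≤ (2 * K' + 10 * K) * δ ^ 2 := by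
    have h1 : ‖(lam : ℂ) * I‖ ≤ 4 * K * δ ^ 3 + (K' + K) * δ ^ 2 := by
      have := norm_add_le ((lam : ℂ) * I - κ) κ
      rw [sub_add_cancel] at this
      linarith
    rw [norm_mul] at h1
    have h2 : K * δ ^ 3 ≤ K * δ ^ 2 := by
      have : δ ^ 3 ≤ δ ^ 2 := pow_le_pow_of_le_one h0 (by linarith) (by norm_num)
      gcongr
    nlinarith [norm_nonneg (lam : ℂ)]
  -- Since `lam = O(δ ^ 2)`, replacing `I` by `1` costs `O(δ ^ 3)`.
  have e5 : (lam : ℂ) - κ = (lam : ℂ) * (((1 ^ 2 : ℝ) : ℂ) - I) + ((lam : ℂ) * I - κ) := by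
    push_cast; ring
  rw [e5]
  refine (norm_add_le _ _).trans ?_
  rw [norm_mul, norm_sub_rev]
  have : ‖(lam : ℂ)‖ * ‖I - ((1 ^ 2 : ℝ) : ℂ)‖ ≤
      ((2 * K' + 10 * K) * δ ^ 2) * (9 * K ^ 2 * δ * 1 ^ 2) :=
    mul_le_mul t3 hb (norm_nonneg _) ((norm_nonneg _).trans t3)
  nlinarith

/-- The eigenspace is two-dimensional: it is the image under `J ∘ lift` of the span of `c₁, c₂`. -/
lemma finrank_eq_two (h : SmallPencil c₁ c₂ J L G C K δ) {lam : ℝ}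
    (hlam : ‖(lam : ℂ)‖ ≤ 1 / (4 * K)) (hker : ∀ c : H, pairProj c₁ c₂ c = c →
      L (lift c₁ c₂ L G lam c) = (lam : ℂ) • G (lift c₁ c₂ L G lam c))
    (V : Submodule ℂ H) (hV : ∀ u, u ∈ V ↔ ∃ f, u = J f ∧ L f = (lam : ℂ) • G f) :
    Module.finrank ℂ V = 2 := by
  set T : H →L[ℂ] H := J ∘L lift c₁ c₂ L G lam
  have hPT : ∀ c, pairProj c₁ c₂ c = c → pairProj c₁ c₂ (T c) = c := by
    intro c hc
    exact (h.PJ _).trans (h.P_lift hlam hc)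
  have hli : LinearIndependent ℂ ![T c₁, T c₂] := by
    rw [LinearIndependent.pair_iff]
    intro s t hst
    have h1 := congrArg (pairProj c₁ c₂) hst
    rw [map_add, map_smul, map_smul, hPT _ h.P₁, hPT _ h.P₂, map_zero] at h1
    have a := congrArg (inner ℂ c₁) h1
    have b := congrArg (inner ℂ c₂) h1
    simp [h.orth, h.orth', inner_self_eq_norm_sq_to_K,
      h.norm₁, h.norm₂] at a b
    exact ⟨a, b⟩
  have hspan : V = Submodule.span ℂ (Set.range ![T c₁, T c₂]) := by
    have hr : Set.range ![T c₁, T c₂] = {T c₁, T c₂} := by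
      ext u; simp [or_comm]
    rw [hr]
    ext u
    rw [hV, Submodule.mem_span_pair]
    constructor
    · rintro ⟨f, rfl, hf⟩
      refine ⟨inner ℂ c₁ f, inner ℂ c₂ f, ?_⟩
      rw [← map_smul, ← map_smul, ← map_add, ← pairProj_apply]
      change J (lift c₁ c₂ L G lam _) = _
      rw [← h.eq_lift hlam hf]
    · rintro ⟨a, b, rfl⟩
      refine ⟨lift c₁ c₂ L G lam (a • c₁ + b • c₂), ?_, hker _ ?_⟩
      · simp [T]
      · simp [h.P₁, h.P₂]
  rw [hspan, finrank_span_eq_card hli]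
  simp

end SmallPencil

end Pencil

/-! ### Integration over the fundamental cell -/

instance : IsFiniteMeasure torusMeasure := by
  refine ⟨?_⟩
  rw [torusMeasure, Measure.restrict_apply_univ, cell, Real.volume_pi_Ioc]
  exact ENNReal.prod_lt_top fun _ _ => ENNReal.ofReal_lt_top

lemma torusMeasure_real_univ : torusMeasure.real Set.univ = (2 * Real.pi) ^ 3 := by
  rw [Measure.real, torusMeasure, Measure.restrict_apply_univ, cell, Real.volume_pi_Ioc]
  simp [ENNReal.toReal_ofReal, Real.pi_pos.le]

lemma measurableSet_cell : MeasurableSet cell := MeasurableSet.univ_pi fun _ => measurableSet_Ioc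

lemma ae_mem_cell : ∀ᵐ x ∂torusMeasure, x ∈ cell :=
  ae_restrict_mem (μ := (volume : Measure R3)) measurableSet_cell

lemma exists_bound_cell {E : Type*} [SeminormedAddCommGroup E] {φ : R3 → E} (hφ : Continuous φ) :
    ∃ C, 0 ≤ C ∧ ∀ x ∈ cell, ‖φ x‖ ≤ C := by
  have hcomp : IsCompact (Set.pi Set.univ fun _ : Fin 3 => Set.Icc (0 : ℝ) (2 * Real.pi)) :=
    isCompact_univ_pi fun _ => isCompact_Icc
  obtain ⟨C, hC⟩ := hcomp.exists_bound_of_continuousOn hφ.continuousOn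
  exact ⟨max C 0, le_max_right _ _, fun x hx =>
    (hC x fun i hi => Set.Ioc_subset_Icc_self (hx i hi)).trans (le_max_left _ _)⟩

lemma integrable_of_continuous {E : Type*} [NormedAddCommGroup E] {φ : R3 → E} (hφ : Continuous φ) :
    Integrable φ torusMeasure := by
  obtain ⟨C, -, hC⟩ := exists_bound_cell hφ
  exact Integrable.of_bound hφ.aestronglyMeasurable C (ae_mem_cell.mono hC)

/-- A partial derivative of a periodic function has mean zero. -/
lemma integral_pd_eq_zero (α : Fin 3) {f : R3 → ℂ} (hf : ContDiff ℝ 1 f) (hp : Periodic3 f) :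
    ∫ x, pd α f x ∂torusMeasure = 0 := by
  have hcell : ∫ x, pd α f x ∂torusMeasure
      = ∫ x in Set.Icc (0 : R3) (fun _ => 2 * Real.pi), pd α f x := by
    rw [torusMeasure, cell]
    exact setIntegral_congr_set Measure.univ_pi_Ioc_ae_eq_Icc
  have hpd : Continuous (pd α f) := (hf.continuous_fderiv (by simp)).clm_apply continuous_const
  have hsum : ∀ x, ∑ i : Fin 3, (if i = α then fderiv ℝ f x else 0) (Pi.single i 1) = pd α f x := by
    intro x
    rw [Finset.sum_eq_single α]
    · simp [pd]
    · intro b _ hb; simp [hb]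
    · simp
  -- The divergence theorem on the closed cell, for the field with `f` as its only component.
  have key := integral_divergence_of_hasFDerivAt_off_countable' (n := 2) (E := ℂ) (0 : R3)
    (fun _ => 2 * Real.pi)
    (fun _ => by simp [Real.pi_pos.le])
    (fun i => if i = α then f else 0) (fun i x => if i = α then fderiv ℝ f x else 0)
    ∅ Set.countable_empty
    (by intro i; split_ifs
        · exact hf.continuous.continuousOn
        · exact continuousOn_const)
    (by intro x _ i; split_ifs
        · exact (hf.differentiable (by simp) x).hasFDerivAt
        · exact hasFDerivAt_const 0 x)
    (by simp only [hsum]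
        exact hpd.continuousOn.integrableOn_compact isCompact_Icc)
  simp only [hsum] at key
  rw [hcell, key]
  -- The integrals over opposite faces cancel by periodicity.
  refine Finset.sum_eq_zero fun i _ => ?_
  rw [sub_eq_zero]
  refine integral_congr_ae (Eventually.of_forall fun y => ?_)
  dsimp only
  split_ifs with h
  · subst h
    rw [← hp (i.insertNth ((0 : R3) i) y) i]
    congr 1
    ext j
    rcases Fin.eq_self_or_eq_succAbove i j with rfl | ⟨k, rfl⟩
    · simp
    · simp
  · rfl

lemma pd_mul (α : Fin 3) {f g : R3 → ℂ} (hf : ContDiff ℝ 1 f) (hg : ContDiff ℝ 1 g) (x : R3) :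
    pd α (fun y => f y * g y) x = pd α f x * g x + f x * pd α g x := by
  rw [pd, fderiv_fun_mul (hf.differentiable (by simp) x) (hg.differentiable (by simp) x)]
  simp [pd]; ring

/-! ### Exponentials -/

/-- The character `e^{i m·x}`. -/
def expo (m : Fin 3 → ℤ) (x : R3) : ℂ := Complex.exp (Complex.I * ∑ α, (m α : ℂ) * (x α : ℂ))

lemma contDiff_expo (m : Fin 3 → ℤ) : ContDiff ℝ ∞ (expo m) := by
  unfold expo
  refine ContDiff.cexp (contDiff_const.mul (ContDiff.sum fun α _ => contDiff_const.mul ?_))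
  exact Complex.ofRealCLM.contDiff.comp (contDiff_apply ℝ ℝ α)

lemma continuous_expo (m : Fin 3 → ℤ) : Continuous (expo m) := (contDiff_expo m).continuous

lemma expo_add (m n : Fin 3 → ℤ) (x : R3) : expo (m + n) x = expo m x * expo n x := by
  rw [expo, expo, expo, ← Complex.exp_add]
  congr 1
  simp [add_mul, Finset.sum_add_distrib, mul_add]

@[simp] lemma expo_zero (x : R3) : expo 0 x = 1 := by simp [expo]

lemma conj_expo (m : Fin 3 → ℤ) (x : R3) : (starRingEnd ℂ) (expo m x) = expo (-m) x := by
  rw [expo, expo, ← Complex.exp_conj]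
  congr 1
  simp

lemma expo_eq_fourier (m : Fin 3 → ℤ) (x : R3) :
    (starRingEnd ℂ) (expo m x) = Complex.exp (-Complex.I * ∑ α, (m α : ℂ) * (x α : ℂ)) := by
  rw [expo, ← Complex.exp_conj]
  congr 1
  simp

lemma periodic_expo (m : Fin 3 → ℤ) : Periodic3 (expo m) := by
  intro x α
  have : Complex.I * ∑ β, (m β : ℂ) * (((x + Pi.single α (2 * Real.pi) : R3) β : ℝ) : ℂ)
      = Complex.I * ∑ β, (m β : ℂ) * (x β : ℂ) + (m α : ℂ) * (2 * Real.pi * Complex.I) := by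
    simp only [Pi.add_apply, Complex.ofReal_add, mul_add, Finset.sum_add_distrib]
    congr 1
    rw [Finset.sum_eq_single α]
    · simp; ring
    · intro b _ hb; simp [hb]
    · simp
  rw [expo, expo, this, Complex.exp_add, Complex.exp_int_mul_two_pi_mul_I, mul_one]

lemma pd_expo (α : Fin 3) (m : Fin 3 → ℤ) (x : R3) :
    pd α (expo m) x = Complex.I * (m α : ℂ) * expo m x := by
  have h : HasFDerivAt (fun x : R3 => Complex.I * ∑ β, (m β : ℂ) * (x β : ℂ))
      (Complex.I • ∑ β, (m β : ℂ) • (Complex.ofRealCLM.comp (ContinuousLinearMap.proj β))) x := by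
    refine HasFDerivAt.const_mul (HasFDerivAt.fun_sum fun β _ => HasFDerivAt.const_mul ?_ _) _
    exact (Complex.ofRealCLM.comp
      (ContinuousLinearMap.proj (R := ℝ) (φ := fun _ : Fin 3 => ℝ) β)).hasFDerivAt
  have h2 := h.cexp.fderiv
  change fderiv ℝ (expo m) x = _ at h2
  rw [pd, h2]
  simp only [smul_apply, sum_apply, ContinuousLinearMap.comp_apply,
    ContinuousLinearMap.proj_apply, Complex.ofRealCLM_apply, smul_eq_mul]
  have h3 : ∑ β, (m β : ℂ) * ((Pi.single α (1 : ℝ) : R3) β : ℂ) = m α := by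
    rw [Finset.sum_eq_single α]
    · simp
    · intro b _ hb; simp [hb]
    · simp
  rw [h3, expo]
  ring

lemma integral_expo (m : Fin 3 → ℤ) :
    ∫ x, expo m x ∂torusMeasure = if m = 0 then ((2 * Real.pi) ^ 3 : ℝ) else 0 := by
  split_ifs with h
  · subst h
    simp only [expo_zero, integral_const, torusMeasure_real_univ, Complex.real_smul, mul_one]
  · obtain ⟨α, hα⟩ := Function.ne_iff.1 h
    have := integral_pd_eq_zero α ((contDiff_expo m).of_le (by simp)) (periodic_expo m)
    simp only [pd_expo, integral_const_mul] at this
    rcases mul_eq_zero.1 this with h1 | h1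
    · simp at h1; exact absurd h1 hα
    · exact h1

/-! ### Completeness of the exponentials -/

section Completeness

/-- Normalised Haar measure on the circle, the convention of Mathlib's multivariate Fourier
series. -/
local instance : MeasureSpace UnitAddCircle := ⟨AddCircle.haarAddCircle⟩

local instance : Measure.IsAddHaarMeasure (volume : Measure UnitAddCircle) :=
  inferInstanceAs (Measure.IsAddHaarMeasure AddCircle.haarAddCircle)

local instance : IsProbabilityMeasure (volume : Measure UnitAddCircle) :=
  inferInstanceAs (IsProbabilityMeasure AddCircle.haarAddCircle)

/-- The parametrisation of the fundamental cell by the standard unit torus. -/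
def cellParam (t : UnitAddTorus (Fin 3)) : R3 :=
  (2 * Real.pi) • (UnitAddTorus.measurableEquivPiIoc (fun _ => 0) t).1

lemma measurePreserving_cellParam :
    MeasurePreserving cellParam volume (ENNReal.ofReal ((2 * Real.pi) ^ 3)⁻¹ • torusMeasure) := by
  set s : Set R3 := {x : R3 | ∀ i, x i ∈ Set.Ioc (0 : ℝ) (0 + 1)}
  have hs : MeasurableSet s := MeasurableSet.univ_pi' fun _ => measurableSet_Ioc
  have h1 := UnitAddTorus.measurePreserving_equivPiIoc (d := Fin 3) (fun _ => (0 : ℝ))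
  have h2 : MeasurePreserving (Subtype.val : s → R3) (Measure.comap Subtype.val volume)
      (volume.restrict s) := measurePreserving_subtype_coe hs
  have h3 : MeasurePreserving (fun x : R3 => (2 * Real.pi) • x) (volume.restrict s)
      (ENNReal.ofReal ((2 * Real.pi) ^ 3)⁻¹ • torusMeasure) := by
    refine ⟨measurable_const_smul _, ?_⟩
    have hpre : s = (fun x : R3 => (2 * Real.pi) • x) ⁻¹' cell := by
      ext x
      simp only [s, cell, Set.mem_ofPred_eq, Set.mem_preimage, Set.mem_pi, Set.mem_univ,
        true_imp_iff, Set.mem_Ioc, Pi.smul_apply, smul_eq_mul, zero_add]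
      refine forall_congr' fun i => ?_
      have := Real.two_pi_pos
      constructor
      · rintro ⟨a, b⟩; exact ⟨by positivity, by nlinarith⟩
      · rintro ⟨a, b⟩; exact ⟨by by_contra h; nlinarith, by by_contra h; nlinarith⟩
    rw [hpre, ← Measure.restrict_map (measurable_const_smul _) measurableSet_cell,
      Measure.map_addHaar_smul _ (by positivity), torusMeasure, Measure.restrict_smul]
    congr 2
    simp [abs_of_pos Real.pi_pos]
  exact h3.comp (h2.comp h1)

lemma mFourier_cellParam (m : Fin 3 → ℤ) (t : UnitAddTorus (Fin 3)) :
    UnitAddTorus.mFourier m t = expo m (cellParam t) := by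
  have ht : t = fun i =>
      (((UnitAddTorus.measurableEquivPiIoc (fun _ => 0) t).1 i : ℝ) : UnitAddCircle) := by
    conv_lhs =>
      rw [← (UnitAddTorus.measurableEquivPiIoc (fun _ : Fin 3 => (0 : ℝ))).symm_apply_apply t]
    rfl
  conv_lhs => rw [ht]
  simp only [UnitAddTorus.mFourier, ContinuousMap.coe_mk, fourier_coe_apply, expo, cellParam]
  rw [← Complex.exp_sum, Finset.mul_sum]
  congr 1
  refine Finset.sum_congr rfl fun i _ => ?_
  simp
  ring

/-- The exponentials are complete in `L²` of the cell. This is Mathlib's Fourier basis of the unit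
torus, transported by `cellParam`. -/
lemma ae_eq_zero_of_integral_expo {f : R3 → ℂ} (hf : MemLp f 2 torusMeasure)
    (h : ∀ m, ∫ x, (starRingEnd ℂ) (expo m x) * f x ∂torusMeasure = 0) : f =ᵐ[torusMeasure] 0 := by
  have hmp := measurePreserving_cellParam
  have hf' := hf.smul_measure (c := ENNReal.ofReal ((2 * Real.pi) ^ 3)⁻¹) ENNReal.ofReal_ne_top
  have hF : MemLp (f ∘ cellParam) 2 volume := hf'.comp_measurePreserving hmp
  have hcoef : ∀ m, UnitAddTorus.mFourierBasis.repr (hF.toLp _) m = 0 := by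
    intro m
    rw [UnitAddTorus.mFourierBasis_repr, UnitAddTorus.mFourierCoeff]
    have e : ∫ t, UnitAddTorus.mFourier (-m) t • (hF.toLp _ : UnitAddTorus (Fin 3) → ℂ) t
        = ∫ t, ((fun x => (starRingEnd ℂ) (expo m x) * f x) ∘ cellParam) t := by
      refine integral_congr_ae ?_
      filter_upwards [hF.coeFn_toLp] with t ht
      rw [ht, mFourier_cellParam, ← conj_expo]
      rfl
    rw [e]
    have hm : AEStronglyMeasurable (fun x => (starRingEnd ℂ) (expo m x) * f x)
        (ENNReal.ofReal ((2 * Real.pi) ^ 3)⁻¹ • torusMeasure) :=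
      ((Complex.continuous_conj.comp (continuous_expo m)).aestronglyMeasurable).mul
        hf'.aestronglyMeasurable
    rw [← hmp.map_eq] at hm
    have := integral_map hmp.measurable.aemeasurable hm
    rw [hmp.map_eq, integral_smul_measure, h m, smul_zero] at this
    exact this.symm
  have h0 : hF.toLp (f ∘ cellParam) = 0 := by
    rw [← UnitAddTorus.mFourierBasis.repr.map_eq_zero_iff]
    ext m
    simpa using hcoef m
  have h1 : eLpNorm f 2 (ENNReal.ofReal ((2 * Real.pi) ^ 3)⁻¹ • torusMeasure) = 0 := by
    rw [← eLpNorm_comp_measurePreserving hf'.aestronglyMeasurable hmp]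
    have hz : f ∘ cellParam =ᵐ[volume] 0 :=
      hF.coeFn_toLp.symm.trans (h0 ▸ Lp.coeFn_zero ℂ 2 volume)
    rw [eLpNorm_congr_ae hz, eLpNorm_zero]
  rw [eLpNorm_eq_zero_iff hf'.aestronglyMeasurable (by simp)] at h1
  exact (Measure.ae_ennreal_smul_measure_iff (by simp; positivity)).1 h1

end Completeness

/-! ### Multiplication operators, matrices and charge conjugation -/

/-- The fibre of spinors. -/
local notation "ℂ²" => EuclideanSpace ℂ (Fin 2)

lemma memLp_smul_spinor {φ : R3 → ℂ} (hφ : Continuous φ) (u : SpinorL2) :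
    MemLp (fun x => φ x • u x) 2 torusMeasure := by
  obtain ⟨C, -, hC⟩ := exists_bound_cell hφ
  refine (Lp.memLp u).of_le_mul (c := C)
    (hφ.aestronglyMeasurable.smul (Lp.aestronglyMeasurable u)) ?_
  filter_upwards [ae_mem_cell] with x hx
  rw [norm_smul]
  exact mul_le_mul_of_nonneg_right (hC x hx) (norm_nonneg _)

/-- Multiplication by a continuous function, as an operator in `L²`; the junk value for
discontinuous functions is zero. -/
def mulOp (φ : R3 → ℂ) : SpinorL2 →L[ℂ] SpinorL2 := by
  classical
  exact if hφ : Continuous φ then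
    LinearMap.mkContinuousOfExistsBound
      { toFun := fun u => (memLp_smul_spinor hφ u).toLp _
        map_add' := fun u v => by
          refine Lp.ext ?_
          filter_upwards [(memLp_smul_spinor hφ (u + v)).coeFn_toLp,
            (memLp_smul_spinor hφ u).coeFn_toLp, (memLp_smul_spinor hφ v).coeFn_toLp,
            Lp.coeFn_add u v, Lp.coeFn_add ((memLp_smul_spinor hφ u).toLp _)
              ((memLp_smul_spinor hφ v).toLp _)] with x h1 h2 h3 h4 h5
          rw [h1, h5, Pi.add_apply, h2, h3, h4, Pi.add_apply, smul_add]
        map_smul' := fun c u => by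
          refine Lp.ext ?_
          filter_upwards [(memLp_smul_spinor hφ (c • u)).coeFn_toLp,
            (memLp_smul_spinor hφ u).coeFn_toLp, Lp.coeFn_smul c u,
            Lp.coeFn_smul c ((memLp_smul_spinor hφ u).toLp _)] with x h1 h2 h4 h5
          rw [RingHom.id_apply, h1, h5, Pi.smul_apply, h2, h4, Pi.smul_apply, smul_comm] }
      (by
        obtain ⟨C, -, hC⟩ := exists_bound_cell hφ
        refine ⟨C, fun u => Lp.norm_le_mul_norm_of_ae_le_mul ?_⟩
        filter_upwards [(memLp_smul_spinor hφ u).coeFn_toLp, ae_mem_cell] with x h1 hx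
        change ‖((memLp_smul_spinor hφ u).toLp _ : SpinorL2) x‖ ≤ _
        rw [h1, norm_smul]
        exact mul_le_mul_of_nonneg_right (hC x hx) (norm_nonneg _))
  else 0

lemma mulOp_coe {φ : R3 → ℂ} (hφ : Continuous φ) (u : SpinorL2) :
    ∀ᵐ x ∂torusMeasure, mulOp φ u x = φ x • u x := by
  have : mulOp φ u = (memLp_smul_spinor hφ u).toLp _ := by
    rw [mulOp, dif_pos hφ]; rfl
  rw [this]
  exact (memLp_smul_spinor hφ u).coeFn_toLp

lemma norm_mulOp_le {φ : R3 → ℂ} {C : ℝ} (hC0 : 0 ≤ C) (hC : ∀ x ∈ cell, ‖φ x‖ ≤ C) :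
    ‖mulOp φ‖ ≤ C := by
  by_cases hφ : Continuous φ
  · refine ContinuousLinearMap.opNorm_le_bound _ hC0 fun u => Lp.norm_le_mul_norm_of_ae_le_mul ?_
    filter_upwards [mulOp_coe hφ u, ae_mem_cell] with x h1 hx
    rw [h1, norm_smul]
    exact mul_le_mul_of_nonneg_right (hC x hx) (norm_nonneg _)
  · rw [mulOp, dif_neg hφ, norm_zero]; exact hC0

lemma mulOp_add {φ ψ : R3 → ℂ} (hφ : Continuous φ) (hψ : Continuous ψ) :
    mulOp (fun x => φ x + ψ x) = mulOp φ + mulOp ψ := by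
  ext1 u
  refine Lp.ext ?_
  filter_upwards [mulOp_coe hφ u, mulOp_coe hψ u, mulOp_coe (φ := fun x => φ x + ψ x) (hφ.add hψ) u,
    Lp.coeFn_add (mulOp φ u) (mulOp ψ u)] with x h1 h2 h3 h4
  rw [h3, add_apply, h4, Pi.add_apply, h1, h2, add_smul]

lemma mulOp_const_mul (c : ℂ) {φ : R3 → ℂ} (hφ : Continuous φ) :
    mulOp (fun x => c * φ x) = c • mulOp φ := by
  ext1 u
  refine Lp.ext ?_
  filter_upwards [mulOp_coe hφ u, mulOp_coe (φ := fun x => c * φ x) (continuous_const.mul hφ) u,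
    Lp.coeFn_smul c (mulOp φ u)] with x h1 h3 h4
  rw [h3, smul_apply, h4, Pi.smul_apply, h1, mul_smul]

lemma mulOp_one : mulOp (fun _ => 1) = 1 := by
  ext1 u
  refine Lp.ext ?_
  filter_upwards [mulOp_coe (φ := fun _ => 1) continuous_const u] with x h1
  rw [h1, one_smul]; rfl

lemma mulOp_sub {φ ψ : R3 → ℂ} (hφ : Continuous φ) (hψ : Continuous ψ) :
    mulOp (fun x => φ x - ψ x) = mulOp φ - mulOp ψ := by
  rw [eq_sub_iff_add_eq, ← mulOp_add (φ := fun x => φ x - ψ x) (hφ.sub hψ) hψ]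
  simp

lemma mulOp_mulOp {φ ψ : R3 → ℂ} (hφ : Continuous φ) (hψ : Continuous ψ) (u : SpinorL2) :
    mulOp φ (mulOp ψ u) = mulOp (fun x => φ x * ψ x) u := by
  refine Lp.ext ?_
  filter_upwards [mulOp_coe hφ (mulOp ψ u), mulOp_coe hψ u,
    mulOp_coe (φ := fun x => φ x * ψ x) (hφ.mul hψ) u] with x h1 h2 h3
  rw [h1, h2, h3, mul_smul]

lemma inner_mulOp_left {φ : R3 → ℂ} (hφ : Continuous φ) (u v : SpinorL2) :
    inner ℂ (mulOp φ u) v = inner ℂ u (mulOp (fun x => (starRingEnd ℂ) (φ x)) v) := by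
  rw [L2.inner_def, L2.inner_def]
  refine integral_congr_ae ?_
  filter_upwards [mulOp_coe hφ u, mulOp_coe (φ := fun x => (starRingEnd ℂ) (φ x))
    (Complex.continuous_conj.comp hφ) v] with x h1 h2
  rw [h1, h2, inner_smul_left, inner_smul_right]

lemma inner_mulOp_ofReal {φ : R3 → ℝ} (hφ : Continuous φ) (u v : SpinorL2) :
    inner ℂ (mulOp (fun x => (φ x : ℂ)) u) v = inner ℂ u (mulOp (fun x => (φ x : ℂ)) v) := by
  rw [inner_mulOp_left (φ := fun x => (φ x : ℂ)) (Complex.continuous_ofReal.comp hφ)]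
  simp

/-- A constant matrix acting in `L²`. -/
def matOp (A : Matrix (Fin 2) (Fin 2) ℂ) : SpinorL2 →L[ℂ] SpinorL2 :=
  (LinearMap.toContinuousLinearMap (Matrix.toEuclideanLin A)).compLpL 2 torusMeasure

lemma matOp_coe (A : Matrix (Fin 2) (Fin 2) ℂ) (u : SpinorL2) :
    ∀ᵐ x ∂torusMeasure, matOp A u x = Matrix.toEuclideanLin A (u x) :=
  ContinuousLinearMap.coeFn_compLpL _ u

lemma matOp_mulOp (A : Matrix (Fin 2) (Fin 2) ℂ) {φ : R3 → ℂ} (hφ : Continuous φ) (u : SpinorL2) :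
    matOp A (mulOp φ u) = mulOp φ (matOp A u) := by
  refine Lp.ext ?_
  filter_upwards [matOp_coe A (mulOp φ u), matOp_coe A u, mulOp_coe hφ u, mulOp_coe hφ (matOp A u)]
    with x h1 h2 h3 h4
  rw [h1, h3, h4, h2, map_smul]

lemma inner_matOp_left {A : Matrix (Fin 2) (Fin 2) ℂ} (hA : A.IsHermitian) (u v : SpinorL2) :
    inner ℂ (matOp A u) v = inner ℂ u (matOp A v) := by
  rw [L2.inner_def, L2.inner_def]
  refine integral_congr_ae ?_
  filter_upwards [matOp_coe A u, matOp_coe A v] with x h1 h2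
  rw [h1, h2]
  exact (Matrix.isSymmetric_toEuclideanLin_iff.2 hA) _ _

lemma pauli_isHermitian (j : Fin 3) : (pauli j).IsHermitian := by
  ext a b
  fin_cases j <;> fin_cases a <;> fin_cases b <;> simp [pauli]

/-- Charge conjugation `(u₁, u₂) ↦ (-ū₂, ū₁)` on the fibre. -/
def fibreConj : ℂ² →L⋆[ℂ] ℂ² :=
  LinearMap.mkContinuous
    { toFun := fun v => !₂[-(starRingEnd ℂ) (v 1), (starRingEnd ℂ) (v 0)]
      map_add' := fun v w => by ext i; fin_cases i <;> simp [add_comm]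
      map_smul' := fun c v => by ext i; fin_cases i <;> simp }
    1 (fun v => by
      rw [one_mul, EuclideanSpace.norm_eq, EuclideanSpace.norm_eq]
      simp [Fin.sum_univ_two, add_comm])

lemma fibreConj_apply (v : ℂ²) :
    fibreConj v = !₂[-(starRingEnd ℂ) (v 1), (starRingEnd ℂ) (v 0)] := rfl

/-- Charge conjugation on `L²`. -/
def conjOp : SpinorL2 →L⋆[ℂ] SpinorL2 := fibreConj.compLpL 2 torusMeasure

lemma conjOp_coe (u : SpinorL2) : ∀ᵐ x ∂torusMeasure, conjOp u x = fibreConj (u x) :=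
  ContinuousLinearMap.coeFn_compLpL _ u

lemma conjOp_mulOp {φ : R3 → ℝ} (hφ : Continuous φ) (u : SpinorL2) :
    conjOp (mulOp (fun x => (φ x : ℂ)) u) = mulOp (fun x => (φ x : ℂ)) (conjOp u) := by
  have hφ' : Continuous fun x => (φ x : ℂ) := Complex.continuous_ofReal.comp hφ
  refine Lp.ext ?_
  filter_upwards [conjOp_coe (mulOp (fun x => (φ x : ℂ)) u), conjOp_coe u, mulOp_coe hφ' u,
    mulOp_coe hφ' (conjOp u)] with x h1 h2 h3 h4
  rw [h1, h3, h4, h2, map_smulₛₗ, Complex.conj_ofReal]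

/-- Charge conjugation anticommutes with the Pauli matrices. Being antilinear, it therefore commutes
with `i s^j`. -/
lemma conjOp_pauli (j : Fin 3) (u : SpinorL2) :
    conjOp (matOp (pauli j) u) = -matOp (pauli j) (conjOp u) := by
  refine Lp.ext ?_
  filter_upwards [conjOp_coe (matOp (pauli j) u), conjOp_coe u, matOp_coe (pauli j) u,
    matOp_coe (pauli j) (conjOp u), Lp.coeFn_neg (matOp (pauli j) (conjOp u))] with x h1 h2 h3 h4 h5
  rw [h1, h3, h5, Pi.neg_apply, h4, h2]
  ext i
  fin_cases j <;> fin_cases i <;>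
    simp [fibreConj_apply, pauli, Matrix.toLpLin_apply, dotProduct, Fin.sum_univ_two, mul_comm]

/-! ### The Fourier basis of the space of spinors -/

/-- The constant spinors of the standard basis of `ℂ²`. -/
def cst (i : Fin 2) : SpinorL2 := Lp.const 2 torusMeasure (EuclideanSpace.single i (1 : ℂ))

lemma cst_coe (i : Fin 2) : ∀ᵐ x ∂torusMeasure, cst i x = EuclideanSpace.single i (1 : ℂ) :=
  Lp.coeFn_const 2 torusMeasure _

lemma inner_mulOp_cst {φ : R3 → ℂ} (hφ : Continuous φ) (i : Fin 2) (u : SpinorL2) :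
    inner ℂ (mulOp φ (cst i)) u = ∫ x, (starRingEnd ℂ) (φ x) * u x i ∂torusMeasure := by
  rw [L2.inner_def]
  refine integral_congr_ae ?_
  filter_upwards [mulOp_coe hφ (cst i), cst_coe i] with x h1 h2
  rw [h1, h2, inner_smul_left, EuclideanSpace.inner_single_left]
  simp

lemma inner_mulOp_cst_mulOp_cst {φ ψ : R3 → ℂ} (hφ : Continuous φ) (hψ : Continuous ψ)
    (i j : Fin 2) : inner ℂ (mulOp φ (cst i)) (mulOp ψ (cst j)) =
      if i = j then ∫ x, (starRingEnd ℂ) (φ x) * ψ x ∂torusMeasure else 0 := by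
  rw [inner_mulOp_cst hφ]
  have : ∀ᵐ x ∂torusMeasure, (starRingEnd ℂ) (φ x) * mulOp ψ (cst j) x i =
      if i = j then (starRingEnd ℂ) (φ x) * ψ x else 0 := by
    filter_upwards [mulOp_coe hψ (cst j), cst_coe j] with x h1 h2
    rw [h1, h2]
    by_cases h : i = j <;> simp [h]
  rw [integral_congr_ae this]
  split_ifs <;> simp

/-- The normalisation constant of the Fourier basis. -/
def fnorm : ℝ := (Real.sqrt ((2 * Real.pi) ^ 3))⁻¹

lemma fnorm_pos : 0 < fnorm := by unfold fnorm; positivity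

lemma fnorm_sq : (fnorm : ℂ) * fnorm * ((2 * Real.pi) ^ 3 : ℝ) = 1 := by
  have h : (0 : ℝ) < (2 * Real.pi) ^ 3 := by positivity
  have : fnorm * fnorm * (2 * Real.pi) ^ 3 = 1 := by
    rw [fnorm, ← mul_inv, Real.mul_self_sqrt h.le, inv_mul_cancel₀ h.ne']
  exact_mod_cast this

/-- The normalised plane waves `(2π)^{-3/2} e^{i m·x} ⊗ e_i`. -/
def planeWave (k : (Fin 3 → ℤ) × Fin 2) : SpinorL2 := (fnorm : ℂ) • mulOp (expo k.1) (cst k.2)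

lemma orthonormal_planeWave : Orthonormal ℂ planeWave := by
  rw [orthonormal_iff_ite]
  rintro ⟨m, i⟩ ⟨n, j⟩
  rw [planeWave, planeWave, inner_smul_left, inner_smul_right,
    inner_mulOp_cst_mulOp_cst (continuous_expo m) (continuous_expo n)]
  have : ∀ x, (starRingEnd ℂ) (expo m x) * expo n x = expo (n - m) x := by
    intro x; rw [conj_expo, ← expo_add]; congr 1; abel
  simp only [this, integral_expo]
  by_cases hm : m = n
  · subst hm
    by_cases hi : i = j
    · subst hi
      simp only [sub_self, if_true, Complex.conj_ofReal]
      rw [← mul_assoc, fnorm_sq]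
    · simp [hi]
  · have : n - m ≠ 0 := fun h => hm (sub_eq_zero.1 h).symm
    simp [hm, this]

lemma inner_planeWave (m : Fin 3 → ℤ) (i : Fin 2) (u : SpinorL2) :
    inner ℂ (planeWave (m, i)) u =
      fnorm * ∫ x, (starRingEnd ℂ) (expo m x) * u x i ∂torusMeasure := by
  rw [planeWave, inner_smul_left, inner_mulOp_cst (continuous_expo m), Complex.conj_ofReal]

lemma memLp_coord (u : SpinorL2) (i : Fin 2) : MemLp (fun x => u x i) 2 torusMeasure :=
  (EuclideanSpace.proj (𝕜 := ℂ) i).comp_memLp' (Lp.memLp u)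

/-- The plane waves form a Hilbert basis of `L²`. -/
def fourierBasis : HilbertBasis ((Fin 3 → ℤ) × Fin 2) ℂ SpinorL2 :=
  HilbertBasis.mkOfOrthogonalEqBot orthonormal_planeWave (by
    rw [Submodule.eq_bot_iff]
    intro u hu
    have h0 : ∀ i : Fin 2, (fun x => u x i) =ᵐ[torusMeasure] 0 := by
      intro i
      refine ae_eq_zero_of_integral_expo (memLp_coord u i) fun m => ?_
      have := (Submodule.mem_orthogonal _ _).1 hu (planeWave (m, i))
        (Submodule.subset_span ⟨_, rfl⟩)
      rw [inner_planeWave] at this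
      exact (mul_eq_zero.1 this).resolve_left (by exact_mod_cast fnorm_pos.ne')
    refine Lp.ext ?_
    filter_upwards [h0 0, h0 1, Lp.coeFn_zero ℂ² 2 torusMeasure] with x h1 h2 h3
    rw [h3]
    ext i
    fin_cases i
    · exact h1
    · exact h2)

lemma fourierBasis_apply (k : (Fin 3 → ℤ) × Fin 2) : fourierBasis k = planeWave k := by
  rw [fourierBasis, HilbertBasis.coe_mkOfOrthogonalEqBot]

/-- The Fourier coefficients of a spinor field with respect to the plane waves. -/
def fcoef (u : SpinorL2) (m : Fin 3 → ℤ) (i : Fin 2) : ℂ := inner ℂ (planeWave (m, i)) u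

lemma fcoef_ext {u v : SpinorL2} (h : ∀ m i, fcoef u m i = fcoef v m i) : u = v := by
  apply fourierBasis.repr.injective
  ext ⟨m, i⟩
  rw [HilbertBasis.repr_apply_apply, HilbertBasis.repr_apply_apply, fourierBasis_apply]
  exact h m i

lemma hasSum_inner (u v : SpinorL2) :
    HasSum (fun k : (Fin 3 → ℤ) × Fin 2 => (starRingEnd ℂ) (fcoef u k.1 k.2) * fcoef v k.1 k.2)
      (inner ℂ u v) := by
  have := fourierBasis.hasSum_inner_mul_inner u v
  simp only [fourierBasis_apply] at this
  simpa only [fcoef, inner_conj_symm] using this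

@[simp] lemma fcoef_add (u v : SpinorL2) (m i) : fcoef (u + v) m i = fcoef u m i + fcoef v m i :=
  inner_add_right _ _ _

@[simp] lemma fcoef_sub (u v : SpinorL2) (m i) : fcoef (u - v) m i = fcoef u m i - fcoef v m i :=
  inner_sub_right _ _ _

@[simp] lemma fcoef_neg (u : SpinorL2) (m i) : fcoef (-u) m i = -fcoef u m i :=
  inner_neg_right _ _

@[simp] lemma fcoef_smul (c : ℂ) (u : SpinorL2) (m i) : fcoef (c • u) m i = c * fcoef u m i :=
  inner_smul_right _ _ _

@[simp] lemma fcoef_sum {ι : Type*} (s : Finset ι) (u : ι → SpinorL2) (m i) :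
    fcoef (∑ k ∈ s, u k) m i = ∑ k ∈ s, fcoef (u k) m i :=
  inner_sum _ _ _

lemma fcoef_eq_integral (u : SpinorL2) (m i) :
    fcoef u m i = fnorm * ∫ x, (starRingEnd ℂ) (expo m x) * u x i ∂torusMeasure :=
  inner_planeWave m i u

/-- Relation to the normalisation of the Fourier coefficients in `fourierCoeff3`. -/
lemma fcoef_mulOp_cst {ψ : R3 → ℂ} (hψ : Continuous ψ) (j : Fin 2) (m i) :
    fcoef (mulOp ψ (cst j)) m i =
      if i = j then fnorm * ((2 * Real.pi) ^ 3 : ℝ) * fourierCoeff3 ψ m else 0 := by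
  rw [fcoef, planeWave, inner_smul_left, inner_mulOp_cst_mulOp_cst (continuous_expo m) hψ,
    Complex.conj_ofReal, fourierCoeff3]
  split_ifs
  · simp only [expo_eq_fourier]
    have : (2 * (Real.pi : ℂ)) ^ 3 ≠ 0 := by
      have := Real.pi_ne_zero; simp [this]
    push_cast
    field_simp
  · simp

lemma integrable_expo_mul (u : SpinorL2) (m : Fin 3 → ℤ) (i : Fin 2) :
    Integrable (fun x => (starRingEnd ℂ) (expo m x) * u x i) torusMeasure := by
  have h := integrable_smul_spinor (fun x => (starRingEnd ℂ) (expo m x))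
    (Complex.continuous_conj.comp (continuous_expo m)) u
  exact (EuclideanSpace.proj (𝕜 := ℂ) i).integrable_comp h

lemma fcoef_matOp (A : Matrix (Fin 2) (Fin 2) ℂ) (u : SpinorL2) (m i) :
    fcoef (matOp A u) m i = ∑ k, A i k * fcoef u m k := by
  simp only [fcoef_eq_integral]
  have : ∀ᵐ x ∂torusMeasure, (starRingEnd ℂ) (expo m x) * matOp A u x i =
      ∑ k, A i k * ((starRingEnd ℂ) (expo m x) * u x k) := by
    filter_upwards [matOp_coe A u] with x h
    rw [h, Matrix.toLpLin_apply]
    simp only [Matrix.mulVec, dotProduct, Finset.mul_sum]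
    exact Finset.sum_congr rfl fun k _ => by ring
  rw [integral_congr_ae this,
    integral_finsetSum _ fun k _ => (integrable_expo_mul u m k).const_mul _, Finset.mul_sum]
  refine Finset.sum_congr rfl fun k _ => ?_
  rw [integral_const_mul]; ring

lemma fcoef_conjOp (u : SpinorL2) (m) (i : Fin 2) :
    fcoef (conjOp u) m i =
      ![-(starRingEnd ℂ) (fcoef u (-m) 1), (starRingEnd ℂ) (fcoef u (-m) 0)] i := by
  have key : ∀ k, (starRingEnd ℂ) (fcoef u (-m) k) =
      fnorm * ∫ x, (starRingEnd ℂ) (expo m x) * (starRingEnd ℂ) (u x k) ∂torusMeasure := by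
    intro k
    rw [fcoef_eq_integral, map_mul, Complex.conj_ofReal, ← integral_conj]
    simp only [map_mul, conj_expo, neg_neg]
  rw [fcoef_eq_integral]
  fin_cases i
  · have : ∀ᵐ x ∂torusMeasure, (starRingEnd ℂ) (expo m x) * conjOp u x 0 =
        -((starRingEnd ℂ) (expo m x) * (starRingEnd ℂ) (u x 1)) := by
      filter_upwards [conjOp_coe u] with x h
      rw [h, fibreConj_apply]; simp
    simp only [Fin.zero_eta, Matrix.cons_val_zero, key]
    rw [integral_congr_ae this, integral_neg, mul_neg]
  · have : ∀ᵐ x ∂torusMeasure, (starRingEnd ℂ) (expo m x) * conjOp u x 1 =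
        ((starRingEnd ℂ) (expo m x) * (starRingEnd ℂ) (u x 0)) := by
      filter_upwards [conjOp_coe u] with x h
      rw [h, fibreConj_apply]; simp
    simp only [Fin.mk_one, Matrix.cons_val_one, key]
    rw [integral_congr_ae this]
    rfl

/-! ### Fourier multipliers -/

/-- The Fourier multiplier with the given bounded symbol; the junk value for unbounded symbols is
zero. -/
def fmul (a : (Fin 3 → ℤ) → ℂ) : SpinorL2 →L[ℂ] SpinorL2 := by
  classical
  exact if ha : Memℓp (E := fun _ : (Fin 3 → ℤ) × Fin 2 => ℂ) (fun k => a k.1) ⊤ then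
    (fourierBasis.repr.symm.toContinuousLinearEquiv : _ →L[ℂ] SpinorL2) ∘L
      (lp.holderL (𝕜 := ℂ) (p := ⊤) (q := 2) 2 (fun _ => ContinuousLinearMap.mul ℂ ℂ) (K := 1)
        (fun _ => by simp) ⟨_, ha⟩) ∘L
      (fourierBasis.repr.toContinuousLinearEquiv : SpinorL2 →L[ℂ] _)
  else 0

lemma fcoef_fmul {a : (Fin 3 → ℤ) → ℂ} {K : ℝ} (ha : ∀ m, ‖a m‖ ≤ K) (u : SpinorL2) (m i) :
    fcoef (fmul a u) m i = a m * fcoef u m i := by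
  have ha' : Memℓp (E := fun _ : (Fin 3 → ℤ) × Fin 2 => ℂ) (fun k => a k.1) ⊤ :=
    memℓp_infty ⟨K, by rintro _ ⟨k, rfl⟩; exact ha k.1⟩
  have h : ∀ v, fcoef v m i = fourierBasis.repr v (m, i) := by
    intro v
    rw [HilbertBasis.repr_apply_apply, fourierBasis_apply, fcoef]
  rw [h, h, fmul, dif_pos ha']
  simp [lp.holderL]

/-! ### Weak derivatives in Fourier space -/

lemma fourierCoeff3_pd (α : Fin 3) {ψ : R3 → ℂ} (hψ : ContDiff ℝ 1 ψ) (hp : Periodic3 ψ)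
    (m : Fin 3 → ℤ) :
    fourierCoeff3 (pd α ψ) m = Complex.I * (m α : ℂ) * fourierCoeff3 ψ m := by
  have he : ContDiff ℝ 1 (expo (-m)) := (contDiff_expo _).of_le (by simp)
  have h := integral_pd_eq_zero α (he.mul hψ) (fun x β => by
    change expo (-m) _ * ψ _ = expo (-m) _ * ψ _
    rw [periodic_expo (-m) x β, hp x β])
  have hpd : Continuous (pd α ψ) := (hψ.continuous_fderiv (by simp)).clm_apply continuous_const
  have e : ∀ x, pd α (fun y => expo (-m) y * ψ y) x =
      -(Complex.I * (m α : ℂ) * (expo (-m) x * ψ x)) + expo (-m) x * pd α ψ x := by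
    intro x
    rw [pd_mul α he hψ, pd_expo]
    push_cast [Pi.neg_apply]
    ring
  change ∫ x, pd α (fun y => expo (-m) y * ψ y) x ∂torusMeasure = 0 at h
  simp only [e] at h
  rw [integral_add, integral_neg, integral_const_mul] at h
  · simp only [fourierCoeff3, ← expo_eq_fourier, conj_expo]
    linear_combination (1 / (2 * (Real.pi : ℂ)) ^ 3) * h
  · exact (integrable_of_continuous
      (continuous_const.mul ((continuous_expo (-m)).mul hψ.continuous))).neg
  · exact integrable_of_continuous ((continuous_expo (-m)).mul hpd)

lemma integral_smul_apply {φ : R3 → ℂ} (hφ : Continuous φ) (u : SpinorL2) (i : Fin 2) :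
    (∫ x, φ x • u x ∂torusMeasure) i = ∫ x, φ x * u x i ∂torusMeasure :=
  ((EuclideanSpace.proj (𝕜 := ℂ) i).integral_comp_comm (integrable_smul_spinor φ hφ u)).symm

/-- The components of `∫ φ u` as inner products with scalar functions times constant spinors, so
that Parseval's identity applies. -/
lemma integral_smul_apply' {φ : R3 → ℂ} (hφ : Continuous φ) (u : SpinorL2) (i : Fin 2) :
    (∫ x, φ x • u x ∂torusMeasure) i =
      inner ℂ (mulOp (fun x => (starRingEnd ℂ) (φ x)) (cst i)) u := by
  rw [integral_smul_apply hφ, inner_mulOp_cst (φ := fun x => (starRingEnd ℂ) (φ x))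
    (Complex.continuous_conj.comp hφ)]
  simp

lemma pd_conj (α : Fin 3) {φ : R3 → ℂ} (hφ : ContDiff ℝ 1 φ) (x : R3) :
    pd α (fun y => (starRingEnd ℂ) (φ y)) x = (starRingEnd ℂ) (pd α φ x) := by
  have := (Complex.conjCLE.toContinuousLinearMap.hasFDerivAt.comp x
    (hφ.differentiable (by simp) x).hasFDerivAt).fderiv
  change fderiv ℝ (fun y => (starRingEnd ℂ) (φ y)) x = _ at this
  rw [pd, this]
  rfl

lemma pd_ofReal (α : Fin 3) {φ : R3 → ℝ} (hφ : ContDiff ℝ 1 φ) (x : R3) :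
    pd α (fun y => (φ y : ℂ)) x = ((pd α φ x : ℝ) : ℂ) := by
  have := (Complex.ofRealCLM.hasFDerivAt.comp x
    (hφ.differentiable (by simp) x).hasFDerivAt).fderiv
  change fderiv ℝ (fun y => (φ y : ℂ)) x = _ at this
  rw [pd, this]
  rfl

/-- Weak differentiation is multiplication by `i m_α` in Fourier space. -/
lemma isWeakDeriv_iff (α : Fin 3) (u w : SpinorL2) :
    IsWeakDeriv α u w ↔ ∀ m i, fcoef w m i = Complex.I * (m α : ℂ) * fcoef u m i := by
  constructor
  · intro h m i
    have h1 := congrArg (fun v : EuclideanSpace ℂ (Fin 2) => v i)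
      (h (expo (-m)) (contDiff_expo _) (periodic_expo _))
    simp only [PiLp.neg_apply] at h1
    rw [integral_smul_apply (continuous_pd α _ (contDiff_expo _)),
      integral_smul_apply (continuous_expo _)] at h1
    simp only [pd_expo, Pi.neg_apply, Int.cast_neg, mul_assoc, integral_const_mul] at h1
    rw [fcoef_eq_integral, fcoef_eq_integral]
    simp only [conj_expo]
    linear_combination (fnorm : ℂ) * h1
  · intro h φ hφ hp
    have hφ1 : ContDiff ℝ 1 φ := hφ.of_le (by simp)
    have hc : ContDiff ℝ 1 (fun x => (starRingEnd ℂ) (φ x)) :=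
      Complex.conjCLE.contDiff.comp hφ1
    have hcp : Periodic3 (fun x => (starRingEnd ℂ) (φ x)) := fun x β => by
      change (starRingEnd ℂ) _ = _; rw [hp x β]
    have hpd := continuous_pd α φ hφ
    ext i
    rw [PiLp.neg_apply, integral_smul_apply' hpd, integral_smul_apply' hφ.continuous]
    have e : (fun x => (starRingEnd ℂ) (pd α φ x)) = pd α (fun x => (starRingEnd ℂ) (φ x)) :=
      funext fun x => (pd_conj α hφ1 x).symm
    rw [e]
    have hcont : Continuous (pd α (fun x => (starRingEnd ℂ) (φ x))) :=
      (hc.continuous_fderiv (by simp)).clm_apply continuous_const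
    refine (hasSum_inner _ _).unique ?_
    refine HasSum.congr_fun (hasSum_inner _ _).neg fun k => ?_
    rw [h, fcoef_mulOp_cst hcont, fcoef_mulOp_cst hc.continuous, fourierCoeff3_pd α hc hcp]
    split_ifs
    · simp only [map_mul, Complex.conj_I, Complex.conj_ofReal, map_intCast]
      ring
    · simp

lemma IsWeakDeriv.unique {α : Fin 3} {u w w' : SpinorL2} (h : IsWeakDeriv α u w)
    (h' : IsWeakDeriv α u w') : w = w' :=
  fcoef_ext fun m i => by rw [(isWeakDeriv_iff _ _ _).1 h, (isWeakDeriv_iff _ _ _).1 h']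

lemma IsWeakDeriv.matOp {α : Fin 3} {u w : SpinorL2} (h : IsWeakDeriv α u w)
    (A : Matrix (Fin 2) (Fin 2) ℂ) : IsWeakDeriv α (matOp A u) (matOp A w) := by
  rw [isWeakDeriv_iff] at h ⊢
  intro m i
  simp only [fcoef_matOp, h, Finset.mul_sum]
  exact Finset.sum_congr rfl fun k _ => by ring

/-- Integration by parts for two fields in `H¹`. -/
lemma IsWeakDeriv.inner_eq {α : Fin 3} {u w u' w' : SpinorL2} (h : IsWeakDeriv α u w)
    (h' : IsWeakDeriv α u' w') : inner ℂ u w' = -inner ℂ w u' := by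
  rw [isWeakDeriv_iff] at h h'
  refine (hasSum_inner _ _).unique ?_
  refine HasSum.congr_fun (hasSum_inner _ _).neg fun k => ?_
  rw [h, h']
  simp only [map_mul, Complex.conj_I, map_intCast]
  ring

/-- The Leibniz rule for the product of a smooth function and a field in `H¹`. -/
lemma IsWeakDeriv.mulOp {α : Fin 3} {u w : SpinorL2} (h : IsWeakDeriv α u w) {φ : R3 → ℝ}
    (hφ : ContDiff ℝ ∞ φ) (hp : Periodic3 φ) :
    IsWeakDeriv α (mulOp (fun x => (φ x : ℂ)) u)
      (mulOp (fun x => (φ x : ℂ)) w + mulOp (fun x => ((pd α φ x : ℝ) : ℂ)) u) := by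
  intro ψ hψ hψp
  have hφ1 : ContDiff ℝ 1 φ := hφ.of_le (by simp)
  have hψ1 : ContDiff ℝ 1 ψ := hψ.of_le (by simp)
  have hφc : ContDiff ℝ ∞ (fun x => (φ x : ℂ)) := Complex.ofRealCLM.contDiff.comp hφ
  have hc1 : Continuous (fun x => (φ x : ℂ)) := hφc.continuous
  have hc2 : Continuous (fun x => ((pd α φ x : ℝ) : ℂ)) :=
    Complex.continuous_ofReal.comp ((hφ1.continuous_fderiv (by simp)).clm_apply continuous_const)
  have key := h (fun x => ψ x * φ x) (hψ.mul hφc) (fun x β => by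
    change ψ _ * (φ _ : ℂ) = _; rw [hψp x β, hp x β])
  have hpψ := continuous_pd α ψ hψ
  have e1 : ∫ x, pd α (fun x => ψ x * (φ x : ℂ)) x • u x ∂torusMeasure =
      ∫ x, pd α ψ x • TorusDirac.mulOp (fun x => (φ x : ℂ)) u x ∂torusMeasure +
        ∫ x, ψ x • TorusDirac.mulOp (fun x => ((pd α φ x : ℝ) : ℂ)) u x ∂torusMeasure := by
    rw [← integral_add (integrable_smul_spinor _ hpψ _)
      (integrable_smul_spinor _ hψ.continuous _)]
    refine integral_congr_ae ?_
    filter_upwards [mulOp_coe hc1 u, mulOp_coe hc2 u] with x h1 h2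
    rw [h1, h2, pd_mul α hψ1 (hφc.of_le (by simp)), pd_ofReal α hφ1, add_smul, smul_smul, smul_smul]
  have e2 : ∫ x, (ψ x * (φ x : ℂ)) • w x ∂torusMeasure =
      ∫ x, ψ x • TorusDirac.mulOp (fun x => (φ x : ℂ)) w x ∂torusMeasure := by
    refine integral_congr_ae ?_
    filter_upwards [mulOp_coe hc1 w] with x h1
    rw [h1, smul_smul]
  have e3 : ∫ x, ψ x • (TorusDirac.mulOp (fun x => (φ x : ℂ)) w +
        TorusDirac.mulOp (fun x => ((pd α φ x : ℝ) : ℂ)) u : SpinorL2) x ∂torusMeasure =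
      ∫ x, ψ x • TorusDirac.mulOp (fun x => (φ x : ℂ)) w x ∂torusMeasure +
        ∫ x, ψ x • TorusDirac.mulOp (fun x => ((pd α φ x : ℝ) : ℂ)) u x ∂torusMeasure := by
    rw [← integral_add (integrable_smul_spinor _ hψ.continuous _)
      (integrable_smul_spinor _ hψ.continuous _)]
    refine integral_congr_ae ?_
    filter_upwards [Lp.coeFn_add (TorusDirac.mulOp (fun x => (φ x : ℂ)) w)
      (TorusDirac.mulOp (fun x => ((pd α φ x : ℝ) : ℂ)) u)] with x h1
    rw [h1, Pi.add_apply, smul_add]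
  rw [e3, ← e2, neg_add, ← key, e1]
  abel

/-! ### The inverse of the flat Dirac operator -/

/-- The symbol `m_j / ‖m‖²`, with value `0` at `m = 0`. -/
def rsym (j : Fin 3) (m : Fin 3 → ℤ) : ℂ := (m j : ℂ) / ∑ κ, (m κ : ℂ) ^ 2

lemma sum_sq_ne_zero {m : Fin 3 → ℤ} (hm : m ≠ 0) : (∑ κ, (m κ : ℂ) ^ 2) ≠ 0 := by
  intro h
  have h' : ∑ κ, (m κ) ^ 2 = 0 := by exact_mod_cast h
  rw [Finset.sum_eq_zero_iff_of_nonneg fun _ _ => sq_nonneg _] at h'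
  exact hm (funext fun κ => by simpa using h' κ (Finset.mem_univ κ))

lemma norm_mul_rsym_le (a j : Fin 3) (m : Fin 3 → ℤ) : ‖(m a : ℂ) * rsym j m‖ ≤ 1 := by
  by_cases hm : m = 0
  · simp [hm]
  have e : (∑ κ, (m κ : ℂ) ^ 2) = ((∑ κ, (m κ : ℝ) ^ 2 : ℝ) : ℂ) := by push_cast; rfl
  have hpos : 0 < ∑ κ, (m κ : ℝ) ^ 2 := by
    refine lt_of_le_of_ne (Finset.sum_nonneg fun _ _ => sq_nonneg _) fun h => ?_
    exact sum_sq_ne_zero hm (by rw [e, ← h]; simp)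
  have h1 : ∀ b, (m b : ℝ) ^ 2 ≤ ∑ κ, (m κ : ℝ) ^ 2 := fun b =>
    Finset.single_le_sum (f := fun κ => (m κ : ℝ) ^ 2) (fun _ _ => sq_nonneg _) (Finset.mem_univ b)
  rw [rsym, e, ← mul_div_assoc, norm_div, Complex.norm_real, Real.norm_of_nonneg hpos.le,
    div_le_one hpos, norm_mul, Complex.norm_intCast, Complex.norm_intCast]
  nlinarith [h1 a, h1 j, sq_abs (m a : ℝ), sq_abs (m j : ℝ), sq_nonneg (|(m a : ℝ)| - |(m j : ℝ)|)]

lemma norm_rsym_le (j : Fin 3) (m : Fin 3 → ℤ) : ‖rsym j m‖ ≤ 1 := by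
  by_cases hm : m j = 0
  · simp [rsym, hm]
  have h := norm_mul_rsym_le j j m
  rw [norm_mul, Complex.norm_intCast] at h
  have h1 : (1 : ℝ) ≤ |(m j : ℝ)| := by exact_mod_cast Int.one_le_abs hm
  nlinarith [norm_nonneg (rsym j m)]

lemma norm_I_mul_rsym_le (α j : Fin 3) (m : Fin 3 → ℤ) :
    ‖Complex.I * (m α : ℂ) * rsym j m‖ ≤ 1 := by
  rw [mul_assoc, norm_mul, Complex.norm_I, one_mul]
  exact norm_mul_rsym_le α j m

/-- The orthogonal projection onto the constant spinors, the kernel of the flat Dirac operator. -/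
def constProj : SpinorL2 →L[ℂ] SpinorL2 := pairProj (planeWave (0, 0)) (planeWave (0, 1))

/-- The inverse of the flat Dirac operator `-i s^α ∂_α` on the fields of mean zero. -/
def flatInv : SpinorL2 →L[ℂ] SpinorL2 := ∑ j, matOp (pauli j) ∘L fmul (rsym j)

/-- The isomorphism `P + (-i s^α ∂_α)⁻¹ (1 - P)` of `L²` onto `H¹`. -/
def sobolevIso : SpinorL2 →L[ℂ] SpinorL2 := constProj + flatInv

/-- The bounded operator `∂_α (-i s^β ∂_β)⁻¹ (1 - P)`, which is also `∂_α` composed with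
`sobolevIso`. -/
def riesz (α : Fin 3) : SpinorL2 →L[ℂ] SpinorL2 :=
  ∑ j, matOp (pauli j) ∘L fmul (fun m => Complex.I * (m α : ℂ) * rsym j m)

lemma fcoef_constProj (u : SpinorL2) (m : Fin 3 → ℤ) (i : Fin 2) :
    fcoef (constProj u) m i = if m = 0 then fcoef u 0 i else 0 := by
  have h : ∀ j : Fin 2, fcoef (planeWave (0, j)) m i = if m = 0 ∧ i = j then 1 else 0 := by
    intro j
    have := orthonormal_iff_ite.1 orthonormal_planeWave (m, i) (0, j)
    simpa [fcoef] using this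
  rw [constProj, pairProj_apply, fcoef_add, fcoef_smul, fcoef_smul, h, h]
  by_cases hm : m = 0
  · fin_cases i <;> simp [hm, fcoef]
  · simp [hm]

lemma fcoef_flatInv (u : SpinorL2) (m : Fin 3 → ℤ) (i : Fin 2) :
    fcoef (flatInv u) m i = ∑ j, ∑ k, pauli j i k * (rsym j m * fcoef u m k) := by
  simp only [flatInv, sum_apply, ContinuousLinearMap.comp_apply, fcoef_sum, fcoef_matOp,
    fcoef_fmul (norm_rsym_le _)]

lemma fcoef_riesz (α : Fin 3) (u : SpinorL2) (m : Fin 3 → ℤ) (i : Fin 2) :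
    fcoef (riesz α u) m i = Complex.I * (m α : ℂ) * fcoef (flatInv u) m i := by
  simp only [riesz, sum_apply, ContinuousLinearMap.comp_apply, fcoef_sum, fcoef_matOp,
    fcoef_fmul (norm_I_mul_rsym_le _ _), fcoef_flatInv, Finset.mul_sum]
  exact Finset.sum_congr rfl fun j _ => Finset.sum_congr rfl fun k _ => by ring

lemma isWeakDeriv_sobolevIso (α : Fin 3) (f : SpinorL2) :
    IsWeakDeriv α (sobolevIso f) (riesz α f) := by
  rw [isWeakDeriv_iff]
  intro m i
  rw [sobolevIso, add_apply, fcoef_add, fcoef_riesz, fcoef_constProj]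
  split_ifs with h
  · simp [h]
  · rw [zero_add]

lemma rsym_zero (j : Fin 3) : rsym j 0 = 0 := by simp [rsym]

/-- The flat Dirac operator inverts `flatInv` on fields of mean zero. -/
lemma sum_pauli_riesz (f : SpinorL2) :
    ∑ α, (-Complex.I) • matOp (pauli α) (riesz α f) = f - constProj f := by
  refine fcoef_ext fun m i => ?_
  simp only [fcoef_sum, fcoef_smul, fcoef_matOp, fcoef_riesz, fcoef_sub, fcoef_constProj,
    fcoef_flatInv]
  by_cases hm : m = 0
  · simp [hm]
  · -- The Clifford relations give `(Σ m_j s^j)² = ‖m‖²`.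
    rw [if_neg hm]
    have hn := sum_sq_ne_zero hm
    simp only [rsym]
    rw [Fin.sum_univ_three] at hn ⊢
    fin_cases i <;> simp [pauli, Fin.sum_univ_two, Fin.sum_univ_three] <;> field_simp <;>
      ring_nf <;> simp only [Complex.I_sq, Complex.I_pow_four] <;> ring

/-- Every field in `H¹` is in the range of `sobolevIso`, namely the image of `P u + D u` with `D`
the flat Dirac operator. -/
lemma sobolevIso_eq {u : SpinorL2} {w : Fin 3 → SpinorL2} (h : ∀ α, IsWeakDeriv α u (w α)) :
    sobolevIso (constProj u + ∑ α, (-Complex.I) • matOp (pauli α) (w α)) = u := by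
  refine fcoef_ext fun m i => ?_
  have h' := fun α => (isWeakDeriv_iff _ _ _).1 (h α)
  rw [sobolevIso, add_apply, fcoef_add, fcoef_constProj, fcoef_flatInv]
  simp only [fcoef_sum, fcoef_smul, fcoef_matOp, fcoef_add, fcoef_constProj, h']
  by_cases hm : m = 0
  · simp [hm, rsym_zero]
  · -- The Clifford relations give `(Σ m_j s^j)² = ‖m‖²`.
    simp only [if_neg hm]
    have hn := sum_sq_ne_zero hm
    simp only [rsym]
    rw [Fin.sum_univ_three] at hn ⊢
    fin_cases i <;> simp [pauli, Fin.sum_univ_two, Fin.sum_univ_three] <;> field_simp <;>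
      ring_nf <;> simp only [Complex.I_sq, Complex.I_pow_four] <;> ring

lemma conjOp_constProj (u : SpinorL2) : conjOp (constProj u) = constProj (conjOp u) := by
  refine fcoef_ext fun m i => ?_
  rw [fcoef_conjOp, fcoef_constProj, fcoef_constProj, fcoef_constProj, fcoef_conjOp]
  by_cases hm : m = 0
  · simp [hm]
  · fin_cases i <;> simp [hm]

lemma conj_rsym_neg (j : Fin 3) (m : Fin 3 → ℤ) :
    (starRingEnd ℂ) (rsym j (-m)) = -rsym j m := by
  simp [rsym, neg_div]

lemma conjOp_flatInv (u : SpinorL2) : conjOp (flatInv u) = flatInv (conjOp u) := by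
  refine fcoef_ext fun m i => ?_
  rw [fcoef_conjOp, fcoef_flatInv, fcoef_flatInv, fcoef_flatInv]
  simp only [fcoef_conjOp]
  fin_cases i <;>
    simp [pauli, Fin.sum_univ_two, Fin.sum_univ_three, conj_rsym_neg] <;> ring

lemma conjOp_sobolevIso (u : SpinorL2) : conjOp (sobolevIso u) = sobolevIso (conjOp u) := by
  simp [sobolevIso, conjOp_constProj, conjOp_flatInv]

lemma conjOp_riesz (α : Fin 3) (u : SpinorL2) : conjOp (riesz α u) = riesz α (conjOp u) := by
  refine fcoef_ext fun m i => ?_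
  rw [fcoef_conjOp, fcoef_riesz, fcoef_riesz, fcoef_riesz, ← conjOp_flatInv, fcoef_conjOp]
  fin_cases i <;> simp

/-! ### First-order symmetric operators with Pauli matrix coefficients -/

/-- The operator
`-i Σ c_{jα} s^j ∂_α - (i/2) Σ (∂_α c_{jα}) s^j + F`, composed with `sobolevIso` to be bounded. -/
def diracOp (c : Fin 3 → Fin 3 → R3 → ℝ) (F : R3 → ℝ) : SpinorL2 →L[ℂ] SpinorL2 :=
  (∑ j, ∑ α, ((-Complex.I) • (mulOp (fun x => (c j α x : ℂ)) ∘L matOp (pauli j) ∘L riesz α) +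
    (-Complex.I / 2) • (mulOp (fun x => ((pd α (c j α) x : ℝ) : ℂ)) ∘L matOp (pauli j) ∘L
      sobolevIso))) + mulOp (fun x => (F x : ℂ)) ∘L sobolevIso

/-- Multiplication by a density, composed with `sobolevIso`. -/
def densityOp (ρ : R3 → ℝ) : SpinorL2 →L[ℂ] SpinorL2 :=
  mulOp (fun x => (ρ x : ℂ)) ∘L sobolevIso

lemma diracOp_apply (c : Fin 3 → Fin 3 → R3 → ℝ) (F : R3 → ℝ) (f : SpinorL2) :
    diracOp c F f = (∑ j, ∑ α, ((-Complex.I) • mulOp (fun x => (c j α x : ℂ))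
        (matOp (pauli j) (riesz α f)) +
      (-Complex.I / 2) • mulOp (fun x => ((pd α (c j α) x : ℝ) : ℂ))
        (matOp (pauli j) (sobolevIso f)))) + mulOp (fun x => (F x : ℂ)) (sobolevIso f) := by
  simp [diracOp]

lemma continuous_pd_real {φ : R3 → ℝ} (hφ : ContDiff ℝ ∞ φ) (α : Fin 3) : Continuous (pd α φ) :=
  (hφ.continuous_fderiv (by simp)).clm_apply continuous_const

section Structure

variable {c : Fin 3 → Fin 3 → R3 → ℝ} {F ρ : R3 → ℝ}

/-- Formal self-adjointness with respect to Lebesgue measure: the terms with `∂_α c_{jα}` compensate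
for the derivatives of the coefficients in the integration by parts. -/
lemma inner_diracOp (hc : ∀ j α, ContDiff ℝ ∞ (c j α)) (hp : ∀ j α, Periodic3 (c j α))
    (hF : Continuous F) (f f' : SpinorL2) :
    inner ℂ (sobolevIso f) (diracOp c F f') = inner ℂ (diracOp c F f) (sobolevIso f') := by
  rw [diracOp_apply, diracOp_apply, inner_add_left, inner_add_right, inner_mulOp_ofReal hF]
  congr 1
  simp only [inner_sum, sum_inner]
  refine Finset.sum_congr rfl fun j _ => Finset.sum_congr rfl fun α _ => ?_
  have hcj : Continuous fun x => (c j α x : ℂ) := Complex.continuous_ofReal.comp (hc j α).continuous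
  have hcd : Continuous fun x => ((pd α (c j α) x : ℝ) : ℂ) :=
    Complex.continuous_ofReal.comp (continuous_pd_real (hc j α) α)
  have key := (isWeakDeriv_sobolevIso α f).inner_eq
    (((isWeakDeriv_sobolevIso α f').matOp (pauli j)).mulOp (hc j α) (hp j α))
  simp only [inner_add_left, inner_add_right, inner_smul_left, inner_smul_right,
    inner_mulOp_ofReal (hc j α).continuous, inner_mulOp_ofReal (continuous_pd_real (hc j α) α),
    inner_matOp_left (pauli_isHermitian j), matOp_mulOp _ hcj, matOp_mulOp _ hcd] at key ⊢
  simp only [map_neg, map_div₀, Complex.conj_I, map_ofNat]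
  linear_combination (-Complex.I) * key

lemma inner_densityOp (hρ : Continuous ρ) (f f' : SpinorL2) :
    inner ℂ (sobolevIso f) (densityOp ρ f') = inner ℂ (densityOp ρ f) (sobolevIso f') := by
  simp only [densityOp, ContinuousLinearMap.comp_apply, inner_mulOp_ofReal hρ]

/-- The operators commute with charge conjugation because the coefficients `c` and `F` are real. -/
lemma conjOp_diracOp (hc : ∀ j α, ContDiff ℝ ∞ (c j α)) (hF : Continuous F) (f : SpinorL2) :
    conjOp (diracOp c F f) = diracOp c F (conjOp f) := by
  rw [diracOp_apply, diracOp_apply, map_add, map_sum, conjOp_mulOp hF, conjOp_sobolevIso]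
  congr 1
  refine Finset.sum_congr rfl fun j _ => ?_
  rw [map_sum]
  refine Finset.sum_congr rfl fun α _ => ?_
  simp only [map_add, map_smulₛₗ, conjOp_mulOp (hc j α).continuous,
    conjOp_mulOp (continuous_pd_real (hc j α) α), conjOp_pauli, conjOp_riesz, conjOp_sobolevIso,
    map_neg, map_div₀, Complex.conj_I, map_ofNat, smul_neg, neg_smul, neg_neg, neg_div]

lemma conjOp_densityOp (hρ : Continuous ρ) (f : SpinorL2) :
    conjOp (densityOp ρ f) = densityOp ρ (conjOp f) := by
  simp only [densityOp, ContinuousLinearMap.comp_apply, conjOp_mulOp hρ, conjOp_sobolevIso]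

/-- The pointwise value of the operator of `diracOp` on a spinor with value `u` and derivatives
`w α`. -/
def diracFibre (c : Fin 3 → Fin 3 → R3 → ℝ) (F : R3 → ℝ) (x : R3)
    (w : Fin 3 → EuclideanSpace ℂ (Fin 2)) (u : EuclideanSpace ℂ (Fin 2)) :
    EuclideanSpace ℂ (Fin 2) :=
  (∑ j, ∑ α, ((-Complex.I) • (c j α x : ℂ) • Matrix.toEuclideanLin (pauli j) (w α) +
    (-Complex.I / 2) • ((pd α (c j α) x : ℝ) : ℂ) • Matrix.toEuclideanLin (pauli j) u)) +
    (F x : ℂ) • u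

lemma coeFn_finset_sum {ι : Type*} (s : Finset ι) (f : ι → SpinorL2) :
    ∀ᵐ x ∂torusMeasure, (∑ i ∈ s, f i : SpinorL2) x = ∑ i ∈ s, f i x := by
  classical
  induction s using Finset.induction_on with
  | empty =>
    filter_upwards [Lp.coeFn_zero (EuclideanSpace ℂ (Fin 2)) 2 torusMeasure] with x hx
    simpa using hx
  | insert a s ha ih =>
    rw [Finset.sum_insert ha]
    filter_upwards [Lp.coeFn_add (f a) (∑ i ∈ s, f i), ih] with x h1 h2
    rw [h1, Pi.add_apply, h2, Finset.sum_insert ha]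

lemma diracOp_coe (hc : ∀ j α, ContDiff ℝ ∞ (c j α)) (hF : Continuous F) (f : SpinorL2) :
    ∀ᵐ x ∂torusMeasure, diracOp c F f x =
      diracFibre c F x (fun α => riesz α f x) (sobolevIso f x) := by
  rw [diracOp_apply]
  have hFc : Continuous fun x => (F x : ℂ) := Complex.continuous_ofReal.comp hF
  have h1 : ∀ j α, ∀ᵐ x ∂torusMeasure,
      ((-Complex.I) • mulOp (fun x => (c j α x : ℂ)) (matOp (pauli j) (riesz α f)) +
      (-Complex.I / 2) • mulOp (fun x => ((pd α (c j α) x : ℝ) : ℂ))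
        (matOp (pauli j) (sobolevIso f)) : SpinorL2) x =
      (-Complex.I) • (c j α x : ℂ) • Matrix.toEuclideanLin (pauli j) (riesz α f x) +
      (-Complex.I / 2) • ((pd α (c j α) x : ℝ) : ℂ) •
        Matrix.toEuclideanLin (pauli j) (sobolevIso f x) := by
    intro j α
    have hcj : Continuous fun x => (c j α x : ℂ) :=
      Complex.continuous_ofReal.comp (hc j α).continuous
    have hcd : Continuous fun x => ((pd α (c j α) x : ℝ) : ℂ) :=
      Complex.continuous_ofReal.comp (continuous_pd_real (hc j α) α)
    filter_upwards [Lp.coeFn_add ((-Complex.I) • mulOp (fun x => (c j α x : ℂ))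
        (matOp (pauli j) (riesz α f))) ((-Complex.I / 2) • mulOp
        (fun x => ((pd α (c j α) x : ℝ) : ℂ)) (matOp (pauli j) (sobolevIso f))),
      Lp.coeFn_smul (-Complex.I) (mulOp (fun x => (c j α x : ℂ)) (matOp (pauli j) (riesz α f))),
      Lp.coeFn_smul (-Complex.I / 2) (mulOp (fun x => ((pd α (c j α) x : ℝ) : ℂ))
        (matOp (pauli j) (sobolevIso f))),
      mulOp_coe hcj (matOp (pauli j) (riesz α f)), mulOp_coe hcd (matOp (pauli j) (sobolevIso f)),
      matOp_coe (pauli j) (riesz α f), matOp_coe (pauli j) (sobolevIso f)]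
      with x a1 a2 a3 a4 a5 a6 a7
    rw [a1, Pi.add_apply, a2, a3, Pi.smul_apply, Pi.smul_apply, a4, a5, a6, a7]
  have h2 : ∀ᵐ x ∂torusMeasure, ∀ j α, _ := ae_all_iff.2 fun j => ae_all_iff.2 fun α => h1 j α
  have h3 : ∀ᵐ x ∂torusMeasure, ∀ j, _ :=
    ae_all_iff.2 fun j => coeFn_finset_sum Finset.univ fun α =>
      ((-Complex.I) • mulOp (fun x => (c j α x : ℂ)) (matOp (pauli j) (riesz α f)) +
      (-Complex.I / 2) • mulOp (fun x => ((pd α (c j α) x : ℝ) : ℂ))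
        (matOp (pauli j) (sobolevIso f)) : SpinorL2)
  filter_upwards [h2, h3, coeFn_finset_sum Finset.univ fun j => ∑ α,
      ((-Complex.I) • mulOp (fun x => (c j α x : ℂ)) (matOp (pauli j) (riesz α f)) +
      (-Complex.I / 2) • mulOp (fun x => ((pd α (c j α) x : ℝ) : ℂ))
        (matOp (pauli j) (sobolevIso f)) : SpinorL2),
    Lp.coeFn_add (∑ j, ∑ α, ((-Complex.I) • mulOp (fun x => (c j α x : ℂ))
        (matOp (pauli j) (riesz α f)) +
      (-Complex.I / 2) • mulOp (fun x => ((pd α (c j α) x : ℝ) : ℂ))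
        (matOp (pauli j) (sobolevIso f)))) (mulOp (fun x => (F x : ℂ)) (sobolevIso f)),
    mulOp_coe hFc (sobolevIso f)] with x a1 a2 a3 a4 a5
  rw [a4, Pi.add_apply, a5, a3, diracFibre]
  simp only [a2, a1]

/-- The eigenvalue equation of the massless Dirac operator, multiplied by the density and written
in terms of `f` with `u = sobolevIso f`, is an equation between bounded operators. -/
lemma mem_eigenspace_iff {g e : R3 → Matrix (Fin 3) (Fin 3) ℝ}
    (hc : ∀ j α, ContDiff ℝ ∞ (c j α)) (hF : Continuous F) (hρ : Continuous ρ)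
    (hρ0 : ∀ x, ρ x ≠ 0)
    (h : ∀ x w u, (ρ x : ℂ) • diracSymbol g e x w u = diracFibre c F x w u) (μ : ℂ)
    (u : SpinorL2) :
    u ∈ eigenspace g e μ ↔ ∃ f, u = sobolevIso f ∧ diracOp c F f = μ • densityOp ρ f := by
  have hρc : Continuous fun x => (ρ x : ℂ) := Complex.continuous_ofReal.comp hρ
  have hmem : u ∈ eigenspace g e μ ↔ ∃ w : Fin 3 → SpinorL2, (∀ α, IsWeakDeriv α u (w α)) ∧
      ∀ᵐ x ∂torusMeasure, (μ • u : SpinorL2) x = diracSymbol g e x (fun α => w α x) (u x) :=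
    Iff.rfl
  have hval : ∀ f : SpinorL2, (∀ᵐ x ∂torusMeasure, (μ • sobolevIso f : SpinorL2) x =
      diracSymbol g e x (fun α => riesz α f x) (sobolevIso f x)) ↔
      diracOp c F f = μ • densityOp ρ f := by
    intro f
    rw [Lp.ext_iff]
    refine eventually_congr ?_
    filter_upwards [diracOp_coe hc hF f, Lp.coeFn_smul μ (densityOp ρ f),
      mulOp_coe hρc (sobolevIso f), Lp.coeFn_smul μ (sobolevIso f)] with x h1 h2 h3 h4
    have h3' : densityOp ρ f x = (ρ x : ℂ) • sobolevIso f x := h3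
    rw [h1, h2, Pi.smul_apply, h3', h4, Pi.smul_apply, ← h, smul_comm μ]
    have : (ρ x : ℂ) ≠ 0 := by exact_mod_cast hρ0 x
    rw [smul_right_inj this]
    exact eq_comm
  rw [hmem]
  constructor
  · rintro ⟨w, hw, hae⟩
    have hu := sobolevIso_eq hw
    set f := constProj u + ∑ α, (-Complex.I) • matOp (pauli α) (w α)
    refine ⟨f, hu.symm, (hval f).1 ?_⟩
    have hwf : ∀ α, w α = riesz α f := fun α =>
      (hw α).unique (by rw [← hu]; exact isWeakDeriv_sobolevIso α f)
    rw [hu]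
    simpa only [hwf] using hae
  · rintro ⟨f, rfl, hf⟩
    exact ⟨fun α => riesz α f, fun α => isWeakDeriv_sobolevIso α f, (hval f).2 hf⟩

end Structure

/-! ### The Dirac operator in a coframe -/

/-- The cofactor `c_{jα} = det(e) e_j^α` of the coframe, with indices taken modulo `3`. -/
def cofE (e : R3 → Matrix (Fin 3) (Fin 3) ℝ) (j α : Fin 3) (x : R3) : ℝ :=
  e x (j + 1) (α + 1) * e x (j + 2) (α + 2) - e x (j + 1) (α + 2) * e x (j + 2) (α + 1)

/-- The scalar `(1/4) Σ_k ε_{αβγ} e^k_α ∂_β e^k_γ`, the density of the axial torsion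
of the coframe. -/
def axialE (e : R3 → Matrix (Fin 3) (Fin 3) ℝ) (x : R3) : ℝ :=
  (1 / 4) * ∑ k, ∑ α, e x k α * (pd (α + 1) (fun y => e y k (α + 2)) x -
    pd (α + 2) (fun y => e y k (α + 1)) x)

lemma pd_mul_real (α : Fin 3) {f g : R3 → ℝ} (hf : ContDiff ℝ ∞ f) (hg : ContDiff ℝ ∞ g)
    (x : R3) : pd α (fun y => f y * g y) x = pd α f x * g x + f x * pd α g x := by
  rw [pd, fderiv_fun_mul (hf.differentiable (by simp) x) (hg.differentiable (by simp) x)]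
  simp [pd]; ring

lemma pd_sub_real (α : Fin 3) {f g : R3 → ℝ} (hf : ContDiff ℝ ∞ f) (hg : ContDiff ℝ ∞ g)
    (x : R3) : pd α (fun y => f y - g y) x = pd α f x - pd α g x := by
  rw [pd, fderiv_fun_sub (hf.differentiable (by simp) x) (hg.differentiable (by simp) x)]
  rfl

lemma pd_sum_real {ι : Type*} (s : Finset ι) (α : Fin 3) {f : ι → R3 → ℝ}
    (hf : ∀ i, ContDiff ℝ ∞ (f i)) (x : R3) :
    pd α (fun y => ∑ i ∈ s, f i y) x = ∑ i ∈ s, pd α (f i) x := by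
  rw [pd, fderiv_fun_sum fun i _ => (hf i).differentiable (by simp) x]
  simp [pd]

section Algebra

/-- Contraction of the spin connection coefficients of a frame with three Pauli matrices. Here
`p k l j` stands for the derivative of `e^k` along the `l`-th frame vector, evaluated on the `j`-th
frame vector. -/
lemma pauli_contraction (p : Fin 3 → Fin 3 → Fin 3 → ℝ) :
    (1 / 4 : ℂ) • ∑ l, ∑ k, ∑ j, (((-p k l j + (1 / 2) * ((p k l j + p j l k) +
      (p k j l + p l j k) - (p j k l + p l k j)) : ℝ)) : ℂ) • (pauli l * (pauli k * pauli j)) =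
    (1 / 2 : ℂ) • ∑ j, ((∑ k, (p k j k - p k k j) : ℝ) : ℂ) • pauli j +
      (Complex.I * (((1 / 4) * ∑ k, (p k (k + 1) (k + 2) - p k (k + 2) (k + 1)) : ℝ) : ℂ)) •
        (1 : Matrix (Fin 2) (Fin 2) ℂ) := by
  ext a b
  fin_cases a <;> fin_cases b <;>
    simp [Fin.sum_univ_three, pauli, Matrix.add_apply, Matrix.smul_apply] <;>
    ring_nf

end Algebra

/-- The derivative `∂_α e^k_γ` as a matrix in `k, γ`. -/
def pdMat (e : R3 → Matrix (Fin 3) (Fin 3) ℝ) (α : Fin 3) (x : R3) : Matrix (Fin 3) (Fin 3) ℝ :=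
  Matrix.of fun k γ => pd α (fun y => e y k γ) x

/-- The frame components `(∇_l e^k)_j` of the derivative of the coframe. -/
def frameDeriv (e : R3 → Matrix (Fin 3) (Fin 3) ℝ) (x : R3) (k l j : Fin 3) : ℝ :=
  ∑ α, (e x)⁻¹ α l * (pdMat e α x * (e x)⁻¹) k j

section Coframe

variable {g e : R3 → Matrix (Fin 3) (Fin 3) ℝ}

lemma contDiff_cofE (he : ∀ j α, ContDiff ℝ ∞ fun x => e x j α) (j α : Fin 3) :
    ContDiff ℝ ∞ (cofE e j α) :=
  ((he _ _).mul (he _ _)).sub ((he _ _).mul (he _ _))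

lemma contDiff_det (he : ∀ j α, ContDiff ℝ ∞ fun x => e x j α) :
    ContDiff ℝ ∞ fun x => (e x).det := by
  simp only [Matrix.det_fin_three]
  have := he
  fun_prop

/-- The definition of `cofE` modulo `3` absorbs the signs of the cofactors. -/
lemma cofE_eq {x : R3} (h0 : (e x).det ≠ 0) (j α : Fin 3) :
    cofE e j α x = (e x).det * frame e j α x := by
  have h : (e x).det * frame e j α x = (e x).adjugate α j := by
    rw [frame, Matrix.transpose_apply, Matrix.inv_def, Matrix.smul_apply, Ring.inverse_eq_inv',
      smul_eq_mul, mul_inv_cancel_left₀ h0]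
  rw [h, Matrix.adjugate_fin_three, cofE]
  fin_cases j <;> fin_cases α <;> simp <;> ring

lemma contDiff_frame (he : ∀ j α, ContDiff ℝ ∞ fun x => e x j α) (h0 : ∀ x, (e x).det ≠ 0)
    (j α : Fin 3) : ContDiff ℝ ∞ (frame e j α) := by
  have : frame e j α = fun x => cofE e j α x / (e x).det := by
    ext x
    rw [cofE_eq (h0 x), mul_div_cancel_left₀ _ (h0 x)]
  rw [this]
  exact (contDiff_cofE he j α).div (contDiff_det he) h0

lemma mul_frame {x : R3} (h0 : (e x).det ≠ 0) (k j : Fin 3) :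
    ∑ β, e x k β * frame e j β x = if k = j then 1 else 0 := by
  have := congrFun (congrFun (Matrix.mul_nonsing_inv (e x) (isUnit_iff_ne_zero.2 h0)) k) j
  rw [Matrix.mul_apply, Matrix.one_apply] at this
  exact this

/-- Differentiation of `e e⁻¹ = 1`. -/
lemma sum_mul_pd_frame (he : ∀ j α, ContDiff ℝ ∞ fun x => e x j α) (h0 : ∀ x, (e x).det ≠ 0)
    (α k j : Fin 3) (x : R3) :
    ∑ β, e x k β * pd α (frame e j β) x = -(pdMat e α x * (e x)⁻¹) k j := by
  have h : pd α (fun y => ∑ β, e y k β * frame e j β y) x = 0 := by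
    have : (fun y => ∑ β, e y k β * frame e j β y) = fun _ => if k = j then 1 else 0 :=
      funext fun y => mul_frame (h0 y) k j
    rw [this, pd]; simp
  rw [pd_sum_real _ _ fun β => (he k β).mul (contDiff_frame he h0 j β)] at h
  simp only [pd_mul_real α (he k _) (contDiff_frame he h0 j _), Finset.sum_add_distrib] at h
  rw [Matrix.mul_apply]
  have e1 : ∑ β, pdMat e α x k β * (e x)⁻¹ β j = ∑ β, pd α (fun y => e y k β) x * frame e j β x :=
    rfl
  rw [e1]
  linarith

lemma sigmaDown_eq {x : R3} (hg : g x = (e x)ᵀ * e x) (h0 : (e x).det ≠ 0) (β : Fin 3) :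
    sigmaDown g e β x = ∑ k, (e x k β : ℂ) • pauli k := by
  have h : ∀ k, ∑ α, g x β α * frame e k α x = e x k β := by
    intro k
    have : g x * (e x)⁻¹ = (e x)ᵀ := by
      rw [hg, Matrix.mul_assoc, Matrix.mul_nonsing_inv _ (isUnit_iff_ne_zero.2 h0), Matrix.mul_one]
    have := congrFun (congrFun this β) k
    rwa [Matrix.mul_apply] at this
  simp only [sigmaDown, sigmaUp, Finset.smul_sum, smul_smul]
  rw [Finset.sum_comm]
  refine Finset.sum_congr rfl fun k _ => ?_
  rw [← Finset.sum_smul, ← h k]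
  push_cast
  rfl

lemma pdSigmaUp_eq (he : ∀ j α, ContDiff ℝ ∞ fun x => e x j α) (h0 : ∀ x, (e x).det ≠ 0)
    (α β : Fin 3) (x : R3) :
    pdSigmaUp e α β x = ∑ j, ((pd α (frame e j β) x : ℝ) : ℂ) • pauli j := by
  ext a b
  have hd : ∀ j, DifferentiableAt ℝ (fun y => (frame e j β y : ℂ)) x := fun j =>
    Complex.ofRealCLM.differentiableAt.comp x
      ((contDiff_frame he h0 j β).differentiable (by simp) x)
  have e1 : (fun y => sigmaUp e β y a b) = fun y => ∑ j, (frame e j β y : ℂ) * pauli j a b := by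
    ext y; simp [sigmaUp, Matrix.sum_apply]
  rw [pdSigmaUp, Matrix.of_apply, e1, pd, fderiv_fun_sum fun j _ => (hd j).mul_const _]
  simp only [sum_apply, Matrix.sum_apply, Matrix.smul_apply, smul_eq_mul]
  refine Finset.sum_congr rfl fun j _ => ?_
  rw [fderiv_mul_const (hd j), smul_apply, smul_eq_mul, mul_comm,
    ← pd_ofReal α ((contDiff_frame he h0 j β).of_le (by simp))]
  rfl

lemma pd_metric (he : ∀ j α, ContDiff ℝ ∞ fun x => e x j α) (hg : ∀ x, g x = (e x)ᵀ * e x)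
    (α γ δ : Fin 3) (x : R3) : pd α (fun y => g y γ δ) x =
      ((pdMat e α x)ᵀ * e x + (e x)ᵀ * pdMat e α x) γ δ := by
  have e1 : (fun y => g y γ δ) = fun y => ∑ i, e y i γ * e y i δ := by
    ext y; rw [hg, Matrix.mul_apply]; rfl
  rw [e1, pd_sum_real _ _ fun i => (he i γ).mul (he i δ)]
  simp only [pd_mul_real α (he _ γ) (he _ δ), Matrix.add_apply, Matrix.mul_apply,
    Finset.sum_add_distrib, Matrix.transpose_apply]
  rfl

/-- The derivative of the metric, with its two arguments contracted with frame vectors. -/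
lemma sum_pd_metric (he : ∀ j α, ContDiff ℝ ∞ fun x => e x j α) (hg : ∀ x, g x = (e x)ᵀ * e x)
    (h0 : ∀ x, (e x).det ≠ 0) (α j k : Fin 3) (x : R3) :
    ∑ γ, ∑ δ, (e x)⁻¹ γ j * (e x)⁻¹ δ k * pd α (fun y => g y γ δ) x =
      (pdMat e α x * (e x)⁻¹) k j + (pdMat e α x * (e x)⁻¹) j k := by
  have hEN : e x * (e x)⁻¹ = 1 := Matrix.mul_nonsing_inv _ (isUnit_iff_ne_zero.2 (h0 x))
  have hNE : ((e x)⁻¹)ᵀ * (e x)ᵀ = 1 := by rw [← Matrix.transpose_mul, hEN, Matrix.transpose_one]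
  have key : ((e x)⁻¹)ᵀ * ((pdMat e α x)ᵀ * e x + (e x)ᵀ * pdMat e α x) * (e x)⁻¹ =
      (pdMat e α x * (e x)⁻¹)ᵀ + pdMat e α x * (e x)⁻¹ := by
    rw [Matrix.mul_add, Matrix.add_mul, Matrix.mul_assoc, Matrix.mul_assoc, hEN, Matrix.mul_one,
      ← Matrix.mul_assoc _ (e x)ᵀ, hNE, Matrix.one_mul, Matrix.transpose_mul]
  have := congrFun (congrFun key j) k
  rw [Matrix.add_apply, Matrix.transpose_apply] at this
  rw [← this, Matrix.mul_apply]
  have hrow : ∀ B : Matrix (Fin 3) (Fin 3) ℝ, ∀ δ,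
      (((e x)⁻¹)ᵀ * B) j δ = ∑ γ, (e x)⁻¹ γ j * B γ δ := fun B δ => Matrix.mul_apply
  simp only [hrow, Finset.sum_mul, pd_metric he hg]
  rw [Finset.sum_comm]
  exact Finset.sum_congr rfl fun γ _ => Finset.sum_congr rfl fun δ _ => by ring

lemma sum_mul_christoffel (hg : ∀ x, g x = (e x)ᵀ * e x)
    (h0 : ∀ x, (e x).det ≠ 0) (k α γ : Fin 3) (x : R3) :
    ∑ β, e x k β * christoffel g β α γ x = (1 / 2) * ∑ δ, (e x)⁻¹ δ k *
      (pd α (fun y => g y γ δ) x + pd γ (fun y => g y α δ) x - pd δ (fun y => g y α γ) x) := by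
  have h : ∀ δ, ∑ β, e x k β * (g x)⁻¹ β δ = (e x)⁻¹ δ k := by
    intro δ
    have hEN : e x * (e x)⁻¹ = 1 := Matrix.mul_nonsing_inv _ (isUnit_iff_ne_zero.2 (h0 x))
    have : e x * (g x)⁻¹ = ((e x)⁻¹)ᵀ := by
      rw [hg, Matrix.mul_inv_rev, ← Matrix.mul_assoc, hEN, Matrix.one_mul,
        Matrix.transpose_nonsing_inv]
    have := congrFun (congrFun this k) δ
    rwa [Matrix.mul_apply] at this
  simp only [christoffel, ← h, Finset.mul_sum, Finset.sum_mul]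
  rw [Finset.sum_comm]
  exact Finset.sum_congr rfl fun δ _ => Finset.sum_congr rfl fun β _ => by ring

/-- The connection coefficients of the frame in terms of the derivatives of the coframe. -/
lemma connection_coeff (he : ∀ j α, ContDiff ℝ ∞ fun x => e x j α)
    (hg : ∀ x, g x = (e x)ᵀ * e x) (h0 : ∀ x, (e x).det ≠ 0) (k j l : Fin 3) (x : R3) :
    ∑ α, (e x)⁻¹ α l * ∑ β, e x k β *
        (pd α (frame e j β) x + ∑ γ, christoffel g β α γ x * frame e j γ x) =
      -frameDeriv e x k l j + (1 / 2) * ((frameDeriv e x k l j + frameDeriv e x j l k) +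
        (frameDeriv e x k j l + frameDeriv e x l j k) -
        (frameDeriv e x j k l + frameDeriv e x l k j)) := by
  have h1 : ∀ α, ∑ β, e x k β *
      (pd α (frame e j β) x + ∑ γ, christoffel g β α γ x * frame e j γ x) =
      -(pdMat e α x * (e x)⁻¹) k j + ∑ γ, (e x)⁻¹ γ j * ((1 / 2) * ∑ δ, (e x)⁻¹ δ k *
      (pd α (fun y => g y γ δ) x + pd γ (fun y => g y α δ) x - pd δ (fun y => g y α γ) x)) := by
    intro α
    simp only [mul_add, Finset.sum_add_distrib, sum_mul_pd_frame he h0, ← sum_mul_christoffel hg h0]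
    congr 1
    simp only [Finset.mul_sum]
    rw [Finset.sum_comm]
    refine Finset.sum_congr rfl fun γ _ => Finset.sum_congr rfl fun β _ => ?_
    rw [frame, Matrix.transpose_apply]
    ring
  have s1 : ∑ α, (e x)⁻¹ α l * ∑ γ, ∑ δ, (e x)⁻¹ γ j * (e x)⁻¹ δ k * pd α (fun y => g y γ δ) x =
      frameDeriv e x k l j + frameDeriv e x j l k := by
    simp only [sum_pd_metric he hg h0, mul_add, Finset.sum_add_distrib, frameDeriv]
  have s2 : ∑ γ, (e x)⁻¹ γ j * ∑ α, ∑ δ, (e x)⁻¹ α l * (e x)⁻¹ δ k * pd γ (fun y => g y α δ) x =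
      frameDeriv e x k j l + frameDeriv e x l j k := by
    simp only [sum_pd_metric he hg h0, mul_add, Finset.sum_add_distrib, frameDeriv]
  have s3 : ∑ δ, (e x)⁻¹ δ k * ∑ α, ∑ γ, (e x)⁻¹ α l * (e x)⁻¹ γ j * pd δ (fun y => g y α γ) x =
      frameDeriv e x j k l + frameDeriv e x l k j := by
    simp only [sum_pd_metric he hg h0, mul_add, Finset.sum_add_distrib, frameDeriv]
  have s0 : ∑ α, (e x)⁻¹ α l * -(pdMat e α x * (e x)⁻¹) k j = -frameDeriv e x k l j := by
    simp only [frameDeriv, mul_neg, Finset.sum_neg_distrib]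
  rw [← s0, ← s1, ← s2, ← s3]
  simp only [h1]
  simp only [Fin.sum_univ_three]
  ring

lemma sum_mul_pauli_pauli (N : Fin 3 → Fin 3 → ℂ) (Ω : Fin 3 → Fin 3 → Fin 3 → ℂ) :
    ∑ α, (∑ l, N l α • pauli l) * ((1 / 4 : ℂ) • ∑ k, ∑ j, Ω α k j • (pauli k * pauli j)) =
      (1 / 4 : ℂ) • ∑ l, ∑ k, ∑ j, (∑ α, N l α * Ω α k j) • (pauli l * (pauli k * pauli j)) := by
  have h : ∀ α, (∑ l, N l α • pauli l) * ((1 / 4 : ℂ) • ∑ k, ∑ j, Ω α k j • (pauli k * pauli j)) =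
      (1 / 4 : ℂ) • ∑ l, ∑ k, ∑ j, (N l α * Ω α k j) • (pauli l * (pauli k * pauli j)) := by
    intro α
    rw [mul_smul_comm, Finset.sum_mul]
    congr 1
    refine Finset.sum_congr rfl fun l _ => ?_
    rw [Finset.mul_sum]
    refine Finset.sum_congr rfl fun k _ => ?_
    rw [Finset.mul_sum]
    exact Finset.sum_congr rfl fun j _ => smul_mul_smul_comm _ _ _ _
  simp only [h, ← Finset.smul_sum, Finset.sum_smul]
  congr 1
  rw [Finset.sum_comm]
  refine Finset.sum_congr rfl fun l _ => ?_
  rw [Finset.sum_comm]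
  refine Finset.sum_congr rfl fun k _ => ?_
  rw [Finset.sum_comm]

/-- The zeroth-order term `σ^α ω_α` of the Dirac operator, with `ω` the spin connection. -/
lemma sum_sigma_connection (he : ∀ j α, ContDiff ℝ ∞ fun x => e x j α)
    (hg : ∀ x, g x = (e x)ᵀ * e x) (h0 : ∀ x, (e x).det ≠ 0) (x : R3) :
    ∑ α, sigmaUp e α x * spinConnection g e α x =
    (1 / 2 : ℂ) • ∑ j, ((∑ k, (frameDeriv e x k j k - frameDeriv e x k k j) : ℝ) : ℂ) • pauli j +
      (Complex.I * (((1 / 4) * ∑ k, (frameDeriv e x k (k + 1) (k + 2) -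
        frameDeriv e x k (k + 2) (k + 1)) : ℝ) : ℂ)) • (1 : Matrix (Fin 2) (Fin 2) ℂ) := by
  rw [← pauli_contraction]
  simp only [← connection_coeff he hg h0]
  have hs : ∀ α, spinConnection g e α x = (1 / 4 : ℂ) • ∑ k, ∑ j,
      ((∑ β, e x k β * (pd α (frame e j β) x + ∑ γ, christoffel g β α γ x * frame e j γ x) : ℝ) : ℂ)
        • (pauli k * pauli j) := by
    intro α
    rw [spinConnection]
    congr 1
    have h1 : ∀ β, pdSigmaUp e α β x + ∑ γ, (christoffel g β α γ x : ℂ) • sigmaUp e γ x =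
        ∑ j, ((pd α (frame e j β) x + ∑ γ, christoffel g β α γ x * frame e j γ x : ℝ) : ℂ) •
          pauli j := by
      intro β
      simp only [pdSigmaUp_eq he h0, sigmaUp, Finset.smul_sum, smul_smul]
      rw [Finset.sum_comm, ← Finset.sum_add_distrib]
      refine Finset.sum_congr rfl fun j _ => ?_
      rw [← Finset.sum_smul, ← add_smul]
      push_cast
      rfl
    simp only [h1, sigmaDown_eq (hg x) (h0 x), Finset.sum_mul_sum, smul_mul_smul_comm]
    rw [Finset.sum_comm]
    refine Finset.sum_congr rfl fun k _ => ?_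
    rw [Finset.sum_comm]
    refine Finset.sum_congr rfl fun j _ => ?_
    rw [← Finset.sum_smul]
    push_cast
    rfl
  simp only [hs, sigmaUp]
  rw [sum_mul_pauli_pauli]
  simp only [Complex.ofReal_sum, Complex.ofReal_mul]
  rfl

/-- The derivatives of the coframe are recovered from `frameDeriv`, so that identities between them
become polynomial identities in `frameDeriv` and `e`. -/
lemma pdMat_eq (h0 : ∀ x, (e x).det ≠ 0) (α k γ : Fin 3) (x : R3) :
    pd α (fun y => e y k γ) x = ∑ l, ∑ j, frameDeriv e x k l j * (e x l α * e x j γ) := by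
  have hNE : (e x)⁻¹ * e x = 1 := Matrix.nonsing_inv_mul _ (isUnit_iff_ne_zero.2 (h0 x))
  have h1 : pd α (fun y => e y k γ) x = ∑ j, (pdMat e α x * (e x)⁻¹) k j * e x j γ := by
    rw [← Matrix.mul_apply, Matrix.mul_assoc, hNE, Matrix.mul_one]; rfl
  have h2 : ∀ j, (pdMat e α x * (e x)⁻¹) k j = ∑ l, frameDeriv e x k l j * e x l α := by
    intro j
    have : ∀ β, ∑ l, (e x)⁻¹ β l * e x l α = if β = α then 1 else 0 := fun β => by
      rw [← Matrix.mul_apply, hNE, Matrix.one_apply]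
    simp only [frameDeriv, Finset.sum_mul]
    rw [Finset.sum_comm]
    have e1 : ∀ β, ∑ l, (e x)⁻¹ β l * (pdMat e β x * (e x)⁻¹) k j * e x l α =
        (if β = α then 1 else 0) * (pdMat e β x * (e x)⁻¹) k j := by
      intro β
      rw [← this β, Finset.sum_mul]
      exact Finset.sum_congr rfl fun l _ => by ring
    simp [e1]
  rw [h1, Finset.sum_comm]
  refine Finset.sum_congr rfl fun j _ => ?_
  rw [h2, Finset.sum_mul]
  exact Finset.sum_congr rfl fun l _ => by ring

lemma axialE_eq (h0 : ∀ x, (e x).det ≠ 0) (x : R3) :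
    axialE e x = (e x).det * ((1 / 4) * ∑ k, (frameDeriv e x k (k + 1) (k + 2) -
        frameDeriv e x k (k + 2) (k + 1))) := by
  simp only [axialE, pdMat_eq h0, Matrix.det_fin_three]
  generalize frameDeriv e x = p
  generalize e x = E
  simp [Fin.sum_univ_three]
  ring

/-- The divergence of the density `det(e) e_j^α` is the trace of the torsion of the coframe. -/
lemma sum_pd_cofE (he : ∀ j α, ContDiff ℝ ∞ fun x => e x j α) (h0 : ∀ x, (e x).det ≠ 0)
    (j : Fin 3) (x : R3) : ∑ α, pd α (cofE e j α) x =
      (e x).det * ∑ k, (frameDeriv e x k j k - frameDeriv e x k k j) := by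
  have h : ∀ α, pd α (cofE e j α) x =
      pd α (fun y => e y (j + 1) (α + 1)) x * e x (j + 2) (α + 2) +
      e x (j + 1) (α + 1) * pd α (fun y => e y (j + 2) (α + 2)) x -
      (pd α (fun y => e y (j + 1) (α + 2)) x * e x (j + 2) (α + 1) +
      e x (j + 1) (α + 2) * pd α (fun y => e y (j + 2) (α + 1)) x) := by
    intro α
    rw [← pd_mul_real α (he _ _) (he _ _), ← pd_mul_real α (he _ _) (he _ _),
      ← pd_sub_real α ((he _ _).mul (he _ _)) ((he _ _).mul (he _ _))]
    rfl
  simp only [h, pdMat_eq h0, Matrix.det_fin_three]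
  generalize frameDeriv e x = p
  generalize e x = E
  fin_cases j <;> simp [Fin.sum_univ_three] <;> ring

/-- The Dirac operator multiplied by the density `det e` is of the form treated by `diracOp`, with
coefficients that are polynomial in the coframe and its first derivatives. The anti-Hermitian part
of the zeroth-order term is the one required by formal self-adjointness. -/
lemma det_smul_diracSymbol (he : ∀ j α, ContDiff ℝ ∞ fun x => e x j α)
    (hg : ∀ x, g x = (e x)ᵀ * e x) (h0 : ∀ x, (e x).det ≠ 0) (x : R3)
    (w : Fin 3 → EuclideanSpace ℂ (Fin 2)) (u : EuclideanSpace ℂ (Fin 2)) :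
    ((e x).det : ℂ) • diracSymbol g e x w u = diracFibre (cofE e) (axialE e) x w u := by
  have h1 : ((e x).det : ℂ) • ∑ α, Matrix.toEuclideanLin (sigmaUp e α x) (w α) =
      ∑ j, ∑ α, (cofE e j α x : ℂ) • Matrix.toEuclideanLin (pauli j) (w α) := by
    rw [Finset.sum_comm, Finset.smul_sum]
    refine Finset.sum_congr rfl fun α _ => ?_
    simp only [sigmaUp, map_sum, map_smul, LinearMap.sum_apply, LinearMap.smul_apply,
      Finset.smul_sum, smul_smul, cofE_eq (h0 x), Complex.ofReal_mul]
  have h2 : ((e x).det : ℂ) • ∑ α, Matrix.toEuclideanLin (sigmaUp e α x)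
      (Matrix.toEuclideanLin (spinConnection g e α x) u) =
      (1 / 2 : ℂ) • ∑ j, ∑ α, ((pd α (cofE e j α) x : ℝ) : ℂ) • Matrix.toEuclideanLin (pauli j) u +
        (Complex.I * (axialE e x : ℂ)) • u := by
    have e1 : ∀ α, Matrix.toEuclideanLin (sigmaUp e α x)
        (Matrix.toEuclideanLin (spinConnection g e α x) u) =
        Matrix.toEuclideanLin (sigmaUp e α x * spinConnection g e α x) u := by
      intro α
      simp [Matrix.toLpLin_apply]
    have e2 : ∀ j, ∑ α, ((pd α (cofE e j α) x : ℝ) : ℂ) • Matrix.toEuclideanLin (pauli j) u =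
        (((e x).det * ∑ k, (frameDeriv e x k j k - frameDeriv e x k k j) : ℝ) : ℂ) •
          Matrix.toEuclideanLin (pauli j) u := by
      intro j
      rw [← Finset.sum_smul, ← sum_pd_cofE he h0]
      push_cast
      rfl
    have e3 : Matrix.toEuclideanLin (1 : Matrix (Fin 2) (Fin 2) ℂ) u = u := by
      simp
    simp only [e1, e2]
    rw [← LinearMap.sum_apply, ← map_sum, sum_sigma_connection he hg h0, axialE_eq h0, map_add,
      map_smul, map_smul, map_sum, LinearMap.add_apply, LinearMap.smul_apply, LinearMap.smul_apply,
      LinearMap.sum_apply, e3]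
    simp only [map_smul, LinearMap.smul_apply, smul_add, Finset.smul_sum, smul_smul]
    congr 1
    · refine Finset.sum_congr rfl fun j _ => ?_
      congr 1
      push_cast
      ring
    · congr 1
      push_cast
      ring
  rw [diracSymbol, smul_comm]
  simp only [map_add, Finset.sum_add_distrib]
  rw [smul_add, h1, h2, diracFibre]
  simp only [Finset.sum_add_distrib, ← Finset.smul_sum, smul_add, add_assoc]
  congr 1
  rw [smul_smul, smul_smul]
  congr 2
  · ring
  · linear_combination (-(axialE e x : ℂ)) * Complex.I_mul_I

end Coframe

/-! ### Smooth one-parameter families of functions -/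

/-- A family of functions on `ℝ³`, defined for `|ε| < ε₀` and jointly smooth. -/
def SmoothFamily (ε₀ : ℝ) (f : ℝ → R3 → ℝ) : Prop :=
  ContDiffOn ℝ ∞ (fun p : ℝ × R3 => f p.1 p.2) (Set.Ioo (-ε₀) ε₀ ×ˢ Set.univ)

/-- The first variation `∂f/∂ε` at `ε = 0`. -/
def firstVar (f : ℝ → R3 → ℝ) (x : R3) : ℝ := deriv (fun ε => f ε x) 0

namespace SmoothFamily

variable {ε₀ : ℝ} {f f' : ℝ → R3 → ℝ}

lemma isOpen_dom : IsOpen (Set.Ioo (-ε₀) ε₀ ×ˢ (Set.univ : Set R3)) := isOpen_Ioo.prod isOpen_univ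

lemma sub (hf : SmoothFamily ε₀ f) (hf' : SmoothFamily ε₀ f') :
    SmoothFamily ε₀ fun ε x => f ε x - f' ε x := ContDiffOn.sub hf hf'

lemma mul (hf : SmoothFamily ε₀ f) (hf' : SmoothFamily ε₀ f') :
    SmoothFamily ε₀ fun ε x => f ε x * f' ε x := ContDiffOn.mul hf hf'

lemma const (c : ℝ) : SmoothFamily ε₀ fun _ _ => c := contDiffOn_const

lemma sum {ι : Type*} (s : Finset ι) {f : ι → ℝ → R3 → ℝ} (hf : ∀ i, SmoothFamily ε₀ (f i)) :
    SmoothFamily ε₀ fun ε x => ∑ i ∈ s, f i ε x := ContDiffOn.sum fun i _ => hf i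

lemma contDiffAt (hf : SmoothFamily ε₀ f) {ε : ℝ} (hε : ε ∈ Set.Ioo (-ε₀) ε₀) (x : R3) :
    ContDiffAt ℝ ∞ (fun p : ℝ × R3 => f p.1 p.2) (ε, x) :=
  ContDiffOn.contDiffAt hf (isOpen_dom.mem_nhds ⟨hε, trivial⟩)

lemma differentiableAt (hf : SmoothFamily ε₀ f) {ε : ℝ} (hε : ε ∈ Set.Ioo (-ε₀) ε₀) (x : R3) :
    DifferentiableAt ℝ (fun p : ℝ × R3 => f p.1 p.2) (ε, x) :=
  (hf.contDiffAt hε x).differentiableAt (by simp)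

lemma contDiff_slice (hf : SmoothFamily ε₀ f) {ε : ℝ} (hε : ε ∈ Set.Ioo (-ε₀) ε₀) :
    ContDiff ℝ ∞ (f ε) := by
  rw [contDiff_iff_contDiffAt]
  intro x
  exact (hf.contDiffAt hε x).comp x (contDiffAt_const.prodMk contDiffAt_id)

lemma hasDerivAt (hf : SmoothFamily ε₀ f) {ε : ℝ} (hε : ε ∈ Set.Ioo (-ε₀) ε₀) (x : R3) :
    HasDerivAt (fun t => f t x) (fderiv ℝ (fun p : ℝ × R3 => f p.1 p.2) (ε, x) (1, 0)) ε :=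
  HasFDerivAt.comp_hasDerivAt (l := fun p : ℝ × R3 => f p.1 p.2) (f := fun t => (t, x)) ε
    (hf.differentiableAt hε x).hasFDerivAt ((hasDerivAt_id ε).prodMk (hasDerivAt_const ε x))

lemma pd_eq (hf : SmoothFamily ε₀ f) {ε : ℝ} (hε : ε ∈ Set.Ioo (-ε₀) ε₀) (α : Fin 3) (x : R3) :
    pd α (f ε) x = fderiv ℝ (fun p : ℝ × R3 => f p.1 p.2) (ε, x) (0, Pi.single α 1) := by
  have h : HasFDerivAt (fun y => f ε y) _ x :=
    (hf.differentiableAt hε x).hasFDerivAt.comp x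
      ((hasFDerivAt_const ε x).prodMk (hasFDerivAt_id x))
  rw [TorusDirac.pd, h.fderiv]
  rfl

lemma fderiv_apply (hf : SmoothFamily ε₀ f) (v : ℝ × R3) :
    ContDiffOn ℝ ∞ (fun p => fderiv ℝ (fun p : ℝ × R3 => f p.1 p.2) p v)
      (Set.Ioo (-ε₀) ε₀ ×ˢ Set.univ) :=
  (hf.fderiv_of_isOpen isOpen_dom (by simp)).clm_apply contDiffOn_const

lemma deriv (hf : SmoothFamily ε₀ f) : SmoothFamily ε₀ fun ε x => deriv (fun t => f t x) ε :=
  (hf.fderiv_apply (1, 0)).congr fun p hp => (hf.hasDerivAt hp.1 p.2).deriv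

lemma pd (hf : SmoothFamily ε₀ f) (α : Fin 3) : SmoothFamily ε₀ fun ε => pd α (f ε) :=
  (hf.fderiv_apply (0, Pi.single α 1)).congr fun p hp => hf.pd_eq hp.1 α p.2

/-- Partial derivatives commute with the first variation. -/
lemma firstVar_pd (hε₀ : 0 < ε₀) (hf : SmoothFamily ε₀ f) (α : Fin 3) (x : R3) :
    firstVar (fun ε => TorusDirac.pd α (f ε)) x = TorusDirac.pd α (firstVar f) x := by
  have h0 : (0 : ℝ) ∈ Set.Ioo (-ε₀) ε₀ := ⟨neg_neg_of_pos hε₀, hε₀⟩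
  set Φ := fun p : ℝ × R3 => f p.1 p.2
  have hd : DifferentiableAt ℝ (fderiv ℝ Φ) (0, x) :=
    (hf.fderiv_of_isOpen (m := ∞) isOpen_dom (by simp)).contDiffAt
      (isOpen_dom.mem_nhds ⟨h0, trivial⟩) |>.differentiableAt (by simp)
  have e1 : firstVar (fun ε => TorusDirac.pd α (f ε)) x =
      fderiv ℝ (fderiv ℝ Φ) (0, x) (1, 0) (0, Pi.single α 1) := by
    rw [firstVar, ((hf.pd α).hasDerivAt h0 x).deriv]
    have : (fun p : ℝ × R3 => TorusDirac.pd α (f p.1) p.2) =ᶠ[𝓝 (0, x)]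
        fun p => fderiv ℝ Φ p (0, Pi.single α 1) := by
      filter_upwards [isOpen_dom.mem_nhds (x := ((0 : ℝ), x)) ⟨h0, trivial⟩] with p hp
      exact hf.pd_eq hp.1 α p.2
    rw [this.fderiv_eq, fderiv_clm_apply hd (differentiableAt_const _)]
    simp
  have e2 : TorusDirac.pd α (firstVar f) x =
      fderiv ℝ (fderiv ℝ Φ) (0, x) (0, Pi.single α 1) (1, 0) := by
    have h1 : TorusDirac.pd α (firstVar f) x = _ := hf.deriv.pd_eq h0 α x
    rw [h1]
    have : (fun p : ℝ × R3 => _root_.deriv (fun t => f t p.2) p.1) =ᶠ[𝓝 (0, x)]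
        fun p => fderiv ℝ Φ p (1, 0) := by
      filter_upwards [isOpen_dom.mem_nhds (x := ((0 : ℝ), x)) ⟨h0, trivial⟩] with p hp
      exact (hf.hasDerivAt hp.1 p.2).deriv
    rw [this.fderiv_eq, fderiv_clm_apply hd (differentiableAt_const _)]
    simp
  rw [e1, e2]
  exact (hf.contDiffAt h0 x).isSymmSndFDerivAt (by
    rw [minSmoothness_of_isRCLikeNormedField]
    exact WithTop.coe_le_coe.2 (le_top : (2 : ℕ∞) ≤ ⊤)) _ _

lemma contDiff_firstVar (hε₀ : 0 < ε₀) (hf : SmoothFamily ε₀ f) : ContDiff ℝ ∞ (firstVar f) :=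
  hf.deriv.contDiff_slice ⟨neg_neg_of_pos hε₀, hε₀⟩

lemma periodic_firstVar (hε₀ : 0 < ε₀) (hp : ∀ ε ∈ Set.Ioo (-ε₀) ε₀, Periodic3 (f ε)) :
    Periodic3 (firstVar f) := by
  intro x α
  refine Filter.EventuallyEq.deriv_eq ?_
  filter_upwards [Ioo_mem_nhds (neg_neg_of_pos hε₀) hε₀] with ε hε
  exact hp ε hε x α

lemma hasDerivAt_zero (hε₀ : 0 < ε₀) (hf : SmoothFamily ε₀ f) (x : R3) :
    HasDerivAt (fun t => f t x) (firstVar f x) 0 :=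
  (hf.hasDerivAt ⟨neg_neg_of_pos hε₀, hε₀⟩ x).differentiableAt.hasDerivAt

/-- The bound holds on the smaller interval `|ε| ≤ ε₀ / 2`, since nothing is assumed near `±ε₀`. -/
lemma exists_bound (hε₀ : 0 < ε₀) (hf : SmoothFamily ε₀ f) :
    ∃ C, ∀ ε ∈ Set.Icc (-(ε₀ / 2)) (ε₀ / 2), ∀ x ∈ cell, ‖f ε x‖ ≤ C := by
  have hcomp : IsCompact (Set.Icc (-(ε₀ / 2)) (ε₀ / 2) ×ˢ
      Set.pi Set.univ fun _ : Fin 3 => Set.Icc (0 : ℝ) (2 * Real.pi)) :=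
    isCompact_Icc.prod (isCompact_univ_pi fun _ => isCompact_Icc)
  obtain ⟨C, hC⟩ := hcomp.exists_bound_of_continuousOn (hf.continuousOn.mono (by
    rintro ⟨ε, x⟩ ⟨hε, -⟩
    have := hε.1
    have := hε.2
    exact ⟨⟨by simp only at *; linarith, by simp only at *; linarith⟩, trivial⟩))
  exact ⟨C, fun ε hε x hx => hC (ε, x) ⟨hε, fun i hi => Set.Ioc_subset_Icc_self (hx i hi)⟩⟩

lemma eventually_small (hε₀ : 0 < ε₀) : ∀ᶠ p : ℝ × R3 in 𝓝 0 ×ˢ 𝓟 cell,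
    p.1 ∈ Set.Icc (-(ε₀ / 2)) (ε₀ / 2) ∧ p.2 ∈ cell := by
  refine Filter.prod_mem_prod (s := Set.Icc (-(ε₀ / 2)) (ε₀ / 2)) (t := cell) ?_
    (mem_principal_self _)
  exact Icc_mem_nhds (by linarith) (by linarith)

lemma exists_lipschitz (hε₀ : 0 < ε₀) (hf : SmoothFamily ε₀ f) :
    ∃ C, 0 ≤ C ∧ ∀ ε ∈ Set.Icc (-(ε₀ / 2)) (ε₀ / 2), ∀ x ∈ cell, ‖f ε x - f 0 x‖ ≤ C * |ε| := by
  obtain ⟨C, hC⟩ := hf.deriv.exists_bound hε₀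
  have h0 : (0 : ℝ) ∈ Set.Icc (-(ε₀ / 2)) (ε₀ / 2) := ⟨by linarith, by linarith⟩
  refine ⟨max C 0, le_max_right _ _, fun ε hε x hx => ?_⟩
  have := (convex_Icc (-(ε₀ / 2)) (ε₀ / 2)).norm_image_sub_le_of_norm_hasDerivWithin_le
    (f := fun t => f t x) (f' := fun t => _root_.deriv (fun t => f t x) t) (C := max C 0)
    (fun t ht => ((hf.hasDerivAt ⟨by linarith [ht.1], by linarith [ht.2]⟩
      x).differentiableAt.hasDerivAt).hasDerivWithinAt)
    (fun t ht => (hC t ht x hx).trans (le_max_left _ _)) h0 hε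
  simpa using this

lemma isBigO_sub (hε₀ : 0 < ε₀) (hf : SmoothFamily ε₀ f) :
    (fun p : ℝ × R3 => f p.1 p.2 - f 0 p.2) =O[𝓝 0 ×ˢ 𝓟 cell] fun p => p.1 := by
  obtain ⟨C, -, hC⟩ := hf.exists_lipschitz hε₀
  refine IsBigO.of_bound C ?_
  filter_upwards [eventually_small hε₀] with p hp
  exact hC _ hp.1 _ hp.2

/-- Taylor's formula in `ε` to first order, uniformly in `x`. -/
lemma isBigO_taylor (hε₀ : 0 < ε₀) (hf : SmoothFamily ε₀ f) :
    (fun p : ℝ × R3 => f p.1 p.2 - f 0 p.2 - p.1 * firstVar f p.2) =O[𝓝 0 ×ˢ 𝓟 cell]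
      fun p => p.1 ^ 2 := by
  obtain ⟨C, hC0, hC⟩ := hf.deriv.exists_lipschitz hε₀
  refine IsBigO.of_bound C ?_
  filter_upwards [eventually_small hε₀] with ⟨ε, x⟩ ⟨hε, hx⟩
  simp only at hε hx ⊢
  have habs : |ε| ≤ ε₀ / 2 := abs_le.2 hε
  have := (convex_Icc (-|ε|) |ε|).norm_image_sub_le_of_norm_hasDerivWithin_le
    (f := fun t => f t x - t * firstVar f x)
    (f' := fun t => _root_.deriv (fun t => f t x) t - 1 * firstVar f x) (C := C * |ε|)
    (fun t ht => (((hf.hasDerivAt ⟨by linarith [ht.1], by linarith [ht.2]⟩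
      x).differentiableAt.hasDerivAt).sub
        ((hasDerivAt_id t).mul_const (firstVar f x))).hasDerivWithinAt)
    (fun t ht => by
      rw [one_mul]
      refine (hC t ⟨by linarith [ht.1], by linarith [ht.2]⟩ x hx).trans ?_
      exact mul_le_mul_of_nonneg_left (abs_le.2 ht) hC0)
    (x := 0) (y := ε) ⟨by simp, by simp⟩ ⟨neg_abs_le ε, le_abs_self ε⟩
  have e : f ε x - f 0 x - ε * firstVar f x =
      f ε x - ε * firstVar f x - (f 0 x - 0 * firstVar f x) := by ring
  rw [e]
  refine this.trans (le_of_eq ?_)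
  simp [pow_two, mul_assoc]

end SmoothFamily

/-! ### Expansion of the coframe -/

/-- The part of `axialE` that is linear in the deviation of the coframe from the identity. It is a
sum of derivatives, and so has mean zero for periodic coframes. -/
def axialLin (A : R3 → Matrix (Fin 3) (Fin 3) ℝ) (x : R3) : ℝ :=
  (1 / 4) * ∑ k, (pd (k + 1) (fun y => A y k (k + 2)) x - pd (k + 2) (fun y => A y k (k + 1)) x)

/-- The first variation `tr(A) δ_{jα} - A_{αj}` of the cofactors at the identity. -/
def cofVar (A : R3 → Matrix (Fin 3) (Fin 3) ℝ) (j α : Fin 3) (x : R3) : ℝ :=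
  (if j = α then ∑ k, A x k k else 0) - A x α j

section Families

variable {ε₀ : ℝ} {e : ℝ → R3 → Matrix (Fin 3) (Fin 3) ℝ}

/-- The first variation of a family of coframes. -/
def coframeVar (e : ℝ → R3 → Matrix (Fin 3) (Fin 3) ℝ) (x : R3) : Matrix (Fin 3) (Fin 3) ℝ :=
  Matrix.of fun j α => firstVar (fun ε x => e ε x j α) x

lemma smoothFamily_cofE (he : ∀ j α, SmoothFamily ε₀ fun ε x => e ε x j α) (j α : Fin 3) :
    SmoothFamily ε₀ fun ε => cofE (e ε) j α :=
  ((he _ _).mul (he _ _)).sub ((he _ _).mul (he _ _))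

lemma smoothFamily_det (he : ∀ j α, SmoothFamily ε₀ fun ε x => e ε x j α) :
    SmoothFamily ε₀ fun ε x => (e ε x).det := by
  simp only [SmoothFamily, Matrix.det_fin_three]
  have : ∀ j α, ContDiffOn ℝ ∞ (fun p : ℝ × R3 => e p.1 p.2 j α) (Set.Ioo (-ε₀) ε₀ ×ˢ Set.univ) :=
    he
  fun_prop

lemma smoothFamily_curl (he : ∀ j α, SmoothFamily ε₀ fun ε x => e ε x j α) (k α : Fin 3) :
    SmoothFamily ε₀ fun ε x => pd (α + 1) (fun y => e ε y k (α + 2)) x -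
      pd (α + 2) (fun y => e ε y k (α + 1)) x :=
  ((he _ _).pd _).sub ((he _ _).pd _)

lemma smoothFamily_axialE (he : ∀ j α, SmoothFamily ε₀ fun ε x => e ε x j α) :
    SmoothFamily ε₀ fun ε => axialE (e ε) :=
  (SmoothFamily.const _).mul (SmoothFamily.sum _ fun k => SmoothFamily.sum _ fun α =>
    (he k α).mul (smoothFamily_curl he k α))

lemma cofE_zero (hid : ∀ x, e 0 x = 1) (j α : Fin 3) :
    cofE (e 0) j α = fun _ => if j = α then 1 else 0 := by
  ext x
  simp only [cofE, hid]
  fin_cases j <;> fin_cases α <;> simp [Matrix.one_apply]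

lemma curl_zero (hid : ∀ x, e 0 x = 1) (k α : Fin 3) (x : R3) :
    pd (α + 1) (fun y => e 0 y k (α + 2)) x - pd (α + 2) (fun y => e 0 y k (α + 1)) x = 0 := by
  simp [hid, pd]

lemma axialE_zero (hid : ∀ x, e 0 x = 1) : axialE (e 0) = fun _ => 0 := by
  ext x
  simp [axialE, curl_zero hid]

lemma firstVar_curl (hε₀ : 0 < ε₀) (he : ∀ j α, SmoothFamily ε₀ fun ε x => e ε x j α)
    (k α : Fin 3) (x : R3) :
    firstVar (fun ε x => pd (α + 1) (fun y => e ε y k (α + 2)) x -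
      pd (α + 2) (fun y => e ε y k (α + 1)) x) x =
    pd (α + 1) (fun y => coframeVar e y k (α + 2)) x -
      pd (α + 2) (fun y => coframeVar e y k (α + 1)) x := by
  have h1 := ((he k (α + 2)).pd (α + 1)).hasDerivAt_zero hε₀ x
  have h2 := ((he k (α + 1)).pd (α + 2)).hasDerivAt_zero hε₀ x
  rw [(he k (α + 2)).firstVar_pd hε₀] at h1
  rw [(he k (α + 1)).firstVar_pd hε₀] at h2
  exact (h1.sub h2).deriv

lemma firstVar_cofE (hε₀ : 0 < ε₀) (he : ∀ j α, SmoothFamily ε₀ fun ε x => e ε x j α)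
    (hid : ∀ x, e 0 x = 1) (j α : Fin 3) :
    firstVar (fun ε => cofE (e ε) j α) = cofVar (coframeVar e) j α := by
  ext x
  have h := fun j α => (he j α).hasDerivAt_zero hε₀ x
  refine ((((h (j + 1) (α + 1)).mul (h (j + 2) (α + 2))).sub
    ((h (j + 1) (α + 2)).mul (h (j + 2) (α + 1)))).deriv).trans ?_
  simp only [cofVar, coframeVar, Matrix.of_apply, hid]
  generalize hA : (fun j α => firstVar (fun ε x => e ε x j α) x) = A
  have hA' : ∀ j α, firstVar (fun ε x => e ε x j α) x = A j α := fun j α => by rw [← hA]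
  simp only [hA']
  fin_cases j <;> fin_cases α <;> simp [Matrix.one_apply, Fin.sum_univ_three] <;> ring

lemma firstVar_axialE (hε₀ : 0 < ε₀) (he : ∀ j α, SmoothFamily ε₀ fun ε x => e ε x j α)
    (hid : ∀ x, e 0 x = 1) :
    firstVar (fun ε => axialE (e ε)) = axialLin (coframeVar e) := by
  ext x
  have h := fun k α => ((he k α).hasDerivAt_zero hε₀ x).mul
    ((smoothFamily_curl he k α).hasDerivAt_zero hε₀ x)
  have h2 := (HasDerivAt.fun_sum fun k (_ : k ∈ Finset.univ) =>
    HasDerivAt.fun_sum fun α (_ : α ∈ Finset.univ) => h k α).const_mul (1 / 4 : ℝ)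
  refine h2.deriv.trans ?_
  simp only [curl_zero hid, mul_zero, zero_add, firstVar_curl hε₀ he]
  simp only [hid, axialLin, Matrix.one_apply, ite_mul, one_mul, zero_mul, Finset.sum_ite_eq,
    Finset.mem_univ, if_true]

/-- The product of two families that vanish at `ε = 0`, to second order. -/
lemma SmoothFamily.isBigO_mul {f f' : ℝ → R3 → ℝ} (hε₀ : 0 < ε₀) (hf : SmoothFamily ε₀ f)
    (hf' : SmoothFamily ε₀ f') (h0 : ∀ x, f 0 x = 0) (h0' : ∀ x, f' 0 x = 0) :
    (fun p : ℝ × R3 => f p.1 p.2 * f' p.1 p.2 - p.1 ^ 2 * (firstVar f p.2 * firstVar f' p.2))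
      =O[𝓝 0 ×ˢ 𝓟 cell] fun p => p.1 ^ 3 := by
  have t := hf.isBigO_taylor hε₀
  have t' := hf'.isBigO_taylor hε₀
  have s' := hf'.isBigO_sub hε₀
  simp only [h0, h0', sub_zero] at t t' s'
  have hb : (fun p : ℝ × R3 => firstVar f p.2) =O[𝓝 0 ×ˢ 𝓟 cell] fun _ => (1 : ℝ) := by
    obtain ⟨C, -, hC⟩ := exists_bound_cell (hf.contDiff_firstVar hε₀).continuous
    refine IsBigO.of_bound C ?_
    filter_upwards [SmoothFamily.eventually_small hε₀] with p hp
    simpa using hC _ hp.2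
  have h1 := t.mul s'
  have h2 := (hb.mul t').mul (isBigO_refl (fun p : ℝ × R3 => p.1) (𝓝 0 ×ˢ 𝓟 cell))
  have h1' := h1.congr_right (g₂ := fun p : ℝ × R3 => p.1 ^ 3) fun p => by ring
  have h2' := h2.congr_right (g₂ := fun p : ℝ × R3 => p.1 ^ 3) fun p => by ring
  refine (h1'.add h2').congr_left fun p => ?_
  ring

lemma isBigO_finset_sum {ι X E : Type*} [SeminormedAddCommGroup E] {s : Finset ι} {l : Filter X}
    {A : ι → X → E} {g : X → ℝ} (h : ∀ i, A i =O[l] g) : (fun x => ∑ i ∈ s, A i x) =O[l] g :=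
  (IsBigO.sum fun i _ => h i).congr_left fun x => Finset.sum_apply x s A

/-- To second order, `axialE` is quadratic in the first variation, up to a sum of derivatives. -/
lemma isBigO_axialE (hε₀ : 0 < ε₀) (he : ∀ j α, SmoothFamily ε₀ fun ε x => e ε x j α)
    (hid : ∀ x, e 0 x = 1) :
    (fun p : ℝ × R3 => axialE (e p.1) p.2 - axialLin (e p.1) p.2 -
      p.1 ^ 2 * axialE (coframeVar e) p.2) =O[𝓝 0 ×ˢ 𝓟 cell] fun p => p.1 ^ 3 := by
  have hs : ∀ k α, SmoothFamily ε₀ fun ε x => e ε x k α - (1 : Matrix (Fin 3) (Fin 3) ℝ) k α :=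
    fun k α => (he k α).sub (SmoothFamily.const _)
  have hv : ∀ k α x, firstVar (fun ε x => e ε x k α - (1 : Matrix (Fin 3) (Fin 3) ℝ) k α) x =
      coframeVar e x k α := fun k α x =>
    (((he k α).hasDerivAt_zero hε₀ x).sub_const _).deriv
  have h := fun k α => (hs k α).isBigO_mul hε₀ (smoothFamily_curl he k α)
    (fun x => by rw [hid, sub_self]) (curl_zero hid k α)
  simp only [hv, firstVar_curl hε₀ he] at h
  -- `axialE - axialLin` is the sum of the products of `e - 1` with the curls, both `O(ε)`.
  refine ((isBigO_finset_sum (s := Finset.univ) fun k => isBigO_finset_sum (s := Finset.univ)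
    (h k)).const_mul_left (1 / 4)).congr_left fun p => ?_
  simp only [axialE, axialLin, Fin.sum_univ_three, Matrix.one_apply]
  simp
  ring

end Families

/-! ### Estimates of the operators -/

/-- A bound on a function, uniform over the cell, bounds the norm of its multiplication operator. -/
lemma isBigO_mulOp {f : ℝ → R3 → ℝ} {n : ℕ}
    (h : (fun p : ℝ × R3 => f p.1 p.2) =O[𝓝 0 ×ˢ 𝓟 cell] fun p => p.1 ^ n) :
    (fun ε => mulOp fun x => (f ε x : ℂ)) =O[𝓝 0] fun ε : ℝ => ε ^ n := by
  obtain ⟨C, hC0, hC⟩ := h.exists_nonneg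
  refine IsBigO.of_bound C ?_
  have := eventually_prod_principal_iff.1 hC.bound
  filter_upwards [this] with ε hε
  refine norm_mulOp_le (by positivity) fun x hx => ?_
  rw [Complex.norm_real]
  exact hε x hx

lemma isBigO_clm_comp {l : Filter ℝ} {A : ℝ → SpinorL2 →L[ℂ] SpinorL2} {g : ℝ → ℝ}
    (h : A =O[l] g) (B : SpinorL2 →L[ℂ] SpinorL2) : (fun ε => A ε ∘L B) =O[l] g := by
  refine IsBigO.trans (IsBigO.of_bound ‖B‖ (Eventually.of_forall fun ε => ?_)) h
  rw [mul_comm]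
  exact ContinuousLinearMap.opNorm_comp_le _ _

lemma isBigO_diracOp {c : Fin 3 → Fin 3 → ℝ → R3 → ℝ} {F : ℝ → R3 → ℝ} {n : ℕ}
    (hc : ∀ j α, (fun p : ℝ × R3 => c j α p.1 p.2) =O[𝓝 0 ×ˢ 𝓟 cell] fun p => p.1 ^ n)
    (hpc : ∀ j α, (fun p : ℝ × R3 => pd α (c j α p.1) p.2) =O[𝓝 0 ×ˢ 𝓟 cell] fun p => p.1 ^ n)
    (hF : (fun p : ℝ × R3 => F p.1 p.2) =O[𝓝 0 ×ˢ 𝓟 cell] fun p => p.1 ^ n) :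
    (fun ε => diracOp (fun j α => c j α ε) (F ε)) =O[𝓝 0] fun ε : ℝ => ε ^ n := by
  refine IsBigO.add (isBigO_finset_sum fun j => isBigO_finset_sum fun α => IsBigO.add ?_ ?_) ?_
  · exact (isBigO_clm_comp (isBigO_mulOp (hc j α)) _).const_smul_left (-Complex.I)
  · exact (isBigO_clm_comp (isBigO_mulOp (f := fun ε => pd α (c j α ε)) (hpc j α))
      _).const_smul_left (-Complex.I / 2)
  · exact isBigO_clm_comp (isBigO_mulOp hF) _

lemma mulOp_taylor {f f₀ f₁ : R3 → ℝ} (hf : Continuous f) (hf₀ : Continuous f₀)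
    (hf₁ : Continuous f₁) (ε : ℝ) : mulOp (fun x => ((f x - f₀ x - ε * f₁ x : ℝ) : ℂ)) =
      mulOp (fun x => (f x : ℂ)) - mulOp (fun x => (f₀ x : ℂ)) -
        (ε : ℂ) • mulOp (fun x => (f₁ x : ℂ)) := by
  have h : Continuous fun x => (f x : ℂ) := Complex.continuous_ofReal.comp hf
  have h₀ : Continuous fun x => (f₀ x : ℂ) := Complex.continuous_ofReal.comp hf₀
  have h₁ : Continuous fun x => (f₁ x : ℂ) := Complex.continuous_ofReal.comp hf₁
  rw [← mulOp_const_mul _ h₁, ← mulOp_sub h h₀, ← mulOp_sub (φ := fun x => (f x : ℂ) - (f₀ x : ℂ))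
    (ψ := fun x => (ε : ℂ) * (f₁ x : ℂ)) (h.sub h₀) (continuous_const.mul h₁)]
  simp

lemma diracOp_taylor {c c₀ c₁ : Fin 3 → Fin 3 → R3 → ℝ} {F F₀ F₁ : R3 → ℝ}
    (hc : ∀ j α, ContDiff ℝ ∞ (c j α)) (hc₀ : ∀ j α, ContDiff ℝ ∞ (c₀ j α))
    (hc₁ : ∀ j α, ContDiff ℝ ∞ (c₁ j α)) (hF : Continuous F) (hF₀ : Continuous F₀)
    (hF₁ : Continuous F₁) (ε : ℝ) :
    diracOp (fun j α x => c j α x - c₀ j α x - ε * c₁ j α x)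
      (fun x => F x - F₀ x - ε * F₁ x) = diracOp c F - diracOp c₀ F₀ - (ε : ℂ) • diracOp c₁ F₁ := by
  have hpd : ∀ j α x, pd α (fun x => c j α x - c₀ j α x - ε * c₁ j α x) x =
      pd α (c j α) x - pd α (c₀ j α) x - ε * pd α (c₁ j α) x := by
    intro j α x
    rw [pd_sub_real α ((hc j α).sub (hc₀ j α)) (contDiff_const.mul (hc₁ j α)),
      pd_sub_real α (hc j α) (hc₀ j α), pd_mul_real α contDiff_const (hc₁ j α)]
    simp [pd]
  simp only [diracOp, hpd, mulOp_taylor hF hF₀ hF₁, mulOp_taylor (hc _ _).continuous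
    (hc₀ _ _).continuous (hc₁ _ _).continuous, mulOp_taylor (continuous_pd_real (hc _ _) _)
    (continuous_pd_real (hc₀ _ _) _) (continuous_pd_real (hc₁ _ _) _),
    ContinuousLinearMap.sub_comp, ContinuousLinearMap.smul_comp, smul_sub, Finset.sum_add_distrib,
    Finset.sum_sub_distrib, smul_add, Finset.smul_sum, smul_comm (ε : ℂ)]
  abel

lemma mulOp_zero : mulOp (fun _ => 0) = 0 := by
  have := mulOp_const_mul 0 (φ := fun _ => 0) continuous_const
  simpa using this

/-- The flat Dirac operator. -/
lemma diracOp_flat :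
    diracOp (fun j α _ => if j = α then 1 else 0) (fun _ => 0) = 1 - constProj := by
  ext1 f
  rw [diracOp_apply, sub_apply, one_apply_eq_self, ← sum_pauli_riesz]
  have h : ∀ j α : Fin 3, mulOp (fun _ => (((if j = α then 1 else 0 : ℝ)) : ℂ)) =
      if j = α then 1 else 0 := by
    intro j α
    split_ifs
    · simpa using mulOp_one
    · simpa using mulOp_zero
  have h' : ∀ (j α : Fin 3) (v : SpinorL2),
      (if j = α then (1 : SpinorL2 →L[ℂ] SpinorL2) else 0) v = if j = α then v else 0 := by
    intro j α v
    split_ifs <;> rfl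
  simp only [h, h', pd, fderiv_fun_const]
  simp [mulOp_zero]

/-! ### The Dirac operators of a family of coframes -/

lemma fcoef_planeWave (m n : Fin 3 → ℤ) (i j : Fin 2) :
    fcoef (planeWave (n, j)) m i = if m = n ∧ i = j then 1 else 0 := by
  simpa [fcoef] using orthonormal_iff_ite.1 orthonormal_planeWave (m, i) (n, j)

lemma constProj_planeWave (i : Fin 2) : constProj (planeWave (0, i)) = planeWave (0, i) := by
  refine fcoef_ext fun m j => ?_
  rw [fcoef_constProj, fcoef_planeWave, fcoef_planeWave]
  by_cases hm : m = 0 <;> simp [hm]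

lemma constProj_flatInv (f : SpinorL2) : constProj (flatInv f) = 0 := by
  refine fcoef_ext fun m j => ?_
  rw [fcoef_constProj, fcoef_flatInv]
  simp [rsym_zero, fcoef]

lemma flatInv_constProj (f : SpinorL2) : flatInv (constProj f) = 0 := by
  refine fcoef_ext fun m j => ?_
  simp only [fcoef_flatInv, fcoef_constProj]
  by_cases hm : m = 0 <;> simp [hm, rsym_zero, fcoef]

lemma constProj_constProj (f : SpinorL2) : constProj (constProj f) = constProj f := by
  refine fcoef_ext fun m j => ?_
  rw [fcoef_constProj, fcoef_constProj, fcoef_constProj]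
  simp

lemma sobolevIso_sub_constProj (f : SpinorL2) : sobolevIso (f - constProj f) = flatInv f := by
  simp [sobolevIso, constProj_constProj, flatInv_constProj]

lemma sobolevIso_planeWave (i : Fin 2) : sobolevIso (planeWave (0, i)) = planeWave (0, i) := by
  rw [sobolevIso, add_apply, constProj_planeWave, ← constProj_planeWave, flatInv_constProj,
    add_zero]

lemma riesz_planeWave (α : Fin 3) (i : Fin 2) : riesz α (planeWave (0, i)) = 0 := by
  refine fcoef_ext fun m j => ?_
  rw [fcoef_riesz, ← constProj_planeWave, flatInv_constProj]
  simp [fcoef]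

lemma conjOp_planeWave_zero : conjOp (planeWave (0, 0)) = planeWave (0, 1) := by
  refine fcoef_ext fun m i => ?_
  rw [fcoef_conjOp]
  fin_cases i <;> simp [fcoef_planeWave]

lemma conjOp_planeWave_one : conjOp (planeWave (0, 1)) = -planeWave (0, 0) := by
  refine fcoef_ext fun m i => ?_
  rw [fcoef_conjOp]
  fin_cases i <;> simp [fcoef_planeWave]

lemma Periodic3.comp {E E' : Type*} {f : R3 → E} (hf : Periodic3 f) (φ : E → E') :
    Periodic3 fun x => φ (f x) := fun x α => congrArg φ (hf x α)

lemma periodic_cofE {e : R3 → Matrix (Fin 3) (Fin 3) ℝ} (he : Periodic3 e) (j α : Fin 3) :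
    Periodic3 (cofE e j α) :=
  he.comp fun A => A (j + 1) (α + 1) * A (j + 2) (α + 2) - A (j + 1) (α + 2) * A (j + 2) (α + 1)

section Families

variable {ε₀ : ℝ} {e : ℝ → R3 → Matrix (Fin 3) (Fin 3) ℝ}

/-- Taylor's formula for the Dirac operator, in operator norm. -/
lemma isBigO_diracOp_taylor (hε₀ : 0 < ε₀) (he : ∀ j α, SmoothFamily ε₀ fun ε x => e ε x j α)
    (hid : ∀ x, e 0 x = 1) :
    (fun ε : ℝ => diracOp (cofE (e ε)) (axialE (e ε)) - (1 - constProj) -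
      (ε : ℂ) • diracOp (cofVar (coframeVar e)) (axialLin (coframeVar e)))
      =O[𝓝 0] fun ε : ℝ => ε ^ 2 := by
  have hc := smoothFamily_cofE he
  have hF := smoothFamily_axialE he
  have h0 : (0 : ℝ) ∈ Set.Ioo (-ε₀) ε₀ := ⟨neg_neg_of_pos hε₀, hε₀⟩
  have hev : ∀ᶠ ε : ℝ in 𝓝 0, ε ∈ Set.Ioo (-ε₀) ε₀ := Ioo_mem_nhds h0.1 h0.2
  have hev' : ∀ᶠ p : ℝ × R3 in 𝓝 0 ×ˢ 𝓟 cell, p.1 ∈ Set.Ioo (-ε₀) ε₀ := hev.prod_inl _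
  have key := isBigO_diracOp
    (c := fun j α ε x => cofE (e ε) j α x - cofE (e 0) j α x -
      ε * firstVar (fun ε => cofE (e ε) j α) x)
    (F := fun ε x => axialE (e ε) x - axialE (e 0) x - ε * firstVar (fun ε => axialE (e ε)) x)
    (n := 2) (fun j α => (hc j α).isBigO_taylor hε₀) (fun j α => by
      refine (((hc j α).pd α).isBigO_taylor hε₀).congr' ?_ EventuallyEq.rfl
      filter_upwards [hev'] with p hp
      have s := (hc j α).contDiff_slice hp
      have s0 := (hc j α).contDiff_slice h0
      have s1 := (hc j α).contDiff_firstVar hε₀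
      rw [pd_sub_real α (s.sub s0) (contDiff_const.mul s1), pd_sub_real α s s0,
        pd_mul_real α contDiff_const s1, (hc j α).firstVar_pd hε₀]
      simp [pd]) (hF.isBigO_taylor hε₀)
  refine key.congr' ?_ EventuallyEq.rfl
  filter_upwards [hev] with ε hε
  rw [diracOp_taylor (fun j α => (hc j α).contDiff_slice hε) (fun j α => (hc j α).contDiff_slice h0)
    (fun j α => (hc j α).contDiff_firstVar hε₀) (hF.contDiff_slice hε).continuous
    (hF.contDiff_slice h0).continuous (hF.contDiff_firstVar hε₀).continuous, ← diracOp_flat,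
    axialE_zero hid, firstVar_axialE hε₀ he hid]
  simp only [firstVar_cofE hε₀ he hid, cofE_zero hid]

lemma isBigO_diracOp_sub (hε₀ : 0 < ε₀) (he : ∀ j α, SmoothFamily ε₀ fun ε x => e ε x j α)
    (hid : ∀ x, e 0 x = 1) :
    (fun ε : ℝ => diracOp (cofE (e ε)) (axialE (e ε)) - (1 - constProj)) =O[𝓝 0]
      fun ε : ℝ => ε := by
  have h1 := (isBigO_diracOp_taylor hε₀ he hid).trans
    (IsBigO.of_bound (g := fun ε : ℝ => ε) 1 (by
      filter_upwards [Icc_mem_nhds (show (-1 : ℝ) < 0 by norm_num) one_pos] with ε hε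
      rw [norm_pow, pow_two]
      exact mul_le_mul_of_nonneg_right (abs_le.2 hε) (norm_nonneg _)))
  have h2 : (fun ε : ℝ => (ε : ℂ) • diracOp (cofVar (coframeVar e)) (axialLin (coframeVar e)))
      =O[𝓝 0] fun ε : ℝ => ε := by
    refine IsBigO.of_bound ‖diracOp (cofVar (coframeVar e)) (axialLin (coframeVar e))‖ ?_
    refine Eventually.of_forall fun ε => ?_
    rw [norm_smul, mul_comm, Complex.norm_real]
  refine (h1.add h2).congr_left fun ε => ?_
  abel

lemma isBigO_densityOp_sub (hε₀ : 0 < ε₀) (he : ∀ j α, SmoothFamily ε₀ fun ε x => e ε x j α)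
    (hid : ∀ x, e 0 x = 1) :
    (fun ε : ℝ => densityOp (fun x => (e ε x).det) - sobolevIso) =O[𝓝 0] fun ε : ℝ => ε := by
  have hd := smoothFamily_det he
  have h1 := isBigO_mulOp (f := fun ε x => (e ε x).det - (e 0 x).det) (n := 1)
    ((hd.isBigO_sub hε₀).congr_right fun p => (pow_one _).symm)
  have hev : ∀ᶠ ε : ℝ in 𝓝 0, ε ∈ Set.Ioo (-ε₀) ε₀ :=
    Ioo_mem_nhds (neg_neg_of_pos hε₀) hε₀
  refine (isBigO_clm_comp h1 sobolevIso).congr' ?_ (Eventually.of_forall fun ε => pow_one _)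
  filter_upwards [hev] with ε hε
  have hc : Continuous fun x => ((e ε x).det : ℂ) :=
    Complex.continuous_ofReal.comp (hd.contDiff_slice hε).continuous
  have := mulOp_sub hc (continuous_const (y := (1 : ℂ)))
  simp only [hid, Matrix.det_one, Complex.ofReal_sub, Complex.ofReal_one]
  rw [this, mulOp_one, ContinuousLinearMap.sub_comp]
  rfl

/-- For small `ε` the Dirac operator is a small perturbation of the flat one in the sense of
`SmallPencil`. -/
lemma exists_smallPencil (hε₀ : 0 < ε₀) (he : ∀ j α, SmoothFamily ε₀ fun ε x => e ε x j α)
    (hper : ∀ ε ∈ Set.Ioo (-ε₀) ε₀, Periodic3 (e ε)) (hid : ∀ x, e 0 x = 1) :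
    ∃ K M : ℝ, 1 ≤ K ∧ 1 ≤ M ∧ ∀ᶠ ε : ℝ in 𝓝 0, SmallPencil (planeWave (0, 0)) (planeWave (0, 1))
      sobolevIso (diracOp (cofE (e ε)) (axialE (e ε))) (densityOp fun x => (e ε x).det) conjOp
      K (M * |ε|) := by
  obtain ⟨M₁, hM₁⟩ := (isBigO_diracOp_sub hε₀ he hid).bound
  obtain ⟨M₂, hM₂⟩ := (isBigO_densityOp_sub hε₀ he hid).bound
  set K := max 1 ‖sobolevIso‖
  set M := max 1 (max M₁ M₂)
  have hK : 1 ≤ K := le_max_left _ _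
  have hM : 1 ≤ M := le_max_left _ _
  refine ⟨K, M, hK, hM, ?_⟩
  have hev : ∀ᶠ ε : ℝ in 𝓝 0, ε ∈ Set.Ioo (-ε₀) ε₀ :=
    Ioo_mem_nhds (neg_neg_of_pos hε₀) hε₀
  have hsmall : ∀ᶠ ε : ℝ in 𝓝 0, 100 * K ^ 2 * (M * |ε|) < 1 := by
    have : Tendsto (fun ε : ℝ => 100 * K ^ 2 * (M * |ε|)) (𝓝 0) (𝓝 (100 * K ^ 2 * (M * |0|))) :=
      Continuous.tendsto (by fun_prop) 0
    exact this.eventually_lt_const (by simp)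
  filter_upwards [hM₁, hM₂, hev, hsmall] with ε h1 h2 hε h3
  have hcs := fun j α => (smoothFamily_cofE he j α).contDiff_slice hε
  have hF := ((smoothFamily_axialE he).contDiff_slice hε).continuous
  have hd := ((smoothFamily_det he).contDiff_slice hε).continuous
  exact
  { norm₁ := orthonormal_planeWave.1 _
    norm₂ := orthonormal_planeWave.1 _
    orth := orthonormal_planeWave.2 (by simp)
    J₁ := sobolevIso_planeWave 0
    J₂ := sobolevIso_planeWave 1
    PJ := fun f => by
      change constProj (sobolevIso f) = constProj f
      rw [sobolevIso, add_apply, map_add, constProj_flatInv, constProj_constProj, add_zero]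
    one_le := hK
    normJ := le_max_right _ _
    normL := h1.trans (mul_le_mul_of_nonneg_right
      ((le_max_left _ _).trans (le_max_right _ _)) (abs_nonneg _))
    normG := h2.trans (mul_le_mul_of_nonneg_right
      ((le_max_right _ _).trans (le_max_right _ _)) (abs_nonneg _))
    symmL := inner_diracOp hcs (periodic_cofE (hper ε hε)) hF
    symmG := inner_densityOp hd
    C₁ := conjOp_planeWave_zero
    C₂ := conjOp_planeWave_one
    CP := conjOp_constProj
    CL := conjOp_diracOp hcs hF
    CG := conjOp_densityOp hd
    small := h3.le }

lemma det_ne_zero {g e : ℝ → R3 → Matrix (Fin 3) (Fin 3) ℝ} (hg : IsMetricFamily ε₀ g)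
    (he : IsCoframeFamily ε₀ g e) {ε : ℝ} (hε : ε ∈ Set.Ioo (-ε₀) ε₀) (x : R3) :
    (e ε x).det ≠ 0 := by
  have h := (hg.posDef ε hε x).det_pos
  rw [he.metric ε hε, Matrix.det_mul, Matrix.det_transpose] at h
  exact fun h0 => by simp [h0] at h

end Families

/-! ### Fourier coefficients of the Dirac operator on constant spinors -/

/-- The Fourier coefficient of a real function. -/
abbrev hat (φ : R3 → ℝ) (m : Fin 3 → ℤ) : ℂ := fourierCoeff3 (fun x => (φ x : ℂ)) m

lemma fcoef_mulOp_planeWave {φ : R3 → ℂ} (hφ : Continuous φ) (k : Fin 2) (m : Fin 3 → ℤ)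
    (i : Fin 2) : fcoef (mulOp φ (planeWave (0, k))) m i =
      if i = k then fourierCoeff3 φ m else 0 := by
  have h1 : mulOp (expo 0) = 1 := by
    rw [show expo 0 = fun _ => 1 from funext expo_zero, mulOp_one]
  rw [planeWave, h1, one_apply_eq_self, map_smul, fcoef_smul, fcoef_mulOp_cst hφ]
  split_ifs
  · rw [← mul_assoc, ← mul_assoc, fnorm_sq, one_mul]
  · simp

section Linear

variable {φ ψ : R3 → ℝ}

lemma hat_eq_fcoef (hφ : Continuous φ) (m : Fin 3 → ℤ) (i : Fin 2) :
    hat φ m = fcoef (mulOp (fun x => (φ x : ℂ)) (planeWave (0, i))) m i := by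
  rw [fcoef_mulOp_planeWave (φ := fun x => (φ x : ℂ)) (Complex.continuous_ofReal.comp hφ),
    if_pos rfl]

lemma hat_add (hφ : Continuous φ) (hψ : Continuous ψ) (m : Fin 3 → ℤ) :
    hat (fun x => φ x + ψ x) m = hat φ m + hat ψ m := by
  rw [hat_eq_fcoef (φ := fun x => φ x + ψ x) (hφ.add hψ) m 0, hat_eq_fcoef hφ m 0,
    hat_eq_fcoef hψ m 0, ← fcoef_add, ← add_apply, ← mulOp_add (φ := fun x => (φ x : ℂ))
    (ψ := fun x => (ψ x : ℂ)) (Complex.continuous_ofReal.comp hφ)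
    (Complex.continuous_ofReal.comp hψ)]
  simp

lemma hat_const_mul (c : ℝ) (hφ : Continuous φ) (m : Fin 3 → ℤ) :
    hat (fun x => c * φ x) m = c * hat φ m := by
  rw [hat_eq_fcoef (φ := fun x => c * φ x) (continuous_const.mul hφ) m 0, hat_eq_fcoef hφ m 0,
    ← fcoef_smul, ← smul_apply, ← mulOp_const_mul (φ := fun x => (φ x : ℂ)) _
    (Complex.continuous_ofReal.comp hφ)]
  simp

lemma hat_sub (hφ : Continuous φ) (hψ : Continuous ψ) (m : Fin 3 → ℤ) :
    hat (fun x => φ x - ψ x) m = hat φ m - hat ψ m := by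
  have := hat_add hφ (ψ := fun x => -1 * ψ x) (continuous_const.mul hψ) m
  rw [hat_const_mul _ hψ] at this
  simpa [sub_eq_add_neg] using this

lemma hat_sum {ι : Type*} (s : Finset ι) {φ : ι → R3 → ℝ} (hφ : ∀ i, Continuous (φ i))
    (m : Fin 3 → ℤ) : hat (fun x => ∑ i ∈ s, φ i x) m = ∑ i ∈ s, hat (φ i) m := by
  classical
  induction s using Finset.induction_on with
  | empty => simp [hat, fourierCoeff3]
  | insert a s ha ih =>
    simp only [Finset.sum_insert ha]
    rw [hat_add (hφ a) (continuous_finsetSum _ fun i _ => hφ i), ih]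

lemma hat_pd (α : Fin 3) (hφ : ContDiff ℝ ∞ φ) (hp : Periodic3 φ) (m : Fin 3 → ℤ) :
    hat (pd α φ) m = Complex.I * m α * hat φ m := by
  rw [hat, ← fourierCoeff3_pd α (ψ := fun x => (φ x : ℂ))
    (Complex.ofRealCLM.contDiff.comp (hφ.of_le (by simp))) (hp.comp _)]
  congr 1
  ext x
  exact (pd_ofReal α (hφ.of_le (by simp)) x).symm

/-- Parseval's identity: the mean of a product. -/
lemma hasSum_hat (hφ : Continuous φ) (hψ : Continuous ψ) :
    HasSum (fun m => (starRingEnd ℂ) (hat φ m) * hat ψ m) (hat (fun x => φ x * ψ x) 0) := by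
  have h := hasSum_inner (mulOp (fun x => (φ x : ℂ)) (planeWave (0, 0)))
    (mulOp (fun x => (ψ x : ℂ)) (planeWave (0, 0)))
  rw [inner_mulOp_ofReal hφ, mulOp_mulOp (φ := fun x => (φ x : ℂ)) (ψ := fun x => (ψ x : ℂ))
    (Complex.continuous_ofReal.comp hφ) (Complex.continuous_ofReal.comp hψ)] at h
  have h2 := h.prod_fiberwise fun m => hasSum_fintype _
  simp only [Fin.sum_univ_two, fcoef_mulOp_planeWave (φ := fun x => (φ x : ℂ))
    (Complex.continuous_ofReal.comp hφ), fcoef_mulOp_planeWave (φ := fun x => (ψ x : ℂ))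
    (Complex.continuous_ofReal.comp hψ)] at h2
  rw [hat_eq_fcoef (φ := fun x => φ x * ψ x) (hφ.mul hψ) 0 0]
  simpa [fcoef] using h2

end Linear

lemma matOp_planeWave (j : Fin 3) (i : Fin 2) :
    matOp (pauli j) (planeWave (0, i)) = ∑ k, pauli j k i • planeWave (0, k) := by
  refine fcoef_ext fun m l => ?_
  simp only [fcoef_matOp, fcoef_sum, fcoef_smul, fcoef_planeWave]
  by_cases hm : m = 0 <;> simp [hm]

lemma diracOp_planeWave (c : Fin 3 → Fin 3 → R3 → ℝ) (F : R3 → ℝ) (i : Fin 2) :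
    diracOp c F (planeWave (0, i)) = (∑ j, ∑ α, (-Complex.I / 2) •
      mulOp (fun x => ((pd α (c j α) x : ℝ) : ℂ)) (∑ k, pauli j k i • planeWave (0, k))) +
      mulOp (fun x => (F x : ℂ)) (planeWave (0, i)) := by
  simp [diracOp_apply, riesz_planeWave, sobolevIso_planeWave, matOp_planeWave]

lemma fcoef_diracOp_planeWave {c : Fin 3 → Fin 3 → R3 → ℝ} {F : R3 → ℝ}
    (hc : ∀ j α, ContDiff ℝ ∞ (c j α)) (hp : ∀ j α, Periodic3 (c j α)) (hF : Continuous F)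
    (i : Fin 2) (m : Fin 3 → ℤ) (k : Fin 2) :
    fcoef (diracOp c F (planeWave (0, i))) m k =
      (-Complex.I / 2) * ∑ j, pauli j k i * ∑ α, Complex.I * m α * hat (c j α) m +
        if k = i then hat F m else 0 := by
  rw [diracOp_planeWave, fcoef_add, fcoef_mulOp_planeWave (φ := fun x => (F x : ℂ))
    (Complex.continuous_ofReal.comp hF)]
  congr 1
  simp only [fcoef_sum, fcoef_smul, map_sum, map_smul, Finset.mul_sum]
  refine Finset.sum_congr rfl fun j _ => Finset.sum_congr rfl fun α _ => ?_
  simp only [fcoef_mulOp_planeWave (φ := fun x => ((pd α (c j α) x : ℝ) : ℂ))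
    (Complex.continuous_ofReal.comp (continuous_pd_real (hc j α) α)), mul_ite, mul_zero,
    Finset.sum_ite_eq, Finset.mem_univ, if_true]
  rw [← hat_pd α (hc j α) (hp j α)]

/-- The diagonal matrix elements on constant spinors. The derivatives of the coefficients have mean
zero, so only `F` contributes. -/
lemma inner_diracOp_planeWave {c : Fin 3 → Fin 3 → R3 → ℝ} {F : R3 → ℝ}
    (hc : ∀ j α, ContDiff ℝ ∞ (c j α)) (hp : ∀ j α, Periodic3 (c j α)) (hF : Continuous F)
    (i : Fin 2) :
    inner ℂ (diracOp c F (planeWave (0, i))) (planeWave (0, i)) = hat F 0 := by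
  have h := inner_diracOp hc hp hF (planeWave (0, i)) (planeWave (0, i))
  rw [sobolevIso_planeWave] at h
  rw [← h]
  refine (fcoef_diracOp_planeWave hc hp hF i 0 i).trans ?_
  simp

lemma continuous_curl {A : R3 → Matrix (Fin 3) (Fin 3) ℝ}
    (hA : ∀ j α, ContDiff ℝ ∞ fun x => A x j α) (k α : Fin 3) :
    Continuous fun x => pd (α + 1) (fun y => A y k (α + 2)) x -
      pd (α + 2) (fun y => A y k (α + 1)) x :=
  (continuous_pd_real (hA _ _) _).sub (continuous_pd_real (hA _ _) _)

lemma hat_curl {A : R3 → Matrix (Fin 3) (Fin 3) ℝ} (hA : ∀ j α, ContDiff ℝ ∞ fun x => A x j α)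
    (hp : Periodic3 A) (k α : Fin 3) (m : Fin 3 → ℤ) :
    hat (fun x => pd (α + 1) (fun y => A y k (α + 2)) x -
      pd (α + 2) (fun y => A y k (α + 1)) x) m =
      Complex.I * m (α + 1) * hat (fun x => A x k (α + 2)) m -
        Complex.I * m (α + 2) * hat (fun x => A x k (α + 1)) m := by
  have hpA : ∀ j k, Periodic3 fun x => A x j k := fun j k => hp.comp fun B => B j k
  rw [hat_sub (φ := fun x => pd (α + 1) (fun y => A y k (α + 2)) x)
    (ψ := fun x => pd (α + 2) (fun y => A y k (α + 1)) x) (continuous_pd_real (hA _ _) _)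
    (continuous_pd_real (hA _ _) _)]
  exact congrArg₂ _ (hat_pd _ (hA _ _) (hpA _ _) m) (hat_pd _ (hA _ _) (hpA _ _) m)

lemma hat_axialLin {A : R3 → Matrix (Fin 3) (Fin 3) ℝ} (hA : ∀ j α, ContDiff ℝ ∞ fun x => A x j α)
    (hp : Periodic3 A) (m : Fin 3 → ℤ) :
    hat (axialLin A) m = (1 / 4) * ∑ k : Fin 3,
      (Complex.I * m (k + 1) * hat (fun x => A x k (k + 2)) m -
        Complex.I * m (k + 2) * hat (fun x => A x k (k + 1)) m) := by
  have hcu := continuous_curl hA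
  unfold axialLin
  rw [hat_const_mul _ (continuous_finsetSum _ fun k _ => hcu k k), hat_sum _ fun k => hcu k k]
  have := Finset.sum_congr rfl fun k (_ : k ∈ Finset.univ) => hat_curl hA hp k k m
  rw [this]
  simp

lemma hat_cofVar {A : R3 → Matrix (Fin 3) (Fin 3) ℝ} (hA : ∀ j α, Continuous fun x => A x j α)
    (j α : Fin 3) (m : Fin 3 → ℤ) :
    hat (cofVar A j α) m = (if j = α then ∑ k, hat (fun x => A x k k) m else 0) -
      hat (fun x => A x α j) m := by
  unfold cofVar
  split_ifs
  · rw [hat_sub (continuous_finsetSum _ fun k _ => hA k k) (hA _ _), hat_sum _ fun k => hA k k]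
  · rw [hat_sub continuous_const (hA _ _)]
    simp [hat, fourierCoeff3]

/-- The mean of `axialE` as a sum over frequencies, by Parseval's identity. -/
lemma hasSum_hat_axialE {A : R3 → Matrix (Fin 3) (Fin 3) ℝ}
    (hA : ∀ j α, ContDiff ℝ ∞ fun x => A x j α) (hp : Periodic3 A) :
    HasSum (fun m : Fin 3 → ℤ => (1 / 4) * ∑ k, ∑ α : Fin 3,
      (starRingEnd ℂ) (hat (fun x => A x k α) m) *
        (Complex.I * m (α + 1) * hat (fun x => A x k (α + 2)) m -
          Complex.I * m (α + 2) * hat (fun x => A x k (α + 1)) m)) (hat (axialE A) 0) := by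
  have hcu := continuous_curl hA
  have h1 : ∀ k α, Continuous fun x => A x k α * (pd (α + 1) (fun y => A y k (α + 2)) x -
      pd (α + 2) (fun y => A y k (α + 1)) x) := fun k α => (hA k α).continuous.mul (hcu k α)
  have h : ∀ k α, HasSum (fun m : Fin 3 → ℤ => (starRingEnd ℂ) (hat (fun x => A x k α) m) *
      (Complex.I * m (α + 1) * hat (fun x => A x k (α + 2)) m -
        Complex.I * m (α + 2) * hat (fun x => A x k (α + 1)) m))
      (hat (fun x => A x k α * (pd (α + 1) (fun y => A y k (α + 2)) x -
        pd (α + 2) (fun y => A y k (α + 1)) x)) 0) := fun k α => by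
    refine (hasSum_hat (hA k α).continuous (hcu k α)).congr_fun fun m => ?_
    exact congrArg₂ _ rfl (hat_curl hA hp k α m).symm
  have h2 := (hasSum_sum fun k (_ : k ∈ Finset.univ) =>
    hasSum_sum fun α (_ : α ∈ Finset.univ) => h k α).mul_left (1 / 4 : ℂ)
  unfold axialE
  rw [hat_const_mul _ (continuous_finsetSum _ fun k _ => continuous_finsetSum _ fun α _ => h1 k α),
    hat_sum _ fun k => continuous_finsetSum _ fun α _ => h1 k α]
  have h3 := Finset.sum_congr rfl fun k (_ : k ∈ Finset.univ) =>
    hat_sum Finset.univ (h1 k) 0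
  rw [h3]
  simpa using h2

/-! ### The second-order coefficient -/

/-- The part of `⟨D⁻¹ ψ, ψ⟩` at one frequency, for `D` the flat Dirac operator, summed over the
two constant spinors that `ψ` comes from. -/
lemma sum_pauli_quadratic (m D : Fin 3 → ℂ) (F n : ℂ) (hm : ∀ j, (starRingEnd ℂ) (m j) = m j)
    (hn : (starRingEnd ℂ) n = n) :
    ∑ i, ∑ k, (starRingEnd ℂ) (∑ j, ∑ l, pauli j k l * (m j / n * ((-Complex.I / 2) *
      ∑ j, pauli j l i * D j + if l = i then F else 0))) * ((-Complex.I / 2) *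
      ∑ j, pauli j k i * D j + if k = i then F else 0) =
    2 * (n⁻¹ * (-(Complex.I / 2) * (starRingEnd ℂ) F * (∑ j, D j * m j) +
      (Complex.I / 2) * (∑ j, (starRingEnd ℂ) (D j) * m j) * F + (Complex.I / 4) *
        ∑ j : Fin 3, (starRingEnd ℂ) (D j) * (m (j + 1) * D (j + 2) - m (j + 2) * D (j + 1)))) := by
  simp [pauli, Fin.sum_univ_two, Fin.sum_univ_three, hm, hn, div_eq_mul_inv]
  have h2 : (starRingEnd ℂ) 2 = 2 := map_ofNat _ 2
  rw [h2]
  ring_nf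
  simp only [Complex.I_pow_three]
  ring

lemma sum_antisymbol (T : Fin 3 → Fin 3 → Fin 3 → ℂ) :
    ∑ α, ∑ β, ∑ γ, antisymbol α β γ * T α β γ =
      T 0 1 2 + T 1 2 0 + T 2 0 1 - T 0 2 1 - T 2 1 0 - T 1 0 2 := by
  simp [antisymbol, Fin.sum_univ_three]
  ring

/-- The algebraic identity behind the formula for the coefficient. Here `a` and `b` stand for the
Fourier coefficients of the first variation of the coframe and for their complex conjugates. -/
lemma coefficient_polynomial (a b : Fin 3 → Fin 3 → ℂ) (m d d' : Fin 3 → ℂ) (f f' : ℂ)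
    (hf : f = (1 / 4) * ∑ k : Fin 3, (m (k + 1) * a k (k + 2) - m (k + 2) * a k (k + 1)))
    (hf' : f' = (1 / 4) * ∑ k : Fin 3, (m (k + 1) * b k (k + 2) - m (k + 2) * b k (k + 1)))
    (hd : ∀ j, d j = ∑ α, m α * ((if j = α then ∑ k, a k k else 0) - a α j))
    (hd' : ∀ j, d' j = ∑ α, m α * ((if j = α then ∑ k, b k k else 0) - b α j)) :
    (∑ κ, m κ ^ 2) * ((1 / 4) * ∑ k, ∑ α : Fin 3, b k α *
        (m (α + 1) * a k (α + 2) - m (α + 2) * a k (α + 1))) -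
      (-(1 / 2) * f' * (∑ j, d j * m j) + (1 / 2) * (∑ j, d' j * m j) * f + (1 / 4) *
        ∑ j : Fin 3, d' j * (m (j + 1) * d (j + 2) - m (j + 2) * d (j + 1))) =
    (1 / 16) * ∑ α, ∑ β, ∑ γ, antisymbol α β γ * ∑ μ, ∑ ν,
      ((if μ = ν then ∑ κ, m κ ^ 2 else 0) - m μ * m ν) * m α * (a β μ + a μ β) *
        (b γ ν + b ν γ) := by
  rw [sum_antisymbol]
  simp only [hf, hf', hd, hd', Fin.sum_univ_three, Fin.isValue, Fin.reduceAdd, Fin.reduceEq,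
    if_true, if_false]
  ring

/-- `coefficient_polynomial` in terms of the Fourier coefficients `F`, `D j` of the zeroth-order
terms of the Dirac operator. -/
lemma coefficient_identity (a : Fin 3 → Fin 3 → ℂ) (m : Fin 3 → ℂ)
    (hm : ∀ j, (starRingEnd ℂ) (m j) = m j) (hn : ∑ κ, m κ ^ 2 ≠ 0) (D : Fin 3 → ℂ) (F : ℂ)
    (hF : F = (1 / 4) * ∑ k : Fin 3, (Complex.I * m (k + 1) * a k (k + 2) -
      Complex.I * m (k + 2) * a k (k + 1)))
    (hD : ∀ j, D j = ∑ α, Complex.I * m α * ((if j = α then ∑ k, a k k else 0) - a α j)) :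
    (1 / 4) * ∑ k, ∑ α : Fin 3, (starRingEnd ℂ) (a k α) *
        (Complex.I * m (α + 1) * a k (α + 2) - Complex.I * m (α + 2) * a k (α + 1)) -
      (∑ κ, m κ ^ 2)⁻¹ * (-(Complex.I / 2) * (starRingEnd ℂ) F * (∑ j, D j * m j) +
      (Complex.I / 2) * (∑ j, (starRingEnd ℂ) (D j) * m j) * F + (Complex.I / 4) *
        ∑ j : Fin 3, (starRingEnd ℂ) (D j) * (m (j + 1) * D (j + 2) - m (j + 2) * D (j + 1))) =
    (Complex.I / 16) * ∑ α, ∑ β, ∑ γ, antisymbol α β γ * ∑ μ, ∑ ν,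
      ((if μ = ν then 1 else 0) - m μ * m ν / ∑ κ, m κ ^ 2) * m α * (a β μ + a μ β) *
        (starRingEnd ℂ) (a γ ν + a ν γ) := by
  set n := ∑ κ, m κ ^ 2 with hndef
  set f := (1 / 4) * ∑ k : Fin 3, (m (k + 1) * a k (k + 2) - m (k + 2) * a k (k + 1)) with hf
  set d : Fin 3 → ℂ := fun j => ∑ α, m α * ((if j = α then ∑ k, a k k else 0) - a α j) with hd
  have hF' : F = Complex.I * f := by
    rw [hF, hf]; simp only [Fin.sum_univ_three]; ring
  have hD' : ∀ j, D j = Complex.I * d j := fun j => by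
    rw [hD, hd]; simp only [Finset.mul_sum, mul_assoc]
  have h4 : (starRingEnd ℂ) 4 = 4 := map_ofNat _ 4
  have key := coefficient_polynomial a (fun j k => (starRingEnd ℂ) (a j k)) m d
    (fun j => (starRingEnd ℂ) (d j)) f ((starRingEnd ℂ) f) hf
    (by rw [hf]; simp [hm, h4]) (fun _ => rfl)
    (fun j => by simp [hd, hm, apply_ite (starRingEnd ℂ)])
  have hr : ∀ α β γ μ ν : Fin 3, ((if μ = ν then 1 else 0) - m μ * m ν / n) * m α *
      (a β μ + a μ β) * (starRingEnd ℂ) (a γ ν + a ν γ) =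
      n⁻¹ * (((if μ = ν then n else 0) - m μ * m ν) * m α * (a β μ + a μ β) *
        ((starRingEnd ℂ) (a γ ν) + (starRingEnd ℂ) (a ν γ))) := by
    intro α β γ μ ν
    rw [map_add]
    split_ifs
    · field_simp
    · field_simp
      ring
  simp only [hr, ← Finset.mul_sum, mul_left_comm _ n⁻¹]
  rw [← hndef] at key
  have hI : ∀ z : ℂ, n⁻¹ * (Complex.I / 16 * z) = Complex.I * n⁻¹ * (1 / 16 * z) := fun z => by
    ring
  have e1 : (1 / 4) * ∑ k, ∑ α : Fin 3, (starRingEnd ℂ) (a k α) *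
        (Complex.I * m (α + 1) * a k (α + 2) - Complex.I * m (α + 2) * a k (α + 1)) =
      Complex.I * ((1 / 4) * ∑ k, ∑ α : Fin 3, (starRingEnd ℂ) (a k α) *
        (m (α + 1) * a k (α + 2) - m (α + 2) * a k (α + 1))) := by
    simp only [Fin.sum_univ_three]; ring
  have e2 : -(Complex.I / 2) * (starRingEnd ℂ) F * (∑ j, D j * m j) +
      (Complex.I / 2) * (∑ j, (starRingEnd ℂ) (D j) * m j) * F + (Complex.I / 4) *
        ∑ j : Fin 3, (starRingEnd ℂ) (D j) * (m (j + 1) * D (j + 2) - m (j + 2) * D (j + 1)) =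
      Complex.I * (-(1 / 2) * (starRingEnd ℂ) f * (∑ j, d j * m j) +
        (1 / 2) * (∑ j, (starRingEnd ℂ) (d j) * m j) * f + (1 / 4) *
        ∑ j : Fin 3, (starRingEnd ℂ) (d j) * (m (j + 1) * d (j + 2) - m (j + 2) * d (j + 1))) := by
    rw [hF']
    simp only [hD', map_mul, Complex.conj_I, Fin.sum_univ_three]
    ring_nf
    simp only [Complex.I_pow_three]
    ring
  rw [hI, ← key, e1, e2]
  field_simp

/-- The image of a constant spinor under the first variation of the Dirac operator, for a family of
coframes with first variation `A`. -/
def firstOrderSpinor (A : R3 → Matrix (Fin 3) (Fin 3) ℝ) (i : Fin 2) : SpinorL2 :=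
  diracOp (cofVar A) (axialLin A) (planeWave (0, i))

section Coefficient

variable {A : R3 → Matrix (Fin 3) (Fin 3) ℝ}

lemma contDiff_cofVar (hA : ∀ j α, ContDiff ℝ ∞ fun x => A x j α) (j α : Fin 3) :
    ContDiff ℝ ∞ (cofVar A j α) := by
  unfold cofVar
  split_ifs
  · exact (ContDiff.sum fun k _ => hA k k).sub (hA _ _)
  · exact contDiff_const.sub (hA _ _)

lemma continuous_axialLin (hA : ∀ j α, ContDiff ℝ ∞ fun x => A x j α) : Continuous (axialLin A) :=
  continuous_const.mul (continuous_finsetSum _ fun k _ =>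
    (continuous_pd_real (hA k (k + 2)) (k + 1)).sub (continuous_pd_real (hA k (k + 1)) (k + 2)))

/-- The summand of the coefficient at the frequency `m`, for a metric with first variation
`A + Aᵀ`. -/
def coeffSummand (A : R3 → Matrix (Fin 3) (Fin 3) ℝ) (m : Fin 3 → ℤ) : ℂ :=
  (Complex.I / 16) * ∑ α, ∑ β, ∑ γ, antisymbol α β γ * ∑ μ, ∑ ν,
    ((if μ = ν then 1 else 0) - (m μ : ℂ) * m ν / ∑ κ, (m κ : ℂ) ^ 2) * m α *
      (hat (fun x => A x β μ) m + hat (fun x => A x μ β) m) *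
        (starRingEnd ℂ) (hat (fun x => A x γ ν) m + hat (fun x => A x ν γ) m)

/-- The second-order coefficient given by perturbation theory, averaged over the two constant
spinors, as a sum over frequencies. It depends on the symmetric part of `A` only. -/
lemma hasSum_coeffSummand (hA : ∀ j α, ContDiff ℝ ∞ fun x => A x j α) (hp : Periodic3 A) :
    HasSum (coeffSummand A) (hat (axialE A) 0 - (1 / 2) *
      ∑ i, inner ℂ (flatInv (firstOrderSpinor A i)) (firstOrderSpinor A i)) := by
  have hpc : ∀ j α, Periodic3 (cofVar A j α) := fun j α =>
    hp.comp fun B => (if j = α then ∑ k, B k k else 0) - B α j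
  have h1 := hasSum_hat_axialE hA hp
  have h2 := fun i => (hasSum_inner (flatInv (firstOrderSpinor A i))
    (firstOrderSpinor A i)).prod_fiberwise fun m => hasSum_fintype _
  have h3 := h1.sub ((hasSum_sum fun i (_ : i ∈ Finset.univ) => h2 i).mul_left (1 / 2 : ℂ))
  refine h3.congr_fun fun m => ?_
  set D : Fin 3 → ℂ := fun j => ∑ α, Complex.I * m α * hat (cofVar A j α) m with hD
  have hf : ∀ i k, fcoef (firstOrderSpinor A i) m k = (-Complex.I / 2) * ∑ j, pauli j k i * D j +
      if k = i then hat (axialLin A) m else 0 := fun i k =>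
    fcoef_diracOp_planeWave (contDiff_cofVar hA) hpc (continuous_axialLin hA) i m k
  have hint : ∀ j, (starRingEnd ℂ) (m j : ℂ) = m j := fun j => map_intCast _ _
  simp only [fcoef_flatInv, hf, rsym]
  rw [sum_pauli_quadratic (fun j => (m j : ℂ)) D _ (∑ κ, (m κ : ℂ) ^ 2) hint (by simp)]
  by_cases hm : m = 0
  · simp [hm, coeffSummand]
  rw [← mul_assoc, show (1 / 2 : ℂ) * 2 = 1 by norm_num, one_mul]
  refine (coefficient_identity (fun j k => hat (fun x => A x j k) m) (fun j => (m j : ℂ)) hint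
    (sum_sq_ne_zero hm) D _ (hat_axialLin hA hp m) fun j => ?_).symm
  simp only [hD, hat_cofVar (fun j α => (hA j α).continuous)]

end Coefficient

section Family

variable {ε₀ : ℝ} {g e : ℝ → R3 → Matrix (Fin 3) (Fin 3) ℝ}

lemma IsCoframeFamily.smoothFamily (he : IsCoframeFamily ε₀ g e) (j α : Fin 3) :
    SmoothFamily ε₀ fun ε x => e ε x j α := he.smooth j α

/-- The first variation `a + aᵀ` of the metric `eᵀ e`. -/
lemma hTensor_eq (hε₀ : 0 < ε₀) (he : IsCoframeFamily ε₀ g e) (α β : Fin 3) (x : R3) :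
    hTensor g α β x = coframeVar e x α β + coframeVar e x β α := by
  have h := fun j α => SmoothFamily.hasDerivAt_zero hε₀ (he.smoothFamily j α) x
  have h1 : HasDerivAt (fun ε => ∑ k, e ε x k α * e ε x k β)
      (coframeVar e x α β + coframeVar e x β α) 0 := by
    have := HasDerivAt.fun_sum fun k (_ : k ∈ Finset.univ) => (h k α).mul (h k β)
    refine this.congr_deriv ?_
    simp only [he.identity, Matrix.one_apply, coframeVar, Matrix.of_apply]
    simp [Finset.sum_add_distrib, add_comm]
  have h2 : (fun ε => g ε x α β) =ᶠ[𝓝 0] fun ε => ∑ k, e ε x k α * e ε x k β := by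
    filter_upwards [Ioo_mem_nhds (neg_neg_of_pos hε₀) hε₀] with ε hε
    rw [he.metric ε hε, Matrix.mul_apply]
    rfl
  rw [hTensor, h2.deriv_eq, h1.deriv]

lemma contDiff_coframeVar (hε₀ : 0 < ε₀) (he : IsCoframeFamily ε₀ g e) (j α : Fin 3) :
    ContDiff ℝ ∞ fun x => coframeVar e x j α :=
  SmoothFamily.contDiff_firstVar hε₀ (he.smoothFamily j α)

lemma periodic_coframeVar (hε₀ : 0 < ε₀) (he : IsCoframeFamily ε₀ g e) :
    Periodic3 (coframeVar e) := by
  intro x α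
  ext j β
  exact SmoothFamily.periodic_firstVar (f := fun ε x => e ε x j β) hε₀
    (fun ε hε => (he.periodic ε hε).comp fun B => B j β) x α

lemma contDiff_hTensor (hε₀ : 0 < ε₀) (he : IsCoframeFamily ε₀ g e) (α β : Fin 3) :
    ContDiff ℝ ∞ (hTensor g α β) := by
  rw [funext (hTensor_eq hε₀ he α β)]
  exact (contDiff_coframeVar hε₀ he _ _).add (contDiff_coframeVar hε₀ he _ _)

lemma periodic_hTensor (hε₀ : 0 < ε₀) (he : IsCoframeFamily ε₀ g e) (α β : Fin 3) :
    Periodic3 (hTensor g α β) := by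
  rw [funext (hTensor_eq hε₀ he α β)]
  exact (periodic_coframeVar hε₀ he).comp fun B => B α β + B β α

lemma hHat_eq (hε₀ : 0 < ε₀) (he : IsCoframeFamily ε₀ g e) (α β : Fin 3) (m : Fin 3 → ℤ) :
    hHat g α β m = hat (fun x => coframeVar e x α β) m + hat (fun x => coframeVar e x β α) m := by
  rw [← hat_add (contDiff_coframeVar hε₀ he _ _).continuous
    (contDiff_coframeVar hε₀ he _ _).continuous]
  simp only [hHat, hTensor_eq hε₀ he]

lemma norm_projection_symbol_le (μ ν : Fin 3) (m : Fin 3 → ℤ) :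
    ‖(if μ = ν then 1 else 0) - (m μ : ℂ) * (m ν : ℂ) / ∑ κ, (m κ : ℂ) ^ 2‖ ≤ 2 := by
  have h := norm_mul_rsym_le μ ν m
  rw [rsym, ← mul_div_assoc] at h
  refine (norm_sub_le _ _).trans ?_
  have : ‖(if μ = ν then 1 else 0 : ℂ)‖ ≤ 1 := by split_ifs <;> simp
  linarith

/-- The series is dominated by the Parseval series of `∂_α h_{βμ}` and `h_{γν}`. -/
lemma summable_coeffTerm (hε₀ : 0 < ε₀) (he : IsCoframeFamily ε₀ g e) (α β γ : Fin 3) :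
    Summable (coeffTerm g α β γ) := by
  refine summable_sum fun μ _ => summable_sum fun ν _ => ?_
  have h1 := contDiff_hTensor hε₀ he
  have h :=
    (hasSum_hat (h1 γ ν).continuous (continuous_pd_real (h1 β μ) α)).summable.norm.mul_left 2
  refine Summable.of_norm_bounded (h.comp_injective Subtype.val_injective) fun m => ?_
  rw [Function.comp_apply, hat_pd α (h1 β μ) (periodic_hTensor hε₀ he β μ), mul_assoc, mul_assoc,
    norm_mul]
  refine mul_le_mul (norm_projection_symbol_le _ _ _) (le_of_eq ?_) (norm_nonneg _) (by norm_num)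
  simp only [norm_mul, Complex.norm_I, one_mul, hHat]
  ring

/-- The constant of the expansion is the second-order coefficient of perturbation theory, averaged
over the two constant spinors. -/
lemma coeffC_eq (hε₀ : 0 < ε₀) (he : IsCoframeFamily ε₀ g e) :
    coeffC g = hat (axialE (coframeVar e)) 0 - (1 / 2) * ∑ i, inner ℂ
      (flatInv (firstOrderSpinor (coframeVar e) i)) (firstOrderSpinor (coframeVar e) i) := by
  have h1 := hasSum_coeffSummand (contDiff_coframeVar hε₀ he) (periodic_coframeVar hε₀ he)
  have h2 : HasSum (fun m : {m : Fin 3 → ℤ // m ≠ 0} => coeffSummand (coframeVar e) m.1)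
      (coeffC g) := by
    have := (hasSum_sum fun α (_ : α ∈ Finset.univ) => hasSum_sum fun β (_ : β ∈ Finset.univ) =>
      hasSum_sum fun γ (_ : γ ∈ Finset.univ) =>
        (summable_coeffTerm hε₀ he α β γ).hasSum.mul_left (antisymbol α β γ)).mul_left
          (Complex.I / 16)
    refine this.congr_fun fun m => ?_
    simp only [coeffSummand, coeffTerm, hHat_eq hε₀ he]
  have h0 : Function.support (coeffSummand (coframeVar e)) ⊆ {m | m ≠ 0} := by
    intro m hm h
    exact hm (by simp [h, coeffSummand])
  exact h2.unique ((hasSum_subtype_iff_of_support_subset h0).2 h1)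

end Family

/-! ### Asymptotics of the eigenvalue -/

section Family

variable {ε₀ : ℝ} {g e : ℝ → R3 → Matrix (Fin 3) (Fin 3) ℝ}

lemma eventually_mem_Ioo (hε₀ : 0 < ε₀) : ∀ᶠ ε : ℝ in 𝓝 0, ε ∈ Set.Ioo (-ε₀) ε₀ :=
  Ioo_mem_nhds (neg_neg_of_pos hε₀) hε₀

/-- The first-order term `⟨L c, c⟩` of perturbation theory is of second order in `ε`, since the mean
of `axialLin` vanishes. -/
lemma isBigO_inner_diracOp (hε₀ : 0 < ε₀) (he : IsCoframeFamily ε₀ g e) (i : Fin 2) :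
    (fun ε : ℝ => inner ℂ (diracOp (cofE (e ε)) (axialE (e ε)) (planeWave (0, i)))
      (planeWave (0, i)) - (ε : ℂ) ^ 2 * hat (axialE (coframeVar e)) 0)
      =O[𝓝 0] fun ε : ℝ => ε ^ 3 := by
  have hs := he.smoothFamily
  have h1 := isBigO_mulOp (f := fun ε x => axialE (e ε) x - axialLin (e ε) x -
    ε ^ 2 * axialE (coframeVar e) x) (isBigO_axialE hε₀ hs he.identity)
  refine IsBigO.trans (IsBigO.of_bound 1 ?_) h1
  filter_upwards [eventually_mem_Ioo hε₀] with ε hε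
  have hE := fun j α => (hs j α).contDiff_slice hε
  have hF := ((smoothFamily_axialE hs).contDiff_slice hε).continuous
  have hA : Continuous (axialE (coframeVar e)) := continuous_const.mul
    (continuous_finsetSum _ fun k _ => continuous_finsetSum _ fun α _ =>
      (contDiff_coframeVar hε₀ he k α).continuous.mul
        ((continuous_pd_real (contDiff_coframeVar hε₀ he k (α + 2)) (α + 1)).sub
          (continuous_pd_real (contDiff_coframeVar hε₀ he k (α + 1)) (α + 2))))
  have hlin : hat (axialLin (e ε)) 0 = 0 := by
    rw [hat_axialLin hE (he.periodic ε hε)]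
    simp
  rw [inner_diracOp_planeWave (fun j α => (smoothFamily_cofE hs j α).contDiff_slice hε)
    (periodic_cofE (he.periodic ε hε)) hF]
  have hr : hat (axialE (e ε)) 0 - (ε : ℂ) ^ 2 * hat (axialE (coframeVar e)) 0 =
      hat (fun x => axialE (e ε) x - axialLin (e ε) x - ε ^ 2 * axialE (coframeVar e) x) 0 := by
    rw [hat_sub (φ := fun x => axialE (e ε) x - axialLin (e ε) x)
      (ψ := fun x => ε ^ 2 * axialE (coframeVar e) x) (hF.sub (continuous_axialLin hE))
      (continuous_const.mul hA), hat_sub hF (continuous_axialLin hE), hat_const_mul _ hA, hlin]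
    simp
  rw [hr, hat_eq_fcoef (φ := fun x => axialE (e ε) x - axialLin (e ε) x -
    ε ^ 2 * axialE (coframeVar e) x) ((hF.sub (continuous_axialLin hE)).sub
      (continuous_const.mul hA)) 0 i, one_mul]
  refine (norm_inner_le_norm _ _).trans ?_
  rw [orthonormal_planeWave.1, one_mul]
  refine (ContinuousLinearMap.le_opNorm _ _).trans ?_
  rw [orthonormal_planeWave.1, mul_one]

lemma isBigO_diracOp_planeWave (hε₀ : 0 < ε₀) (he : IsCoframeFamily ε₀ g e) (i : Fin 2) :
    (fun ε : ℝ => diracOp (cofE (e ε)) (axialE (e ε)) (planeWave (0, i)) -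
      (ε : ℂ) • firstOrderSpinor (coframeVar e) i) =O[𝓝 0] fun ε : ℝ => ε ^ 2 := by
  refine IsBigO.trans (IsBigO.of_bound 1 (Eventually.of_forall fun ε => ?_))
    (isBigO_diracOp_taylor hε₀ he.smoothFamily he.identity)
  have := ContinuousLinearMap.le_opNorm (diracOp (cofE (e ε)) (axialE (e ε)) - (1 - constProj) -
      (ε : ℂ) • diracOp (cofVar (coframeVar e)) (axialLin (coframeVar e))) (planeWave (0, i))
  rw [orthonormal_planeWave.1, mul_one] at this
  rw [one_mul]
  refine le_trans (le_of_eq ?_) this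
  simp only [sub_apply, smul_apply, one_apply_eq_self, constProj_planeWave, sub_self, sub_zero,
    firstOrderSpinor]

/-- A quadratic form evaluated on a first-order expansion. -/
lemma isBigO_quadratic (T : SpinorL2 →L[ℂ] SpinorL2) {v : ℝ → SpinorL2} {ψ : SpinorL2}
    (hv : (fun ε : ℝ => v ε - (ε : ℂ) • ψ) =O[𝓝 0] fun ε : ℝ => ε ^ 2) :
    (fun ε : ℝ => inner ℂ (T (v ε)) (v ε) - (ε : ℂ) ^ 2 * inner ℂ (T ψ) ψ)
      =O[𝓝 0] fun ε : ℝ => ε ^ 3 := by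
  have hψ : (fun ε : ℝ => (ε : ℂ) • ψ) =O[𝓝 0] fun ε : ℝ => ε := by
    refine IsBigO.of_bound ‖ψ‖ (Eventually.of_forall fun ε => ?_)
    rw [norm_smul, mul_comm, Complex.norm_real]
  have hsq : (fun ε : ℝ => ε ^ 2) =O[𝓝 0] fun ε : ℝ => ε := by
    refine IsBigO.of_bound 1 ?_
    filter_upwards [Icc_mem_nhds (show (-1 : ℝ) < 0 by norm_num) one_pos] with ε hε
    rw [norm_pow, pow_two]
    exact mul_le_mul_of_nonneg_right (abs_le.2 hε) (norm_nonneg _)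
  have hv1 : v =O[𝓝 0] fun ε : ℝ => ε :=
    ((hv.trans hsq).add hψ).congr_left fun ε => by abel
  have hinner : ∀ {a b : ℝ → SpinorL2} {p q : ℝ → ℝ}, a =O[𝓝 0] p → b =O[𝓝 0] q →
      (fun ε => inner ℂ (T (a ε)) (b ε)) =O[𝓝 0] fun ε => p ε * q ε := by
    intro a b p q ha hb
    refine IsBigO.trans (IsBigO.of_bound ‖T‖ (Eventually.of_forall fun ε => ?_))
      (ha.norm_left.mul hb.norm_left)
    refine (norm_inner_le_norm _ _).trans ?_
    rw [norm_mul, norm_norm, norm_norm, ← mul_assoc]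
    exact mul_le_mul_of_nonneg_right (T.le_opNorm _) (norm_nonneg _)
  have h1 := (hinner hv hv1).congr_right (g₂ := fun ε : ℝ => ε ^ 3) fun ε => by ring
  have h2 := (hinner hψ hv).congr_right (g₂ := fun ε : ℝ => ε ^ 3) fun ε => by ring
  refine (h1.add h2).congr_left fun ε => ?_
  simp only [map_sub, map_smul, inner_sub_left, inner_sub_right, inner_smul_left, inner_smul_right,
    Complex.conj_ofReal]
  ring

/-- The expansion of the eigenvalue, computed from one of the two constant spinors. -/
lemma isBigO_eigenvalue (hε₀ : 0 < ε₀) (he : IsCoframeFamily ε₀ g e) {K M : ℝ} (hM : 1 ≤ M)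
    (hpen : ∀ᶠ ε : ℝ in 𝓝 0, SmallPencil (planeWave (0, 0)) (planeWave (0, 1))
      sobolevIso (diracOp (cofE (e ε)) (axialE (e ε))) (densityOp fun x => (e ε x).det) conjOp
      K (M * |ε|)) {lam : ℝ → ℝ}
    (hlam : ∀ᶠ ε : ℝ in 𝓝 0, ‖(lam ε : ℂ)‖ ≤ 1 / (4 * K) ∧ ∀ c : SpinorL2, constProj c = c →
      diracOp (cofE (e ε)) (axialE (e ε)) (SmallPencil.lift (planeWave (0, 0)) (planeWave (0, 1))
        (diracOp (cofE (e ε)) (axialE (e ε))) (densityOp fun x => (e ε x).det) (lam ε) c) =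
      (lam ε : ℂ) • densityOp (fun x => (e ε x).det)
        (SmallPencil.lift (planeWave (0, 0)) (planeWave (0, 1))
          (diracOp (cofE (e ε)) (axialE (e ε))) (densityOp fun x => (e ε x).det) (lam ε) c))
    (i : Fin 2) :
    (fun ε : ℝ => (lam ε : ℂ) - (ε : ℂ) ^ 2 * (hat (axialE (coframeVar e)) 0 -
      inner ℂ (flatInv (firstOrderSpinor (coframeVar e) i)) (firstOrderSpinor (coframeVar e) i)))
      =O[𝓝 0] fun ε : ℝ => ε ^ 3 := by
  have h1 := isBigO_inner_diracOp hε₀ he i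
  have h2 := isBigO_quadratic flatInv (isBigO_diracOp_planeWave hε₀ he i)
  have hq : (fun ε : ℝ => inner ℂ (diracOp (cofE (e ε)) (axialE (e ε)) (planeWave (0, i)))
      (planeWave (0, i))) =O[𝓝 0] fun ε : ℝ => ε ^ 2 := by
    have hcu : (fun ε : ℝ => ε ^ 3) =O[𝓝 0] fun ε : ℝ => ε ^ 2 :=
      (isLittleO_pow_pow (by norm_num : 2 < 3)).isBigO
    have hc : (fun ε : ℝ => (ε : ℂ) ^ 2 * hat (axialE (coframeVar e)) 0)
        =O[𝓝 0] fun ε : ℝ => ε ^ 2 := by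
      refine IsBigO.of_bound ‖hat (axialE (coframeVar e)) 0‖ (Eventually.of_forall fun ε => ?_)
      rw [norm_mul, mul_comm, norm_pow, norm_pow, Complex.norm_real]
    exact ((h1.trans hcu).add hc).congr_left fun ε => by ring
  obtain ⟨K', hK'0, hK'⟩ := hq.exists_nonneg
  have h3 : (fun ε : ℝ => (lam ε : ℂ) -
      (inner ℂ (diracOp (cofE (e ε)) (axialE (e ε)) (planeWave (0, i))) (planeWave (0, i)) -
        inner ℂ (flatInv (diracOp (cofE (e ε)) (axialE (e ε)) (planeWave (0, i))))
          (diracOp (cofE (e ε)) (axialE (e ε)) (planeWave (0, i))))) =O[𝓝 0]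
      fun ε : ℝ => ε ^ 3 := by
    refine IsBigO.of_bound ((9 * K ^ 2 * (2 * K' + 10 * K) + 4 * K) * M ^ 3) ?_
    filter_upwards [hpen, hlam, hK'.bound] with ε hp hl hb
    have := hp.norm_eigenvalue_sub_le hl.1 hl.2 (constProj_planeWave i)
      (orthonormal_planeWave.1 _) (K' := K') (by
        refine hb.trans (mul_le_mul_of_nonneg_left ?_ hK'0)
        rw [norm_pow, Real.norm_eq_abs, mul_pow]
        exact le_mul_of_one_le_left (by positivity) (one_le_pow₀ hM))
    rw [show pairProj (planeWave (0, 0)) (planeWave (0, 1)) = constProj from rfl,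
      sobolevIso_sub_constProj] at this
    refine this.trans (le_of_eq ?_)
    rw [norm_pow, Real.norm_eq_abs]
    ring
  refine ((h3.add h1).sub h2).congr_left fun ε => ?_
  ring

/-- The eigenvalue of the pencil given by `SmallPencil.exists_eigenvalue` is the eigenvalue of
smallest modulus of the Dirac operator. Averaging its expansion over the two constant spinors gives
the coefficient. -/
lemma exists_eigenvalue_expansion (hε₀ : 0 < ε₀) (hg : IsMetricFamily ε₀ g)
    (he : IsCoframeFamily ε₀ g e) :
    ∃ lam : ℝ → ℝ,
      (∀ᶠ ε in 𝓝 (0 : ℝ),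
        Module.finrank ℂ (eigenspace (g ε) (e ε) (lam ε : ℂ)) = 2 ∧
        ∀ μ : ℂ, IsEigenvalue (g ε) (e ε) μ → μ ≠ (lam ε : ℂ) → |lam ε| < ‖μ‖) ∧
      (fun ε : ℝ => (lam ε : ℂ) - coeffC g * (ε : ℂ) ^ 2)
        =O[𝓝 0] fun ε : ℝ => ε ^ 3 := by
  have hs := he.smoothFamily
  obtain ⟨K, M, -, hM, hpen⟩ := exists_smallPencil hε₀ hs he.periodic he.identity
  set L : ℝ → SpinorL2 →L[ℂ] SpinorL2 := fun ε => diracOp (cofE (e ε)) (axialE (e ε))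
  set G : ℝ → SpinorL2 →L[ℂ] SpinorL2 := fun ε => densityOp fun x => (e ε x).det
  set N : ℝ → ℂ → SpinorL2 →L[ℂ] SpinorL2 := fun ε μ =>
    SmallPencil.lift (planeWave (0, 0)) (planeWave (0, 1)) (L ε) (G ε) μ
  -- For `ε` outside the range of perturbation theory the value of `lam` is arbitrary.
  have hex : ∀ ε : ℝ, ∃ μ : ℝ, SmallPencil (planeWave (0, 0)) (planeWave (0, 1))
      sobolevIso (L ε) (G ε) conjOp K (M * |ε|) → ‖(μ : ℂ)‖ ≤ 1 / (4 * K) ∧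
        ∀ c : SpinorL2, constProj c = c → L ε (N ε μ c) = (μ : ℂ) • G ε (N ε μ c) := by
    intro ε
    by_cases h : SmallPencil (planeWave (0, 0)) (planeWave (0, 1))
      sobolevIso (L ε) (G ε) conjOp K (M * |ε|)
    · obtain ⟨μ, hμ⟩ := h.exists_eigenvalue
      exact ⟨μ, fun _ => hμ⟩
    · exact ⟨0, fun h' => absurd h' h⟩
  choose lam hlam using hex
  refine ⟨lam, ?_, ?_⟩
  · filter_upwards [hpen, eventually_mem_Ioo hε₀] with ε hp hε
    obtain ⟨hsmall, hker⟩ := hlam ε hp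
    have hE := fun j α => (hs j α).contDiff_slice hε
    have h0 := det_ne_zero hg he hε
    have hmem := mem_eigenspace_iff (g := g ε) (e := e ε) (contDiff_cofE hE)
      ((smoothFamily_axialE hs).contDiff_slice hε).continuous (contDiff_det hE).continuous h0
      (det_smul_diracSymbol hE (he.metric ε hε) h0)
    refine ⟨hp.finrank_eq_two hsmall hker _ (hmem _), fun μ hμ hne => ?_⟩
    by_contra! hle
    obtain ⟨u, hu, hu0⟩ := (Submodule.ne_bot_iff _).1 hμ
    obtain ⟨f, rfl, hf⟩ := (hmem μ u).1 hu
    refine hne (hp.eigenvalue_unique hsmall hker (hle.trans ?_)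
      (fun h => hu0 (by rw [h, map_zero])) hf)
    rwa [Complex.norm_real, Real.norm_eq_abs] at hsmall
  · have hev := hpen.mono fun ε hp => hlam ε hp
    have h0 := isBigO_eigenvalue hε₀ he hM hpen hev 0
    have h1 := isBigO_eigenvalue hε₀ he hM hpen hev 1
    refine ((h0.add h1).const_mul_left (1 / 2 : ℂ)).congr_left fun ε => ?_
    rw [coeffC_eq hε₀ he, Fin.sum_univ_two]
    ring

end Family

end TorusDirac

end

theorem theorem1 (ε₀ : ℝ) (hε₀ : 0 < ε₀)
    (g e : ℝ → TorusDirac.R3 → Matrix (Fin 3) (Fin 3) ℝ)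
    (hg : TorusDirac.IsMetricFamily ε₀ g)
    (he : TorusDirac.IsCoframeFamily ε₀ g e) :
    (∀ α β γ, Summable (TorusDirac.coeffTerm g α β γ)) ∧
    ∃ lam : ℝ → ℝ,
      (∀ᶠ ε in 𝓝 (0 : ℝ),
        Module.finrank ℂ (TorusDirac.eigenspace (g ε) (e ε) (lam ε : ℂ)) = 2 ∧
        ∀ μ : ℂ, TorusDirac.IsEigenvalue (g ε) (e ε) μ → μ ≠ (lam ε : ℂ) → |lam ε| < ‖μ‖) ∧
      (fun ε : ℝ => (lam ε : ℂ) - TorusDirac.coeffC g * (ε : ℂ) ^ 2)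
        =O[𝓝 0] fun ε : ℝ => ε ^ 3 :=
  ⟨TorusDirac.summable_coeffTerm hε₀ he, TorusDirac.exists_eigenvalue_expansion hε₀ hg he⟩
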